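/- \textbf{Setting.} Let $\mathbf G$ (the set of individuals) be a standard Borel space, $\nu$ a $\sigma$-finite measure on it, and $I:\mathbf G\times\mathbf G\to\{0,1\}$ measurable, not necessarily symmetric; $I(\gamma,\theta)=1$ means that the presence of $\theta$ influences the birth rate of $\gamma$. Each individual occupies a subset of a fixed space; $\Lambda$ is a region of that space. Assume that $\{\theta:\theta\cap\Lambda\ne\emptyset\}$ is measurable with finite $\nu$-measure and that $\nu\{\theta: I(\gamma,\theta)=1\}<\infty$ for every $\gamma$. A cylinder $C=(\gamma,b,s)$ has basis $\gamma$, birth time $b$, lifetime $s$ and life $[b,b+s]$. Let $\mathbf C=\{(\Gamma_i,T_i,S_i):i\in J\}$ be the random set of cylinders of the free process: $\{(\Gamma_i,T_i)\}$ is a Poisson process on $\mathbf G\times\mathbb R$ with mean measure $\nu\times\mathrm{Lebesgue}$, and the $S_i$ are i.i.d. exponential of mean $1$, independent of $\{(\Gamma_i,T_i)\}$. A first-generation ancestor of $C$ is a $C'\in\mathbf C$ born before $C$, alive at the birth time of $C$, with $I(\mathrm{Basis}(C),\mathrm{Basis}(C'))=1$; the clan of ancestors of $C$ is the union of all generations.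 Let $\mathbf A^{\Lambda,0}$ be the set of all $C\in\mathbf C$ alive at time $0$ whose basis intersects $\Lambda$, together with their clans of ancestors, and for $t\ge0$ let $\mathbf A_t$ be the set of $C\in\mathbf A^{\Lambda,0}$ born in $[-t,0)$. Assume that almost surely $\mathbf A_t$ is finite for every $t$ (in particular, this holds when $\mathbf A^{\Lambda,0}$ is almost surely finite). For a finite set $\mathbf H$ of cylinders put $$\mathbf G(\mathbf H,\Lambda)=\{\theta: I(\mathrm{Basis}(C'),\theta)=1\text{ for some }C'\in\mathbf H\}\cup\{\theta:\theta\cap\Lambda\neq\emptyset\},$$ $$\mathrm{TI}(\mathbf H,\Lambda,\theta)=\min\{\mathrm{Birth}(C'):C'\in\mathbf H,\ I(\mathrm{Basis}(C'),\theta)=1\},\qquad \min\emptyset=0,$$ and $$L_tF(\mathbf H)=\int_{\mathbf G(\mathbf H,\Lambda)}\nu(d\theta)\int_{t+\mathrm{TI}(\mathbf H,\Lambda,\theta)}^\infty ds\,e^{-s}\,\bigl[F(\mathbf H\cup\{(\theta,-t,s)\})-F(\mathbf H)\bigr].$$ A test function is a bounded measurable function $F$ of finite sets of cylinders that depends only on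 the cylinders with basis in some measurable set of finite $\nu$-measure. Consider processes $(X_t)_{t\ge 0}$ whose values are finite sets of cylinders and whose paths are almost surely increasing and piecewise constant from the right, with $X_0=\emptyset$ a.s. Say that such an $X$ solves the evolution equation if, for all test functions $F$ and $0\le s\le t$, the variable $\int_s^tL_uF(X_u)\,du$ is integrable and $$\mathbb E\bigl(F(X_t)-F(X_s)\mid X_u,\,0\le u\le s\bigr)=\mathbb E\Bigl(\int_s^t L_uF(X_u)\,du\ \Big|\ X_u,\,0\le u\le s\Bigr)\quad\text{a.s.}$$ \textbf{Theorem.} (1) $(\mathbf A_t)_{t\ge0}$ is such a process (in particular it is increasing and $\mathbf A_0=\emptyset$) and it solves the evolution equation. (2) The evolution equation also holds in differential form: if $F$ is a test function, $t\ge0$, and $u\mapsto L_uF(\mathbf H)$ is right-continuous at $u=t$ for every $\mathbf H$, then, as $h\downarrow0$, $$\mathbb E\Bigl(\tfrac{F(\mathbf A_{t+h})-F(\mathbf A_t)}h\ \Big|\ \mathbf A_s,\,0\le s\le t\Bigr)\longrightarrow L_tF(\mathbf A_t)\quad\text{in }L^1.$$ (3) $(\mathbf A_t)_{t\ge0}$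 is a Markov process. (4) Almost surely $\bigcup_{t\ge0}\mathbf A_t=\mathbf A^{\Lambda,0}$, that is, $\mathbf A_t\uparrow\mathbf A^{\Lambda,0}$ as $t\to\infty$. (5) The initial condition and the evolution equation determine the law: every process $X$ as above, on any probability space, that solves the evolution equation has the same finite-dimensional distributions as $(\mathbf A_t)_{t\ge0}$, and $\bigcup_{t\ge0}X_t$ has the same law as $\mathbf A^{\Lambda,0}$ (the numbers of cylinders in finitely many measurable sets have the same joint law). -/

import Mathlib

open MeasureTheory ProbabilityTheory Filter Topology Set

namespace BackwardClan

/-! ### Cylinders and finite configurations of cylinders -/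

/-- A cylinder `(basis, birth time, lifetime)`. -/
abbrev Cylinder (𝔾 : Type*) := 𝔾 × ℝ × ℝ

namespace Cylinder

variable {𝔾 : Type*}

/-- The individual at the basis of the cylinder. -/
def basis (C : Cylinder 𝔾) : 𝔾 := C.1

/-- The birth time. -/
def birth (C : Cylinder 𝔾) : ℝ := C.2.1

/-- The death time, birth time plus lifetime. -/
def death (C : Cylinder 𝔾) : ℝ := C.2.1 + C.2.2

/-- The time interval during which the cylinder is alive. -/
def life (C : Cylinder 𝔾) : Set ℝ := Icc C.birth C.death

end Cylinder

/-- Finite sets of cylinders. -/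
@[ext]
structure Config (𝔾 : Type*) where
  carrier : Set (Cylinder 𝔾)
  finite : carrier.Finite

namespace Config

variable {𝔾 : Type*}

/-- The empty configuration. -/
def empty : Config 𝔾 := ⟨∅, finite_empty⟩

/-- Add one cylinder to a configuration. -/
def add (a : Config 𝔾) (C : Cylinder 𝔾) : Config 𝔾 :=
  ⟨a.carrier ∪ {C}, a.finite.union (finite_singleton C)⟩

/-- The usual σ-algebra on finite point configurations, generated by the numbers of points in
measurable sets. -/
noncomputable instance [MeasurableSpace 𝔾] : MeasurableSpace (Config 𝔾) :=
  ⨆ D : {D : Set (Cylinder 𝔾) // MeasurableSet D},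
    MeasurableSpace.comap (fun a : Config 𝔾 => (a.carrier ∩ D.1).ncard) ⊤

end Config

/-! ### The free process: Poisson births and independent exponential lifetimes -/

section Free

variable {𝔾 Ω J : Type*} [MeasurableSpace 𝔾] [MeasurableSpace Ω]

/-- The random points `x i`, `i ∈ J`, form a Poisson process with mean measure `m`: the number of
points in a set of finite mean is Poisson distributed, and the numbers of points in disjoint sets
are independent. -/
structure IsPoisson {X : Type*} [MeasurableSpace X] (P : Measure Ω) (m : Measure X)
    (x : J → Ω → X) : Prop where
  measurable : ∀ i, Measurable (x i)
  law : ∀ B : Set X, MeasurableSet B → m B < ⊤ → ∀ k : ℕ,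
    P {ω | {i | x i ω ∈ B}.encard = (k : ℕ∞)} =
      ENNReal.ofReal (Real.exp (-(m B).toReal) * (m B).toReal ^ k / (Nat.factorial k : ℝ))
  indep : ∀ B : ℕ → Set X, (∀ k, MeasurableSet (B k)) → Pairwise (fun k l => Disjoint (B k) (B l)) →
    iIndepFun (fun k ω => {i | x i ω ∈ B k}.encard) P

/-- Random cylinders with bases `Γ i`, birth times `T i` and lifetimes `S i`, `i ∈ J`: the pairs
`(Γ i, T i)` form a Poisson process with mean measure `ν × Lebesgue`; the lifetimes are independent
exponential variables of mean one, independent of the bases and births. -/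
structure IsFreeCylinders (P : Measure Ω) (ν : Measure 𝔾)
    (Γ : J → Ω → 𝔾) (T S : J → Ω → ℝ) : Prop where
  poisson : IsPoisson P (ν.prod (volume : Measure ℝ)) (fun i ω => (Γ i ω, T i ω))
  measurable_lifetime : ∀ i, Measurable (S i)
  law_lifetime : ∀ i, P.map (S i) = expMeasure 1
  indep_lifetime : iIndepFun S P
  indep_poisson : IndepFun (fun ω i => S i ω) (fun ω i => (Γ i ω, T i ω)) P

/-- The random set of all cylinders. -/
def cylinders (Γ : J → Ω → 𝔾) (T S : J → Ω → ℝ) (ω : Ω) : Set (Cylinder 𝔾) :=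
  range fun i => (Γ i ω, T i ω, S i ω)

end Free

/-! ### Ancestors and clans -/

section Clan

variable {𝔾 E : Type*}

/-- `C'` is a first-generation ancestor of `C` in the set `𝒞` of cylinders: it is born before `C`,
is alive at the birth of `C`, and its basis has an influence on the birth rate of the basis of
`C`. -/
def FirstAncestor (I : 𝔾 → 𝔾 → Prop) (𝒞 : Set (Cylinder 𝔾)) (C C' : Cylinder 𝔾) : Prop :=
  C' ∈ 𝒞 ∧ I C.basis C'.basis ∧ C'.birth < C.birth ∧ C.birth ∈ C'.life

/-- The clan of ancestors of `C`: all generations `n ≥ 1`. -/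
def clanOf (I : 𝔾 → 𝔾 → Prop) (𝒞 : Set (Cylinder 𝔾)) (C : Cylinder 𝔾) : Set (Cylinder 𝔾) :=
  {C' | Relation.TransGen (FirstAncestor I 𝒞) C C'}

/-- The individuals intersecting the region `Λ`; the individual `θ` occupies the set `body θ`. -/
def meeting (body : 𝔾 → Set E) (Λ : Set E) : Set 𝔾 := {θ | (body θ ∩ Λ).Nonempty}

/-- The cylinders alive at time `0` whose basis intersects `Λ`. -/
def aliveAtZero (body : 𝔾 → Set E) (Λ : Set E) (𝒞 : Set (Cylinder 𝔾)) : Set (Cylinder 𝔾) :=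
  {C ∈ 𝒞 | C.basis ∈ meeting body Λ ∧ (0 : ℝ) ∈ C.life}

/-- The clan of `Λ × {0}`: the cylinders alive at time `0` whose basis intersects `Λ`, together with
their clans of ancestors. -/
def clan (I : 𝔾 → 𝔾 → Prop) (body : 𝔾 → Set E) (Λ : Set E) (𝒞 : Set (Cylinder 𝔾)) :
    Set (Cylinder 𝔾) :=
  aliveAtZero body Λ 𝒞 ∪ ⋃ C ∈ aliveAtZero body Λ 𝒞, clanOf I 𝒞 C

/-- The members of the clan of `Λ × {0}` born in the time interval `[-t, 0)`. -/
def clanSince (I : 𝔾 → 𝔾 → Prop) (body : 𝔾 → Set E) (Λ : Set E) (𝒞 : Set (Cylinder 𝔾)) (t : ℝ) :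
    Set (Cylinder 𝔾) :=
  {C ∈ clan I body Λ 𝒞 | -t ≤ C.birth ∧ C.birth < 0}

open Classical in
/-- `clanSince` as a finite configuration (empty by convention where `clanSince` is infinite). -/
noncomputable def clanConfig (I : 𝔾 → 𝔾 → Prop) (body : 𝔾 → Set E) (Λ : Set E)
    (𝒞 : Set (Cylinder 𝔾)) (t : ℝ) : Config 𝔾 :=
  if h : (clanSince I body Λ 𝒞 t).Finite then ⟨clanSince I body Λ 𝒞 t, h⟩ else Config.empty

/-- The bases of the potential ancestors of `H` and `Λ × {0}`. -/
def potential (I : 𝔾 → 𝔾 → Prop) (body : 𝔾 → Set E) (Λ : Set E) (H : Config 𝔾) : Set 𝔾 :=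
  {θ | ∃ C' ∈ H.carrier, I C'.basis θ} ∪ meeting body Λ

/-- The earliest birth time among the cylinders of `H` whose basis is influenced by `θ`. The set is
finite, so the infimum is a minimum, and it is `0` when the set is empty. -/
noncomputable def TI (I : 𝔾 → 𝔾 → Prop) (H : Config 𝔾) (θ : 𝔾) : ℝ :=
  sInf {b | ∃ C' ∈ H.carrier, I C'.basis θ ∧ C'.birth = b}

end Clan

/-! ### The evolution equation -/

section Evolution

variable {𝔾 E Ω : Type*} [MeasurableSpace 𝔾]

/-- Test functions: bounded measurable functions of a finite configuration that depend only on the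
cylinders with basis in some set of finite `ν`-measure. -/
structure IsTest (ν : Measure 𝔾) (F : Config 𝔾 → ℝ) : Prop where
  measurable : Measurable F
  bounded : ∃ K : ℝ, ∀ a, |F a| ≤ K
  isLocal : ∃ B : Set 𝔾, MeasurableSet B ∧ ν B < ⊤ ∧ ∀ a a' : Config 𝔾,
    (∀ C : Cylinder 𝔾, C.basis ∈ B → (C ∈ a.carrier ↔ C ∈ a'.carrier)) → F a = F a'

/-- The generator at time `t`: a cylinder with basis `θ`, birth time `-t` and lifetime `s` is added
to `a` at rate `ν(dθ) e^{-s} ds`, for `θ` a potential ancestor and `s > t + TI(a, θ)`. -/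
noncomputable def generator (ν : Measure 𝔾) (I : 𝔾 → 𝔾 → Prop) (body : 𝔾 → Set E) (Λ : Set E)
    (t : ℝ) (F : Config 𝔾 → ℝ) (a : Config 𝔾) : ℝ :=
  ∫ θ in potential I body Λ a,
    (∫ s in Ioi (t + TI I a θ), Real.exp (-s) * (F (a.add (θ, -t, s)) - F a)) ∂ν

/-- The information contained in `X u`, `0 ≤ u ≤ t`. -/
@[reducible]
noncomputable def history (X : ℝ → Ω → Config 𝔾) (t : ℝ) : MeasurableSpace Ω :=
  ⨆ u ∈ Icc (0 : ℝ) t, MeasurableSpace.comap (X u) inferInstance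

/-- `X t`, `t ≥ 0`, is a growing jump process with values in the finite sets of cylinders that
starts from the empty set and satisfies the evolution equation, in integrated form:
`E[F(X t) - F(X s) | X u, u ≤ s] = E[∫ u in s..t, (generator u F)(X u) | X u, u ≤ s]`. -/
structure SolvesEvolution [MeasurableSpace Ω] (P : Measure Ω) (ν : Measure 𝔾)
    (I : 𝔾 → 𝔾 → Prop) (body : 𝔾 → Set E) (Λ : Set E) (X : ℝ → Ω → Config 𝔾) : Prop where
  measurable : ∀ t, 0 ≤ t → Measurable (X t)
  init : ∀ᵐ ω ∂P, X 0 ω = Config.empty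
  mono : ∀ᵐ ω ∂P, ∀ s t, 0 ≤ s → s ≤ t → (X s ω).carrier ⊆ (X t ω).carrier
  right_cont : ∀ᵐ ω ∂P, ∀ t, 0 ≤ t → ∀ᶠ u in 𝓝[>] t, X u ω = X t ω
  integrable : ∀ F, IsTest ν F → ∀ s t, 0 ≤ s → s ≤ t →
    Integrable (fun ω => ∫ u in s..t, generator ν I body Λ u F (X u ω)) P
  evolution : ∀ F, IsTest ν F → ∀ s t, 0 ≤ s → s ≤ t →
    P[fun ω => F (X t ω) - F (X s ω) | history X s] =ᵐ[P]
      P[fun ω => ∫ u in s..t, generator ν I body Λ u F (X u ω) | history X s]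

end Evolution

end BackwardClan

open scoped Interval

set_option linter.unusedSectionVars false

namespace BackwardClan

/-! ### Random sets observed through hitting events -/

section RandomSets

open MeasurableSpace

variable {X : Type*} [MeasurableSpace X] [CountablyGenerated X]

/-! The clan solves the equation. Let `a` be the set of clan members born in `[-r, 0)`. A cylinder
born just before `-r` belongs to the clan exactly when its basis is a potential ancestor of `a` and
it lives until the earliest birth among the members of `a` that it influences, or until time `0` if
it influences none (`mem_clan_of_mem_attached`, `mem_attached_of_mem_clan`). Cylinders born before
`-r` are independent of those born later, and their mean measure is `ν × Lebesgue × Exp(1)`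
(`IsFreeCylinders.independentOutside`). Hence the mean contribution of a thin strip of births, given
the history, is the time integral of the generator with the configuration frozen at `a`
(`setIntegral_jump`, `setIntegral_sum_jump`). Births are almost surely distinct, so on a fine grid
each strip holds at most one clan member and the increments of `F` are sums of such contributions.
Refining the grid unfreezes the configuration and gives the evolution equation
(`setIntegral_increment_clanProcess`).

Uniqueness. Weighting a solution by a bounded function of its history up to time `s` leaves a
`WeakSolution` from `s` on, so it is enough that a weak solution is determined in law by its law at
time `s` (`WeakSolution.map_eq`). Local test functions give a forward equation `value + loss =
initial value + gain`. It extends to nonlocal functions supported by configurations of a fixed size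
`n` (`WeakSolution.lintegral_forward`), because the error caused by bases outside a large set is at
most the probability that such a basis is present at time `t`
(`WeakSolution.lintegral_generator_le`). As paths only grow, one cylinder at a time, the gain into
size `n` comes from size `n - 1`, and induction on `n` leaves only the loss to compare. Where `ν
(potential I body Λ a) ≤ M` the loss rate is at most `M`, and iteration bounds the difference of two
solutions by a multiple of `(M (t - s)) ^ j / j!`, which tends to `0`; finally `M → ∞`.

Consequences. Indicators of past events as weights give the finite-dimensional distributions. The
weights `1_W` and `P(W | X s)` give `X s` the same law, hence also `X t`, and this is the Markov
property. The differential form holds because conditional expectation contracts `L¹` and paths are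
constant to the right of `t`. The limit is a measurable function of the path at integer times. -/

lemma countablePartitionSet_eq_of_succ {n : ℕ} {x y : X}
    (h : countablePartitionSet (n + 1) x = countablePartitionSet (n + 1) y) :
    countablePartitionSet n x = countablePartitionSet n y := by
  have hs := measurableSet_succ_countablePartition n (countablePartitionSet_mem n x)
  rw [measurableSet_generateFrom_countablePartition_iff] at hs
  obtain ⟨S, hS, hSx⟩ := hs
  have hx : x ∈ ⋃₀ (S : Set (Set X)) := hSx ▸ mem_countablePartitionSet n x
  obtain ⟨c, hc, hxc⟩ := hx
  have hcx : countablePartitionSet (n + 1) x = c := countablePartitionSet_of_mem (hS hc) hxc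
  have hyc : y ∈ c := by rw [← hcx, h]; exact mem_countablePartitionSet _ _
  have hy : y ∈ countablePartitionSet n x := by
    rw [hSx]
    exact ⟨c, hc, hyc⟩
  exact (countablePartitionSet_of_mem (countablePartitionSet_mem n x) hy).symm

/-- The partitions refine each other, so two points that share a cell at arbitrarily late levels
share it at all levels; they would then lie in the same sets of a generating family, which separates
points. -/
lemma eventually_countablePartitionSet_ne [SeparatesPoints X] {x y : X} (hxy : x ≠ y) :
    ∀ᶠ n in atTop, countablePartitionSet n x ≠ countablePartitionSet n y := by
  by_contra hcon
  rw [not_eventually] at hcon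
  simp only [ne_eq, not_not] at hcon
  have hdown : ∀ n k : ℕ, countablePartitionSet (n + k) x = countablePartitionSet (n + k) y →
      countablePartitionSet n x = countablePartitionSet n y := by
    intro n k
    induction k with
    | zero => exact id
    | succ k ih => exact fun h => ih (countablePartitionSet_eq_of_succ h)
  have hall : ∀ n, countablePartitionSet n x = countablePartitionSet n y := by
    intro n
    obtain ⟨m, hm, hmn⟩ := (frequently_atTop.mp hcon) n
    obtain ⟨k, rfl⟩ := Nat.exists_eq_add_of_le hm
    exact hdown n k hmn
  have hsep : @SeparatesPoints X (generateFrom (⋃ n, countablePartition X n)) := by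
    rw [generateFrom_iUnion_countablePartition]; infer_instance
  refine hxy (@separating_of_generateFrom X _ hsep x y ?_)
  intro s hs
  obtain ⟨n, hn⟩ := mem_iUnion.mp hs
  rw [← countablePartitionSet_eq_iff x hn, ← countablePartitionSet_eq_iff y hn, hall n]

/-- Finitely many distinct points are eventually in distinct cells, so counting reduces to countably
many questions of whether a cell is hit. This is why hitting events determine all counts. -/
lemma natCast_le_encard_iff [SeparatesPoints X] (S : Set X) (k : ℕ) :
    (k : ℕ∞) ≤ S.encard ↔ ∃ n : ℕ, ∃ t : Finset (countablePartition X n), t.card = k ∧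
      ∀ c ∈ t, (S ∩ (c : Set X)).Nonempty := by
  constructor
  · intro h
    obtain ⟨u, huS, huk⟩ := exists_subset_encard_eq h
    have hufin : u.Finite := finite_of_encard_eq_coe huk
    have hev : ∀ᶠ n in atTop, ∀ x ∈ u, ∀ y ∈ u, x ≠ y →
        countablePartitionSet n x ≠ countablePartitionSet n y := by
      rw [eventually_all_finite hufin]
      intro x _
      rw [eventually_all_finite hufin]
      intro y _
      by_cases hxy : x = y
      · simp [hxy]
      · filter_upwards [eventually_countablePartitionSet_ne hxy] with n hn _ using hn
    obtain ⟨n, hn⟩ := hev.exists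
    classical
    let f : X → countablePartition X n :=
      fun x => ⟨countablePartitionSet n x, countablePartitionSet_mem n x⟩
    have hinj : Set.InjOn f u := by
      intro x hx y hy hxy
      by_contra hne
      exact hn x hx y hy hne (congrArg Subtype.val hxy)
    refine ⟨n, hufin.toFinset.image f, ?_, ?_⟩
    · rw [Finset.card_image_of_injOn (by simpa using hinj)]
      rw [hufin.encard_eq_coe_toFinset_card] at huk
      exact_mod_cast huk
    · intro c hc
      obtain ⟨x, hx, rfl⟩ := Finset.mem_image.mp hc
      exact ⟨x, huS (hufin.mem_toFinset.mp hx), mem_countablePartitionSet n x⟩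
  · rintro ⟨n, t, rfl, ht⟩
    rcases isEmpty_or_nonempty X with hX | hX
    · have : t = ∅ := Finset.eq_empty_of_forall_notMem fun c hc =>
        (ht c hc).elim fun x _ => hX.elim x
      simp [this]
    choose! g hg using ht
    have hinj : Set.InjOn g (t : Set (countablePartition X n)) := by
      intro c hc d hd hcd
      by_contra hne
      have := disjoint_countablePartition c.2 d.2 (fun h => hne (Subtype.ext h))
      exact (Set.disjoint_left.mp this) (hg c hc).2 (by rw [hcd]; exact (hg d hd).2)
    calc ((t.card : ℕ) : ℕ∞) = (t : Set (countablePartition X n)).encard := by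
          rw [encard_coe_eq_coe_finsetCard]
      _ = (g '' (t : Set (countablePartition X n))).encard := hinj.encard_image.symm
      _ ≤ S.encard := encard_le_encard (by
          rintro _ ⟨c, hc, rfl⟩
          exact (hg c hc).1)

variable [SeparatesPoints X]

/-- A random set is measurable if it can be told whether it hits a given measurable set. -/
def HitMeasurable {α : Type*} (m : MeasurableSpace α) (𝒮 : α → Set X) : Prop :=
  ∀ B, MeasurableSet B → MeasurableSet[m] {ω | (𝒮 ω ∩ B).Nonempty}

lemma HitMeasurable.encard {α : Type*} {m : MeasurableSpace α} {𝒮 : α → Set X}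
    (h : HitMeasurable m 𝒮) {B : Set X} (hB : MeasurableSet B) :
    Measurable[m] fun ω => (𝒮 ω ∩ B).encard := by
  have hle : ∀ k : ℕ, MeasurableSet[m] {ω | (k : ℕ∞) ≤ (𝒮 ω ∩ B).encard} := by
    intro k
    simp only [natCast_le_encard_iff, ofPred_exists]
    refine MeasurableSet.iUnion fun n => MeasurableSet.iUnion fun t => ?_
    by_cases ht : t.card = k
    · simp only [ht, true_and, ofPred_forall]
      refine MeasurableSet.biInter (to_countable _) fun c _ => ?_
      simp only [inter_assoc]
      exact h _ (hB.inter (measurableSet_countablePartition n c.2))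
    · simp [ht]
  refine ENat.measurable_iff.mpr fun n => ?_
  have : (fun ω => (𝒮 ω ∩ B).encard) ⁻¹' {(n : ℕ∞)} =
      {ω | (n : ℕ∞) ≤ (𝒮 ω ∩ B).encard} \ {ω | ((n + 1 : ℕ) : ℕ∞) ≤ (𝒮 ω ∩ B).encard} := by
    ext ω
    change (𝒮 ω ∩ B).encard = n ↔ (n : ℕ∞) ≤ (𝒮 ω ∩ B).encard ∧
      ¬ ((n + 1 : ℕ) : ℕ∞) ≤ (𝒮 ω ∩ B).encard
    rw [not_le]
    constructor
    · intro h; rw [h]; exact ⟨le_rfl, by exact_mod_cast Nat.lt_succ_self n⟩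
    · rintro ⟨h1, h2⟩
      refine le_antisymm ?_ h1
      push_cast at h2
      exact Order.le_of_lt_add_one h2
  rw [this]
  exact (hle n).diff (hle (n + 1))

/-- Joint measurability of hitting, for a random set with finitely many points in each piece of a
countable cover. -/
lemma HitMeasurable.exists_mem {α : Type*} {m : MeasurableSpace α} {𝒮 : α → Set X}
    (h : HitMeasurable m 𝒮) {B : ℕ → Set X} (hB : ∀ k, MeasurableSet (B k))
    (hcov : ⋃ k, B k = univ) (hfin : ∀ ω k, (𝒮 ω ∩ B k).Finite)
    {R : Set (α × X)} (hR : MeasurableSet R) :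
    MeasurableSet[m] {ω | ∃ x ∈ 𝒮 ω, (ω, x) ∈ R} := by
  have := MeasurableSpace.measurableSingletonClass_of_countablySeparated (α := X)
  -- Counting measure on each finite piece of the random set is a finite kernel, for which the
  -- measure of a section of a measurable set is measurable; a point in the section exists when one
  -- of these measures is nonzero.
  let μ : ℕ → α → Measure X := fun k ω => Measure.count.restrict (𝒮 ω ∩ B k)
  have happ : ∀ k ω (E : Set X), MeasurableSet E →
      μ k ω E = ((𝒮 ω ∩ (B k ∩ E)).encard : ENNReal) := by
    intro k ω E hE
    simp only [μ]
    rw [Measure.restrict_apply hE, Measure.count_apply (hE.inter (hfin ω k).measurableSet)]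
    congr 2
    ext x; simp; tauto
  have hmeas : ∀ k, Measurable (μ k) := by
    intro k
    refine Measure.measurable_of_measurable_coe _ fun E hE => ?_
    simp only [happ k _ E hE]
    exact (measurable_of_countable (fun n : ℕ∞ => (n : ENNReal))).comp (h.encard ((hB k).inter hE))
  have hfinite : ∀ k ω, IsFiniteMeasure (μ k ω) := by
    intro k ω
    refine ⟨?_⟩
    rw [happ k ω univ MeasurableSet.univ]
    have : (𝒮 ω ∩ (B k ∩ univ)).Finite := by simpa using hfin ω k
    rw [this.encard_eq_coe]
    simp
  have key : {ω | ∃ x ∈ 𝒮 ω, (ω, x) ∈ R} =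
      ⋃ k, {ω | μ k ω (Prod.mk ω ⁻¹' R) ≠ 0} := by
    ext ω
    simp only [mem_ofPred_eq, mem_iUnion]
    have h0 : ∀ k, μ k ω (Prod.mk ω ⁻¹' R) ≠ 0 ↔
        (𝒮 ω ∩ (B k ∩ Prod.mk ω ⁻¹' R)).Nonempty := by
      intro k
      rw [happ k ω _ (measurable_prodMk_left hR), ← encard_ne_zero]
      simp
    simp only [h0]
    constructor
    · rintro ⟨x, hx, hxR⟩
      obtain ⟨k, hk⟩ := mem_iUnion.mp (hcov.symm ▸ mem_univ x)
      exact ⟨k, x, hx, hk, hxR⟩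
    · rintro ⟨k, x, hx, _, hxR⟩
      exact ⟨x, hx, hxR⟩
  rw [key]
  refine MeasurableSet.iUnion fun k => ?_
  have := Kernel.measurable_kernel_prodMk_left_of_finite (κ := ⟨μ k, hmeas k⟩) hR (hfinite k)
  exact (this (measurableSet_singleton 0)).compl

end RandomSets

/-! ### Measurability on the space of configurations -/

namespace Config

variable {𝔾 : Type*} [MeasurableSpace 𝔾]

lemma measurable_ncard {D : Set (Cylinder 𝔾)} (hD : MeasurableSet D) :
    Measurable fun a : Config 𝔾 => (a.carrier ∩ D).ncard := by
  rw [measurable_iff_comap_le]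
  exact le_iSup (fun D : {D : Set (Cylinder 𝔾) // MeasurableSet D} =>
    MeasurableSpace.comap (fun a : Config 𝔾 => (a.carrier ∩ D.1).ncard) ⊤) ⟨D, hD⟩

lemma measurable_of_ncard {α : Type*} {m : MeasurableSpace α} {f : α → Config 𝔾}
    (h : ∀ D, MeasurableSet D → Measurable[m] fun ω => ((f ω).carrier ∩ D).ncard) :
    Measurable[m] f := by
  rw [measurable_iff_comap_le, instMeasurableSpace]
  simp only [MeasurableSpace.comap_iSup, MeasurableSpace.comap_comp, iSup_le_iff]
  exact fun D => measurable_iff_comap_le.mp (h D.1 D.2)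

lemma hitMeasurable_carrier [StandardBorelSpace 𝔾] :
    HitMeasurable inferInstance (fun a : Config 𝔾 => a.carrier) := by
  intro B hB
  have : {a : Config 𝔾 | (a.carrier ∩ B).Nonempty} =
      (fun a : Config 𝔾 => (a.carrier ∩ B).ncard) ⁻¹' {0}ᶜ := by
    ext a
    simp only [mem_ofPred_eq, mem_preimage, mem_compl_iff, mem_singleton_iff,
      ncard_eq_zero (a.finite.subset inter_subset_left), nonempty_iff_ne_empty]
  rw [this]
  exact measurable_ncard hB (by trivial)

/-- A random set with finitely many points, as a measurable random configuration. -/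
lemma measurable_of_hitMeasurable [StandardBorelSpace 𝔾] {α : Type*} {m : MeasurableSpace α}
    {f : α → Config 𝔾} (h : HitMeasurable m fun ω => (f ω).carrier) : Measurable[m] f :=
  measurable_of_ncard fun _ hD => (measurable_of_countable ENat.toNat).comp (h.encard hD)

variable [StandardBorelSpace 𝔾]

/-- Lets sets defined by quantifying over the cylinders of a configuration, as in `potential`, `TI`
or `misplaced`, be measurable without a measurable enumeration of the cylinders. -/
lemma measurableSet_exists {α : Type*} [MeasurableSpace α] {f : α → Config 𝔾} (hf : Measurable f)
    {R : Set (α × Cylinder 𝔾)} (hR : MeasurableSet R) :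
    MeasurableSet {p : α | ∃ C ∈ (f p).carrier, (p, C) ∈ R} := by
  refine HitMeasurable.exists_mem (𝒮 := fun p => (f p).carrier) (B := fun _ => univ) ?_
    (fun _ => MeasurableSet.univ) (iUnion_const _) ?_ hR
  · intro B hB
    exact hf (hitMeasurable_carrier B hB)
  · intro p _
    simpa using (f p).finite

lemma measurable_add : Measurable fun p : Config 𝔾 × Cylinder 𝔾 => p.1.add p.2 := by
  refine measurable_of_hitMeasurable fun B hB => ?_
  have : {p : Config 𝔾 × Cylinder 𝔾 | ((p.1.add p.2).carrier ∩ B).Nonempty} =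
      Prod.fst ⁻¹' {a : Config 𝔾 | (a.carrier ∩ B).Nonempty} ∪ Prod.snd ⁻¹' B := by
    ext p
    simp only [add, mem_ofPred_eq, mem_union, mem_preimage, union_inter_distrib_right,
      union_nonempty, singleton_inter_nonempty]
  rw [this]
  exact (measurable_fst (hitMeasurable_carrier B hB)).union (measurable_snd hB)

/-- The part of a configuration with basis in `B`. -/
def restrict (a : Config 𝔾) (B : Set 𝔾) : Config 𝔾 :=
  ⟨{C ∈ a.carrier | C.basis ∈ B}, a.finite.subset (sep_subset _ _)⟩

lemma measurable_restrict {B : Set 𝔾} (hB : MeasurableSet B) :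
    Measurable fun a : Config 𝔾 => a.restrict B := by
  refine measurable_of_ncard fun D hD => ?_
  have : ∀ a : Config 𝔾, (a.restrict B).carrier ∩ D = a.carrier ∩ (Prod.fst ⁻¹' B ∩ D) := by
    intro a; ext C; simp [restrict, Cylinder.basis, and_assoc]
  simp only [this]
  exact measurable_ncard ((measurable_fst hB).inter hD)

lemma measurableSet_subset {B : Set (Cylinder 𝔾)} (hB : MeasurableSet B) :
    MeasurableSet {a : Config 𝔾 | a.carrier ⊆ B} := by
  have : {a : Config 𝔾 | a.carrier ⊆ B} = {a : Config 𝔾 | (a.carrier ∩ Bᶜ).Nonempty}ᶜ := by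
    ext a
    simp only [mem_ofPred_eq, mem_compl_iff, not_nonempty_iff_eq_empty,
      ← disjoint_iff_inter_eq_empty, disjoint_compl_right_iff_subset]
  rw [this]
  exact (hitMeasurable_carrier _ hB.compl).compl

end Config

/-! ### Potential ancestors and the earliest influenced birth. -/

section PotentialMeasurable

variable {𝔾 E : Type*} [MeasurableSpace 𝔾] [StandardBorelSpace 𝔾]
  {I : 𝔾 → 𝔾 → Prop} {body : 𝔾 → Set E} {Λ : Set E}

lemma measurableSet_potential_prod (hI : MeasurableSet {p : 𝔾 × 𝔾 | I p.1 p.2})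
    (hΛ : MeasurableSet (meeting body Λ)) :
    MeasurableSet {p : Config 𝔾 × 𝔾 | p.2 ∈ potential I body Λ p.1} := by
  have h1 : MeasurableSet {p : Config 𝔾 × 𝔾 | ∃ C ∈ p.1.carrier, I C.basis p.2} := by
    refine Config.measurableSet_exists (f := Prod.fst) measurable_fst
      (R := {q : (Config 𝔾 × 𝔾) × Cylinder 𝔾 | I q.2.basis q.1.2}) ?_
    exact ((measurable_fst.comp measurable_snd).prodMk (measurable_snd.comp measurable_fst)) hI
  exact h1.union (measurable_snd hΛ)

lemma measurableSet_potential (hI : MeasurableSet {p : 𝔾 × 𝔾 | I p.1 p.2})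
    (hΛ : MeasurableSet (meeting body Λ)) (a : Config 𝔾) :
    MeasurableSet (potential I body Λ a) :=
  measurable_prodMk_left (x := a) (measurableSet_potential_prod hI hΛ)

lemma measure_potential_lt_top {ν : Measure 𝔾} (hΛfin : ν (meeting body Λ) < ⊤)
    (hIfin : ∀ γ, ν {θ | I γ θ} < ⊤) (a : Config 𝔾) : ν (potential I body Λ a) < ⊤ := by
  have : potential I body Λ a ⊆ (⋃ C ∈ a.carrier, {θ | I C.basis θ}) ∪ meeting body Λ := by
    rintro θ (⟨C, hC, hI⟩ | h)
    · exact Or.inl (mem_biUnion hC hI)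
    · exact Or.inr h
  refine (measure_mono this).trans_lt ((measure_union_le _ _).trans_lt ?_)
  refine ENNReal.add_lt_top.mpr ⟨?_, hΛfin⟩
  exact measure_biUnion_lt_top a.finite fun C _ => hIfin _

lemma finite_influenced_births (a : Config 𝔾) (θ : 𝔾) :
    {b | ∃ C' ∈ a.carrier, I C'.basis θ ∧ C'.birth = b}.Finite := by
  refine (a.finite.image Cylinder.birth).subset ?_
  rintro b ⟨C, hC, _, rfl⟩
  exact mem_image_of_mem _ hC

lemma TI_le {a : Config 𝔾} {θ : 𝔾} {C : Cylinder 𝔾} (hC : C ∈ a.carrier) (hI : I C.basis θ) :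
    TI I a θ ≤ C.birth :=
  csInf_le (finite_influenced_births a θ).bddBelow ⟨C, hC, hI, rfl⟩

lemma TI_eq_zero {a : Config 𝔾} {θ : 𝔾} (h : ¬ ∃ C ∈ a.carrier, I C.basis θ) : TI I a θ = 0 := by
  have : {b | ∃ C' ∈ a.carrier, I C'.basis θ ∧ C'.birth = b} = ∅ := by
    ext b
    simp only [mem_ofPred_eq, mem_empty_iff_false, iff_false]
    rintro ⟨C, hC, hI, _⟩
    exact h ⟨C, hC, hI⟩
  rw [TI, this, Real.sInf_empty]

lemma exists_birth_eq_TI {a : Config 𝔾} {θ : 𝔾} (h : ∃ C ∈ a.carrier, I C.basis θ) :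
    ∃ C ∈ a.carrier, I C.basis θ ∧ C.birth = TI I a θ := by
  obtain ⟨C, hC, hI⟩ := h
  have hne : {b | ∃ C' ∈ a.carrier, I C'.basis θ ∧ C'.birth = b}.Nonempty :=
    ⟨C.birth, C, hC, hI, rfl⟩
  exact hne.csInf_mem (finite_influenced_births a θ)

lemma measurable_TI (hI : MeasurableSet {p : 𝔾 × 𝔾 | I p.1 p.2}) :
    Measurable fun p : Config 𝔾 × 𝔾 => TI I p.1 p.2 := by
  have hmI : MeasurableSet {q : (Config 𝔾 × 𝔾) × Cylinder 𝔾 | I q.2.basis q.1.2} :=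
    ((measurable_fst.comp measurable_snd).prodMk (measurable_snd.comp measurable_fst)) hI
  have hE : MeasurableSet {p : Config 𝔾 × 𝔾 | ∃ C ∈ p.1.carrier, I C.basis p.2} :=
    Config.measurableSet_exists (f := Prod.fst) measurable_fst hmI
  refine measurable_of_Iio fun r => ?_
  have hr : MeasurableSet {p : Config 𝔾 × 𝔾 | ∃ C ∈ p.1.carrier, I C.basis p.2 ∧ C.birth < r} := by
    refine Config.measurableSet_exists (f := Prod.fst) measurable_fst
      (R := {q : (Config 𝔾 × 𝔾) × Cylinder 𝔾 | I q.2.basis q.1.2 ∧ q.2.birth < r}) ?_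
    exact hmI.inter ((measurable_fst.comp (measurable_snd.comp measurable_snd)) measurableSet_Iio)
  -- The second set accounts for the value `0` of `TI` when nothing is influenced.
  have : (fun p : Config 𝔾 × 𝔾 => TI I p.1 p.2) ⁻¹' Iio r =
      {p : Config 𝔾 × 𝔾 | ∃ C ∈ p.1.carrier, I C.basis p.2 ∧ C.birth < r} ∪
      ({p : Config 𝔾 × 𝔾 | ∃ C ∈ p.1.carrier, I C.basis p.2}ᶜ ∩ {_p | (0 : ℝ) < r}) := by
    ext p
    simp only [mem_preimage, mem_Iio, mem_union, mem_inter_iff, mem_compl_iff]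
    by_cases h : ∃ C ∈ p.1.carrier, I C.basis p.2
    · constructor
      · intro hlt
        obtain ⟨C, hC, hCI, hb⟩ := exists_birth_eq_TI h
        exact Or.inl ⟨C, hC, hCI, hb ▸ hlt⟩
      · rintro (⟨C, hC, hCI, hb⟩ | ⟨h', _⟩)
        · exact (TI_le hC hCI).trans_lt hb
        · exact absurd h h'
    · rw [TI_eq_zero h]
      constructor
      · intro h0
        exact Or.inr ⟨h, h0⟩
      · rintro (⟨C, hC, hCI, hb⟩ | ⟨_, h0⟩)
        · exact absurd ⟨C, hC, hCI⟩ h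
        · exact h0
  rw [this]
  exact hr.union (hE.compl.inter (MeasurableSet.const _))

end PotentialMeasurable

end BackwardClan

namespace BackwardClan

/-! ### The generator as an integral against a rate measure -/

/-- The measure `e^{-s} ds` on the line. -/
noncomputable def expDensity : Measure ℝ :=
  (volume : Measure ℝ).withDensity fun s => ENNReal.ofReal (Real.exp (-s))

noncomputable instance : SFinite expDensity := by unfold expDensity; infer_instance

instance : NullSingletonClass expDensity := by unfold expDensity; infer_instance

/-- The measure has infinite mass on the line, but the admissible lifetimes always form a half-line
bounded below, whose mass is finite. -/
lemma expDensity_Ioi (c : ℝ) : expDensity (Ioi c) = ENNReal.ofReal (Real.exp (-c)) := by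
  rw [expDensity, withDensity_apply _ measurableSet_Ioi,
    ← ofReal_integral_eq_lintegral_ofReal (integrableOn_exp_neg_Ioi c)
      (ae_of_all _ fun _ => (Real.exp_pos _).le), integral_exp_neg_Ioi]

lemma setIntegral_expDensity {s : Set ℝ} (hs : MeasurableSet s) (f : ℝ → ℝ) :
    ∫ x in s, f x ∂expDensity = ∫ x in s, Real.exp (-x) * f x := by
  rw [expDensity, setIntegral_withDensity_eq_setIntegral_toReal_smul (by fun_prop)
    (ae_of_all _ fun _ => ENNReal.ofReal_lt_top) _ hs]
  refine integral_congr_ae (ae_of_all _ fun x => ?_)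
  simp [ENNReal.toReal_ofReal (Real.exp_pos _).le]

section Rate

variable {𝔾 E : Type*} [MeasurableSpace 𝔾] [StandardBorelSpace 𝔾]

/-- All births in the configuration take place during `[-u, 0]`. -/
def Valid (u : ℝ) (a : Config 𝔾) : Prop := ∀ C ∈ a.carrier, -u ≤ C.birth ∧ C.birth ≤ 0

lemma Valid.mono {u v : ℝ} {a : Config 𝔾} (h : Valid u a) (huv : u ≤ v) : Valid v a :=
  fun C hC => ⟨by linarith [(h C hC).1], (h C hC).2⟩

/-- The threshold `u + TI I a θ` for lifetimes is then nonnegative, so the exponential factor in the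
rate is at most `1`. The default value of `TI` is covered because `-u ≤ 0`. -/
lemma Valid.neg_le_TI {I : 𝔾 → 𝔾 → Prop} {u : ℝ} {a : Config 𝔾} (h : Valid u a) (hu : 0 ≤ u)
    (θ : 𝔾) : -u ≤ TI I a θ := by
  by_cases hex : ∃ C ∈ a.carrier, I C.basis θ
  · obtain ⟨C, hC, _, hb⟩ := exists_birth_eq_TI hex
    rw [← hb]
    exact (h C hC).1
  · rw [TI_eq_zero hex]; linarith

/-- Bases and lifetimes of the cylinders that can join `a` at time `u`. -/
def admissible (I : 𝔾 → 𝔾 → Prop) (body : 𝔾 → Set E) (Λ : Set E) (u : ℝ) (a : Config 𝔾) :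
    Set (𝔾 × ℝ) :=
  {p | p.1 ∈ potential I body Λ a ∧ u + TI I a p.1 < p.2}

/-- The rate at which `a` is joined by a cylinder with given basis and lifetime at time `u`. -/
noncomputable def rate (ν : Measure 𝔾) (I : 𝔾 → 𝔾 → Prop) (body : 𝔾 → Set E) (Λ : Set E)
    (u : ℝ) (a : Config 𝔾) : Measure (𝔾 × ℝ) :=
  (ν.prod expDensity).restrict (admissible I body Λ u a)

/-- The configuration `a` joined by a cylinder born at `-u`. -/
def joined (u : ℝ) (a : Config 𝔾) (p : 𝔾 × ℝ) : Config 𝔾 := a.add (p.1, -u, p.2)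

variable {ν : Measure 𝔾} [SigmaFinite ν]
  {I : 𝔾 → 𝔾 → Prop} {body : 𝔾 → Set E} {Λ : Set E}

lemma measurable_joined :
    Measurable fun q : (ℝ × Config 𝔾) × (𝔾 × ℝ) => joined q.1.1 q.1.2 q.2 := by
  have : Measurable fun q : (ℝ × Config 𝔾) × (𝔾 × ℝ) =>
      (q.1.2, ((q.2.1, -q.1.1, q.2.2) : Cylinder 𝔾)) := by fun_prop
  exact Config.measurable_add.comp this

lemma measurable_joined_right (u : ℝ) (a : Config 𝔾) : Measurable (joined u a) :=
  measurable_joined.comp (measurable_prodMk_left (x := (u, a)))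

lemma measurableSet_admissible_prod (hI : MeasurableSet {p : 𝔾 × 𝔾 | I p.1 p.2})
    (hΛ : MeasurableSet (meeting body Λ)) :
    MeasurableSet {q : (ℝ × Config 𝔾) × (𝔾 × ℝ) | q.2 ∈ admissible I body Λ q.1.1 q.1.2} := by
  have hm : Measurable fun q : (ℝ × Config 𝔾) × (𝔾 × ℝ) => (q.1.2, q.2.1) := by fun_prop
  refine (hm (measurableSet_potential_prod hI hΛ)).inter ?_
  exact measurableSet_lt ((measurable_fst.comp measurable_fst).add ((measurable_TI hI).comp hm))
    (by fun_prop)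

lemma measurableSet_admissible (hI : MeasurableSet {p : 𝔾 × 𝔾 | I p.1 p.2})
    (hΛ : MeasurableSet (meeting body Λ)) (u : ℝ) (a : Config 𝔾) :
    MeasurableSet (admissible I body Λ u a) :=
  measurable_prodMk_left (x := (u, a)) (measurableSet_admissible_prod hI hΛ)

/-- Without any assumption on the births the thresholds still have a lower bound, by finiteness of
`a`; this makes every total rate finite. -/
lemma exists_le_TI (I : 𝔾 → 𝔾 → Prop) (a : Config 𝔾) : ∃ β : ℝ, ∀ θ, β ≤ TI I a θ := by
  obtain ⟨β, hβ⟩ := (a.finite.image Cylinder.birth).bddBelow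
  refine ⟨min β 0, fun θ => ?_⟩
  by_cases hex : ∃ C ∈ a.carrier, I C.basis θ
  · obtain ⟨C, hC, _, hb⟩ := exists_birth_eq_TI hex
    rw [← hb]
    exact (min_le_left _ _).trans (hβ (mem_image_of_mem _ hC))
  · rw [TI_eq_zero hex]; exact min_le_right _ _

lemma rate_prod_le {B : Set 𝔾} (hB : MeasurableSet B) {u c : ℝ}
    {a : Config 𝔾} (hc : ∀ θ, c ≤ u + TI I a θ) :
    rate ν I body Λ u a (B ×ˢ univ) ≤
      ν (B ∩ potential I body Λ a) * ENNReal.ofReal (Real.exp (-c)) := by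
  rw [rate, Measure.restrict_apply (hB.prod MeasurableSet.univ), ← expDensity_Ioi,
    ← Measure.prod_prod]
  refine measure_mono ?_
  rintro p ⟨⟨hpB, _⟩, hp⟩
  exact ⟨⟨hpB, hp.1⟩, (hc _).trans_lt hp.2⟩

lemma rate_prod_le_of_valid {B : Set 𝔾} (hB : MeasurableSet B) {u : ℝ} (hu : 0 ≤ u)
    {a : Config 𝔾} (ha : Valid u a) :
    rate ν I body Λ u a (B ×ˢ univ) ≤ ν (B ∩ potential I body Λ a) := by
  have := rate_prod_le (ν := ν) (body := body) (Λ := Λ) hB (u := u) (c := 0) (a := a)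
    (fun θ => by linarith [ha.neg_le_TI (I := I) hu θ])
  simpa using this

lemma rate_univ_lt_top (hΛfin : ν (meeting body Λ) < ⊤)
    (hIfin : ∀ γ, ν {θ | I γ θ} < ⊤) (u : ℝ) (a : Config 𝔾) :
    rate ν I body Λ u a univ < ⊤ := by
  obtain ⟨β, hβ⟩ := exists_le_TI I a
  have := rate_prod_le (ν := ν) (body := body) (Λ := Λ) MeasurableSet.univ (u := u) (c := u + β) (a := a)
    (fun θ => by linarith [hβ θ])
  rw [univ_prod_univ] at this
  refine this.trans_lt (ENNReal.mul_lt_top ?_ ENNReal.ofReal_lt_top)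
  rw [univ_inter]
  exact measure_potential_lt_top hΛfin hIfin a

/-- The rate has no atoms, lifetimes being continuously distributed, so a joining cylinder is almost
never already present. Hence each jump raises the number of cylinders by exactly one. -/
lemma ae_rate_notMem (u : ℝ) (a : Config 𝔾) :
    ∀ᵐ p ∂(rate ν I body Λ u a), ((p.1, -u, p.2) : Cylinder 𝔾) ∉ a.carrier := by
  refine ae_restrict_of_ae ?_
  have hfin : {p : 𝔾 × ℝ | ((p.1, -u, p.2) : Cylinder 𝔾) ∈ a.carrier}.Finite :=
    a.finite.preimage (f := fun p : 𝔾 × ℝ => ((p.1, -u, p.2) : Cylinder 𝔾)) (by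
      rintro ⟨p1, p2⟩ _ ⟨q1, q2⟩ _ h
      simp only [Prod.mk.injEq] at h
      simp [h.1, h.2.2])
  have h0 : (ν.prod expDensity) {p : 𝔾 × ℝ | ((p.1, -u, p.2) : Cylinder 𝔾) ∈ a.carrier} = 0 :=
    hfin.measure_zero _
  rw [ae_iff]
  simpa using h0

lemma integrable_rate (hΛfin : ν (meeting body Λ) < ⊤)
    (hIfin : ∀ γ, ν {θ | I γ θ} < ⊤) (u : ℝ) (a : Config 𝔾) {g : 𝔾 × ℝ → ℝ} (hg : Measurable g)
    {K : ℝ} (hK : ∀ p, |g p| ≤ K) : Integrable g (rate ν I body Λ u a) := by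
  have : IsFiniteMeasure (rate ν I body Λ u a) := ⟨rate_univ_lt_top hΛfin hIfin u a⟩
  exact Integrable.of_bound hg.aestronglyMeasurable K (ae_of_all _ hK)

lemma measurable_increment {F : Config 𝔾 → ℝ} (hF : Measurable F) (u : ℝ) (a : Config 𝔾) :
    Measurable fun p => F (joined u a p) - F a :=
  (hF.comp (measurable_joined_right u a)).sub_const _

lemma abs_increment_le {F : Config 𝔾 → ℝ} {K : ℝ} (hK : ∀ a, |F a| ≤ K) (a b : Config 𝔾) :
    |F b - F a| ≤ 2 * K :=
  (abs_sub _ _).trans (by linarith [hK a, hK b])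

lemma generator_eq_integral_rate (hI : MeasurableSet {p : 𝔾 × 𝔾 | I p.1 p.2})
    (hΛ : MeasurableSet (meeting body Λ)) (hΛfin : ν (meeting body Λ) < ⊤)
    (hIfin : ∀ γ, ν {θ | I γ θ} < ⊤) {F : Config 𝔾 → ℝ} (hF : Measurable F) {K : ℝ}
    (hK : ∀ a, |F a| ≤ K) (u : ℝ) (a : Config 𝔾) :
    generator ν I body Λ u F a = ∫ p, (F (joined u a p) - F a) ∂(rate ν I body Λ u a) := by
  have hadm := measurableSet_admissible (u := u) (a := a) hI hΛ
  have hint : Integrable ((admissible I body Λ u a).indicator fun p => F (joined u a p) - F a)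
      (ν.prod expDensity) := by
    rw [integrable_indicator_iff hadm]
    exact integrable_rate hΛfin hIfin u a (measurable_increment hF u a)
      fun p => abs_increment_le hK _ _
  rw [rate, ← integral_indicator hadm, integral_prod _ hint, generator,
    ← integral_indicator (measurableSet_potential hI hΛ a)]
  refine integral_congr_ae (ae_of_all _ fun θ => ?_)
  by_cases hθ : θ ∈ potential I body Λ a
  · simp only [indicator_of_mem hθ]
    rw [← setIntegral_expDensity measurableSet_Ioi, ← integral_indicator measurableSet_Ioi]
    refine integral_congr_ae (ae_of_all _ fun s => ?_)
    by_cases hs : u + TI I a θ < s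
    · have h1 : (θ, s) ∈ admissible I body Λ u a := ⟨hθ, hs⟩
      simp only [indicator_of_mem h1, indicator_of_mem (mem_Ioi.mpr hs)]
      rfl
    · have h1 : (θ, s) ∉ admissible I body Λ u a := fun h => hs h.2
      simp only [indicator_of_notMem h1, indicator_of_notMem (mt mem_Ioi.mp hs)]
  · simp only [indicator_of_notMem hθ]
    have : ∀ s, (θ, s) ∉ admissible I body Λ u a := fun s h => hθ h.1
    simp [indicator_of_notMem (this _)]

/-- The parameter enters the measure only through the set of restriction, so the integral is one of
an indicator against a fixed product measure. -/
lemma measurable_integral_rate (hI : MeasurableSet {p : 𝔾 × 𝔾 | I p.1 p.2})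
    (hΛ : MeasurableSet (meeting body Λ)) {g : (ℝ × Config 𝔾) × (𝔾 × ℝ) → ℝ} (hg : Measurable g) :
    Measurable fun q : ℝ × Config 𝔾 => ∫ p, g (q, p) ∂(rate ν I body Λ q.1 q.2) := by
  have h := measurableSet_admissible_prod hI hΛ
  have h2 : StronglyMeasurable fun q : ℝ × Config 𝔾 => ∫ p, ({q : (ℝ × Config 𝔾) × (𝔾 × ℝ) |
      q.2 ∈ admissible I body Λ q.1.1 q.1.2}.indicator g) (q, p) ∂(ν.prod expDensity) :=
    (hg.indicator h).stronglyMeasurable.integral_prod_right'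
  convert! h2.measurable using 2 with q
  rw [rate, ← integral_indicator (measurableSet_admissible hI hΛ _ _)]
  rfl

lemma measurable_lintegral_rate (hI : MeasurableSet {p : 𝔾 × 𝔾 | I p.1 p.2})
    (hΛ : MeasurableSet (meeting body Λ)) {g : (ℝ × Config 𝔾) × (𝔾 × ℝ) → ENNReal}
    (hg : Measurable g) :
    Measurable fun q : ℝ × Config 𝔾 => ∫⁻ p, g (q, p) ∂(rate ν I body Λ q.1 q.2) := by
  have h := measurableSet_admissible_prod hI hΛ
  have h2 : Measurable fun q : ℝ × Config 𝔾 => ∫⁻ p, ({q : (ℝ × Config 𝔾) × (𝔾 × ℝ) |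
      q.2 ∈ admissible I body Λ q.1.1 q.1.2}.indicator g) (q, p) ∂(ν.prod expDensity) :=
    (hg.indicator h).lintegral_prod_right'
  convert! h2 using 2 with q
  rw [rate, ← lintegral_indicator (measurableSet_admissible hI hΛ _ _)]
  rfl

lemma measurable_generator (hI : MeasurableSet {p : 𝔾 × 𝔾 | I p.1 p.2})
    (hΛ : MeasurableSet (meeting body Λ)) (hΛfin : ν (meeting body Λ) < ⊤)
    (hIfin : ∀ γ, ν {θ | I γ θ} < ⊤) {F : Config 𝔾 → ℝ} (hF : IsTest ν F) :
    Measurable fun q : ℝ × Config 𝔾 => generator ν I body Λ q.1 F q.2 := by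
  obtain ⟨K, hK⟩ := hF.bounded
  simp only [generator_eq_integral_rate hI hΛ hΛfin hIfin hF.measurable hK]
  refine measurable_integral_rate (ν := ν) (I := I) (body := body) (Λ := Λ)
    (g := fun q => F (joined q.1.1 q.1.2 q.2) - F q.1.2) hI hΛ ?_
  exact (hF.measurable.comp measurable_joined).sub
    (hF.measurable.comp (measurable_snd.comp measurable_fst))

/-- A function of configurations that depends only on the cylinders with basis in `B`. -/
def LocalTo (B : Set 𝔾) (F : Config 𝔾 → ℝ) : Prop :=
  ∀ a a' : Config 𝔾, (∀ C : Cylinder 𝔾, C.basis ∈ B → (C ∈ a.carrier ↔ C ∈ a'.carrier)) → F a = F a'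

lemma LocalTo.joined_eq {B : Set 𝔾} {F : Config 𝔾 → ℝ} (h : LocalTo B F) {u : ℝ} {a : Config 𝔾}
    {p : 𝔾 × ℝ} (hp : p.1 ∉ B) : F (joined u a p) = F a := by
  refine h _ _ fun C hC => ?_
  simp only [joined, Config.add, mem_union, mem_singleton_iff, or_iff_left_iff_imp]
  rintro rfl
  exact absurd hC hp

lemma generator_eq_setIntegral (hI : MeasurableSet {p : 𝔾 × 𝔾 | I p.1 p.2})
    (hΛ : MeasurableSet (meeting body Λ)) (hΛfin : ν (meeting body Λ) < ⊤)
    (hIfin : ∀ γ, ν {θ | I γ θ} < ⊤) {F : Config 𝔾 → ℝ} (hF : Measurable F) {K : ℝ}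
    (hK : ∀ a, |F a| ≤ K) {B : Set 𝔾} (hloc : LocalTo B F) (u : ℝ) (a : Config 𝔾) :
    generator ν I body Λ u F a =
      ∫ p in B ×ˢ univ, (F (joined u a p) - F a) ∂(rate ν I body Λ u a) := by
  rw [generator_eq_integral_rate hI hΛ hΛfin hIfin hF hK]
  refine (setIntegral_eq_integral_of_forall_compl_eq_zero fun p hp => ?_).symm
  rw [hloc.joined_eq (fun h => hp ⟨h, mem_univ _⟩), sub_self]

/-- Only joining cylinders over `B` change `F`, each by at most `2 * K`, and for a valid
configuration their total rate is at most `ν B`. This uniform bound drives the dominated convergence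
of time integrals of the generator. -/
lemma abs_generator_le (hI : MeasurableSet {p : 𝔾 × 𝔾 | I p.1 p.2})
    (hΛ : MeasurableSet (meeting body Λ)) (hΛfin : ν (meeting body Λ) < ⊤)
    (hIfin : ∀ γ, ν {θ | I γ θ} < ⊤) {F : Config 𝔾 → ℝ} (hF : Measurable F) {K : ℝ}
    (hK : ∀ a, |F a| ≤ K) {B : Set 𝔾} (hB : MeasurableSet B) (hBfin : ν B < ⊤)
    (hloc : LocalTo B F) {u : ℝ} (hu : 0 ≤ u) {a : Config 𝔾} (ha : Valid u a) :
    |generator ν I body Λ u F a| ≤ 2 * K * (ν B).toReal := by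
  rw [generator_eq_setIntegral hI hΛ hΛfin hIfin hF hK hloc]
  have hle : rate ν I body Λ u a (B ×ˢ univ) ≤ ν B :=
    (rate_prod_le_of_valid hB hu ha).trans (measure_mono inter_subset_left)
  have hKnn : 0 ≤ 2 * K := (abs_nonneg _).trans (abs_increment_le hK a a)
  refine (norm_setIntegral_le_of_norm_le_const (C := 2 * K) (hle.trans_lt hBfin)
    fun p _ => (Real.norm_eq_abs _).trans_le (abs_increment_le hK _ _)).trans ?_
  exact mul_le_mul_of_nonneg_left (ENNReal.toReal_mono hBfin.ne hle) hKnn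

end Rate

end BackwardClan

namespace BackwardClan

/-! ### Riemann-type sums along uniform grids -/

section Grid

/-- The `k`-th point of the uniform grid of `[s, t]` with `m` cells. -/
noncomputable def grid (s t : ℝ) (m k : ℕ) : ℝ := s + (t - s) * (k / m)

/-- The largest grid point not exceeding `u`. -/
noncomputable def gridFloor (s t : ℝ) (m : ℕ) (u : ℝ) : ℝ := grid s t m ⌊(u - s) / (t - s) * m⌋₊

lemma grid_zero (s t : ℝ) (m : ℕ) : grid s t m 0 = s := by simp [grid]

lemma grid_self (s t : ℝ) {m : ℕ} (hm : 0 < m) : grid s t m m = t := by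
  have : (m : ℝ) ≠ 0 := by positivity
  simp [grid, div_self this]

lemma grid_mono {s t : ℝ} (hst : s ≤ t) (m : ℕ) : Monotone (grid s t m) := by
  intro k l hkl
  have h1 : (k : ℝ) ≤ l := by exact_mod_cast hkl
  have h2 : 0 ≤ t - s := by linarith
  unfold grid
  gcongr

lemma le_grid {s t : ℝ} (hst : s ≤ t) (m k : ℕ) : s ≤ grid s t m k := by
  have := grid_mono hst m (Nat.zero_le k)
  rwa [grid_zero] at this

lemma grid_le {s t : ℝ} (hst : s ≤ t) {m k : ℕ} (hk : k ≤ m) : grid s t m k ≤ t := by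
  rcases Nat.eq_zero_or_pos m with rfl | hm
  · simp [grid, hst]
  · have := grid_mono hst m hk
    rwa [grid_self s t hm] at this

lemma grid_succ_sub (s t : ℝ) (m k : ℕ) :
    grid s t m (k + 1) - grid s t m k = (t - s) / m := by
  simp only [grid]; push_cast; ring

lemma gridFloor_eq {s t : ℝ} (hst : s < t) {m k : ℕ} (hm : 0 < m) {u : ℝ}
    (hu : u ∈ Ico (grid s t m k) (grid s t m (k + 1))) : gridFloor s t m u = grid s t m k := by
  have hm' : (0 : ℝ) < m := by exact_mod_cast hm
  have hts : 0 < t - s := by linarith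
  have hk : ⌊(u - s) / (t - s) * m⌋₊ = k := by
    rw [Nat.floor_eq_iff (by
      have := le_grid hst.le m k
      have : 0 ≤ u - s := by linarith [hu.1]
      positivity)]
    have h1 := hu.1
    have h2 := hu.2
    simp only [grid] at h1 h2
    constructor
    · rw [div_mul_eq_mul_div, le_div_iff₀ hts]
      have : (t - s) * (k / m) * m ≤ (u - s) * m := by gcongr; linarith
      have e : (t - s) * (k / m) * m = k * (t - s) := by field_simp
      linarith
    · rw [div_mul_eq_mul_div, div_lt_iff₀ hts]
      have : (u - s) * m < (t - s) * (((k + 1 : ℕ) : ℝ) / m) * m := by gcongr; linarith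
      have e : (t - s) * (((k + 1 : ℕ) : ℝ) / m) * m = (k + 1) * (t - s) := by
        push_cast; field_simp
      linarith
  rw [gridFloor, hk]

lemma le_gridFloor {s t : ℝ} (hst : s ≤ t) (m : ℕ) (u : ℝ) : s ≤ gridFloor s t m u :=
  le_grid hst _ _

lemma gridFloor_le {s t : ℝ} (hst : s < t) {m : ℕ} (hm : 0 < m) {u : ℝ} (hu : s ≤ u) :
    gridFloor s t m u ≤ u := by
  have hm' : (0 : ℝ) < m := by exact_mod_cast hm
  have hts : 0 < t - s := by linarith
  have hus : 0 ≤ u - s := by linarith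
  have := Nat.floor_le (show 0 ≤ (u - s) / (t - s) * m by positivity)
  rw [gridFloor, grid]
  have h2 : (t - s) * (⌊(u - s) / (t - s) * m⌋₊ / m) ≤ (t - s) * ((u - s) / (t - s) * m / m) := by
    gcongr
  have e : (t - s) * ((u - s) / (t - s) * m / m) = u - s := by field_simp
  linarith

lemma sub_le_gridFloor {s t : ℝ} (hst : s < t) {m : ℕ} (hm : 0 < m) (u : ℝ) :
    u - (t - s) / m ≤ gridFloor s t m u := by
  have hm' : (0 : ℝ) < m := by exact_mod_cast hm
  have hts : 0 < t - s := by linarith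
  have := (Nat.lt_floor_add_one ((u - s) / (t - s) * m)).le
  rw [gridFloor, grid]
  have h2 : (t - s) * (((u - s) / (t - s) * m) / m) ≤
      (t - s) * ((⌊(u - s) / (t - s) * m⌋₊ + 1) / m) := by
    gcongr
  have e : (t - s) * ((u - s) / (t - s) * m / m) = u - s := by field_simp
  have e2 : (t - s) * (((⌊(u - s) / (t - s) * m⌋₊ : ℝ) + 1) / m) =
    (t - s) * (⌊(u - s) / (t - s) * m⌋₊ / m) + (t - s) / m := by ring
  linarith

lemma tendsto_gridFloor {s t : ℝ} (hst : s < t) {u : ℝ} (hu : s ≤ u) :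
    Tendsto (fun m => gridFloor s t m u) atTop (𝓝[≤] u) := by
  refine tendsto_nhdsWithin_iff.mpr ⟨?_, ?_⟩
  · have h1 : Tendsto (fun m : ℕ => u - (t - s) / m) atTop (𝓝 u) := by
      have := (tendsto_const_div_atTop_nhds_zero_nat (t - s)).const_sub u
      simpa using this
    refine tendsto_of_tendsto_of_tendsto_of_le_of_le' h1 tendsto_const_nhds ?_ ?_
    · filter_upwards [eventually_gt_atTop 0] with m hm using sub_le_gridFloor hst hm u
    · filter_upwards [eventually_gt_atTop 0] with m hm using gridFloor_le hst hm hu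
  · filter_upwards [eventually_gt_atTop 0] with m hm using gridFloor_le hst hm hu

/-- Riemann sums with left end points in one of the variables. -/
lemma tendsto_sum_grid_integral {s t : ℝ} (hst : s ≤ t) {φ : ℝ → ℝ → ℝ} {C : ℝ}
    (hmeas : ∀ r, Measurable (φ r))
    (hbound : ∀ r u, s ≤ r → r ≤ u → u ≤ t → |φ r u| ≤ C)
    (hlim : ∀ᵐ u, s < u → Tendsto (fun r => φ r u) (𝓝[≤] u) (𝓝 (φ u u))) :
    Tendsto (fun m => ∑ k ∈ Finset.range m,
      ∫ u in (grid s t m k)..(grid s t m (k + 1)), φ (grid s t m k) u) atTop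
      (𝓝 (∫ u in s..t, φ u u)) := by
  rcases hst.eq_or_lt with rfl | hlt
  · have : ∀ m k, grid s s m k = s := by intro m k; simp [grid]
    simp [this]
  -- Interval integrals run over `(a, b]` while the grid floor is constant on `[a, b)`; the right
  -- end point is discarded as a null set.
  have hcell : ∀ m, 0 < m → ∀ k, k < m → ∀ᵐ u, u ∈ Ι (grid s t m k) (grid s t m (k + 1)) →
      φ (grid s t m k) u = φ (gridFloor s t m u) u := by
    intro m hm k _
    filter_upwards [Measure.ae_ne volume (grid s t m (k + 1))] with u hne hu
    rw [uIoc_of_le (grid_mono hst m (Nat.le_succ k))] at hu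
    rw [gridFloor_eq hlt hm ⟨hu.1.le, lt_of_le_of_ne hu.2 hne⟩]
  have hsum : ∀ m, 0 < m → IntervalIntegrable (fun u => φ (gridFloor s t m u) u) volume s t ∧
      ∑ k ∈ Finset.range m,
      ∫ u in (grid s t m k)..(grid s t m (k + 1)), φ (grid s t m k) u =
      ∫ u in s..t, φ (gridFloor s t m u) u := by
    intro m hm
    have hII : ∀ k < m, IntervalIntegrable (fun u => φ (gridFloor s t m u) u) volume
        (grid s t m k) (grid s t m (k + 1)) := by
      intro k hk
      have h1 : IntervalIntegrable (φ (grid s t m k)) volume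
          (grid s t m k) (grid s t m (k + 1)) := by
        rw [intervalIntegrable_iff_integrableOn_Ioc_of_le (grid_mono hst m (Nat.le_succ k))]
        refine IntegrableOn.of_bound (by simp) (hmeas _).aestronglyMeasurable C ?_
        refine (ae_restrict_iff' measurableSet_Ioc).mpr (ae_of_all _ fun u hu => ?_)
        exact hbound _ _ (le_grid hst _ _) hu.1.le (hu.2.trans (grid_le hst hk))
      exact h1.congr_ae ((ae_restrict_iff' measurableSet_uIoc).mpr (hcell m hm k hk))
    refine ⟨?_, ?_⟩
    · have := IntervalIntegrable.trans_iterate hII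
      rwa [grid_zero, grid_self s t hm] at this
    · have := intervalIntegral.sum_integral_adjacent_intervals hII
      rw [grid_zero, grid_self s t hm] at this
      rw [← this]
      refine Finset.sum_congr rfl fun k hk => ?_
      exact intervalIntegral.integral_congr_ae (hcell m hm k (Finset.mem_range.mp hk))
  have hT : Tendsto (fun m => ∫ u in s..t, φ (gridFloor s t m u) u) atTop
      (𝓝 (∫ u in s..t, φ u u)) := by
    refine intervalIntegral.tendsto_integral_filter_of_dominated_convergence (fun _ => C) ?_ ?_
      intervalIntegrable_const ?_
    · filter_upwards [eventually_gt_atTop 0] with m hm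
      exact (hsum m hm).1.def'.aestronglyMeasurable
    · filter_upwards [eventually_gt_atTop 0] with m hm
      refine ae_of_all _ fun u hu => ?_
      rw [uIoc_of_le hst] at hu
      exact hbound _ _ (le_gridFloor hst m u) (gridFloor_le hlt hm hu.1.le) hu.2
    · filter_upwards [hlim] with u hu hmem
      rw [uIoc_of_le hst] at hmem
      exact (hu hmem.1).comp (tendsto_gridFloor hlt hmem.1.le)
  refine hT.congr' ?_
  filter_upwards [eventually_gt_atTop 0] with m hm using (hsum m hm).2.symm

end Grid

/-! ### Growing step paths -/

section Paths

variable {𝔾 : Type*}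

/-- Growing paths, constant to the right of every time, whose cylinders are born in `[-t, 0]`. -/
structure GoodPath (x : ℝ → Config 𝔾) : Prop where
  mono : ∀ s t, 0 ≤ s → s ≤ t → (x s).carrier ⊆ (x t).carrier
  right : ∀ t, 0 ≤ t → ∀ᶠ u in 𝓝[>] t, x u = x t
  valid : ∀ t, 0 ≤ t → Valid t (x t)

lemma Config.eq_of_subset_of_ncard_le {a b : Config 𝔾} (h : a.carrier ⊆ b.carrier)
    (hn : b.carrier.ncard ≤ a.carrier.ncard) : a = b :=
  Config.ext (Set.eq_of_subset_of_ncard_le h hn b.finite)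

/-- A growing path jumps at countably many times only. -/
lemma ae_eventually_eq_of_mono {x : ℝ → Config 𝔾}
    (h : ∀ s t, 0 ≤ s → s ≤ t → (x s).carrier ⊆ (x t).carrier) :
    ∀ᵐ u, 0 < u → ∀ᶠ v in 𝓝 u, x v = x u := by
  -- The number of cylinders is monotone and thus continuous off a countable set; at a point of
  -- continuity it is locally constant, being an integer, and then inclusion forces equality. Time
  -- is cut at `0` to have monotonicity on the whole line.
  let N : ℝ → ℝ := fun t => ((x (max t 0)).carrier.ncard : ℝ)
  have hN : Monotone N := fun s t hst => by
    have := ncard_le_ncard (h (max s 0) (max t 0) (le_max_right _ _) (max_le_max_right 0 hst))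
      (x _).finite
    exact Nat.cast_le.mpr this
  filter_upwards [hN.countable_not_continuousAt.ae_notMem volume] with u hu hpos
  have hc : ContinuousAt N u := not_not.mp hu
  have h1 : ∀ᶠ v in 𝓝 u, |N v - N u| < 1 := by
    have := Metric.tendsto_nhds.mp hc 1 one_pos
    simpa [Real.dist_eq] using this
  filter_upwards [h1, lt_mem_nhds hpos] with v hv hv0
  have e1 : N v = ((x v).carrier.ncard : ℝ) := by simp only [N]; rw [max_eq_left hv0.le]
  have e2 : N u = ((x u).carrier.ncard : ℝ) := by simp only [N]; rw [max_eq_left hpos.le]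
  rw [e1, e2] at hv
  have hcard : (x v).carrier.ncard = (x u).carrier.ncard := by
    have h3 : |((x v).carrier.ncard : ℤ) - ((x u).carrier.ncard : ℤ)| < 1 := by exact_mod_cast hv
    rw [Int.abs_lt_one_iff] at h3
    omega
  rcases le_total u v with huv | huv
  · exact (Config.eq_of_subset_of_ncard_le (h u v hpos.le huv) hcard.le).symm
  · exact Config.eq_of_subset_of_ncard_le (h v u hv0.le huv) hcard.ge

variable [MeasurableSpace 𝔾] {Ω : Type*} {mΩ : MeasurableSpace Ω}

/-- Joint measurability of right-constant processes. -/
lemma measurable_process {X : ℝ → Ω → Config 𝔾} (hX : ∀ t, 0 ≤ t → Measurable (X t))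
    (hr : ∀ ω, ∀ t, 0 ≤ t → ∀ᶠ u in 𝓝[>] t, X u ω = X t ω) :
    Measurable fun p : ℝ × Ω => X (max p.1 0) p.2 := by
  refine Config.measurable_of_ncard fun D hD => ?_
  -- The sampling time is the least multiple of `1 / (n + 1)` strictly greater than `t`: it takes
  -- countably many values and tends to `t` from the right, where the path is constant.
  let f : ℕ → ℝ × Ω → ℕ := fun n p =>
    ((X (((⌊max p.1 0 * (n + 1)⌋₊ : ℝ) + 1) / (n + 1)) p.2).carrier ∩ D).ncard
  have hf : ∀ n, Measurable (f n) := by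
    intro n
    have h1 : Measurable fun q : ℕ × Ω => ((X (((q.1 : ℝ) + 1) / (n + 1)) q.2).carrier ∩ D).ncard := by
      refine measurable_from_prod_countable_right fun k => ?_
      exact (Config.measurable_ncard hD).comp (hX (((k : ℝ) + 1) / (n + 1)) (by positivity))
    have h2 : Measurable fun p : ℝ × Ω => (⌊max p.1 0 * (n + 1)⌋₊, p.2) := by fun_prop
    have h3 := h1.comp h2
    exact h3
  refine measurable_of_tendsto_metrizable hf (tendsto_pi_nhds.mpr fun p => ?_)
  set t := max p.1 0 with ht
  have ht0 : 0 ≤ t := le_max_right _ _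
  have hlim : Tendsto (fun n : ℕ => ((⌊t * (n + 1)⌋₊ : ℝ) + 1) / (n + 1)) atTop (𝓝[>] t) := by
    refine tendsto_nhdsWithin_iff.mpr ⟨?_, Eventually.of_forall fun n => ?_⟩
    · have h1 : Tendsto (fun n : ℕ => t + 1 / ((n : ℝ) + 1)) atTop (𝓝 t) := by
        simpa using tendsto_one_div_add_atTop_nhds_zero_nat.const_add t
      refine tendsto_of_tendsto_of_tendsto_of_le_of_le tendsto_const_nhds h1 ?_ ?_
      · intro n
        have hn : (0 : ℝ) < n + 1 := by positivity
        simp only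
        rw [le_div_iff₀ hn]
        exact (Nat.lt_floor_add_one _).le
      · intro n
        have hn : (0 : ℝ) < n + 1 := by positivity
        simp only
        rw [div_le_iff₀ hn, add_mul, one_div_mul_cancel hn.ne']
        gcongr
        exact Nat.floor_le (by positivity)
    · have hn : (0 : ℝ) < n + 1 := by positivity
      rw [mem_Ioi, lt_div_iff₀ hn]
      exact Nat.lt_floor_add_one _
  refine tendsto_const_nhds.congr' ?_
  filter_upwards [hlim.eventually (hr p.2 t ht0)] with n hn
  simp only [f, ← ht, hn]

end Paths

end BackwardClan

namespace BackwardClan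

/-! ### Weak solutions of the evolution equation -/

section WeakSolutions

variable {𝔾 E : Type*} [MeasurableSpace 𝔾]

/-- Measurability and finiteness of the influences. -/
structure FiniteInfluence (ν : Measure 𝔾) (I : 𝔾 → 𝔾 → Prop) (body : 𝔾 → Set E) (Λ : Set E) :
    Prop where
  measurable : MeasurableSet {p : 𝔾 × 𝔾 | I p.1 p.2}
  measurable_window : MeasurableSet (meeting body Λ)
  window_lt_top : ν (meeting body Λ) < ⊤
  lt_top : ∀ γ, ν {θ | I γ θ} < ⊤

/-- Processes with growing step paths that satisfy, from time `s` on, the evolution equation tested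
against events of the present only, under a finite measure. -/
structure WeakSolution {Ω : Type*} [MeasurableSpace Ω] (Q : Measure Ω) (ν : Measure 𝔾)
    (I : 𝔾 → 𝔾 → Prop) (body : 𝔾 → Set E) (Λ : Set E) (s : ℝ) (X : ℝ → Ω → Config 𝔾) :
    Prop where
  measurable : ∀ t, 0 ≤ t → Measurable (X t)
  good : ∀ ω, GoodPath fun t => X t ω
  evolution : ∀ F, IsTest ν F → ∀ r t, s ≤ r → r ≤ t → ∀ V, MeasurableSet V →
    ∫ ω in X r ⁻¹' V, (F (X t ω) - F (X r ω)) ∂Q =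
      ∫ ω in X r ⁻¹' V, (∫ u in r..t, generator ν I body Λ u F (X u ω)) ∂Q

/-- Time and state of a process, as a function on `ℝ × Ω`. -/
def timeState {Ω : Type*} (X : ℝ → Ω → Config 𝔾) (p : ℝ × Ω) : ℝ × Config 𝔾 :=
  (p.1, X (max p.1 0) p.2)

variable {Ω : Type*} [MeasurableSpace Ω] {Q : Measure Ω} [IsFiniteMeasure Q]
  {X : ℝ → Ω → Config 𝔾} {s t : ℝ}

lemma measurable_timeState (hX : ∀ t, 0 ≤ t → Measurable (X t))
    (hg : ∀ ω, GoodPath fun t => X t ω) : Measurable (timeState X) :=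
  measurable_fst.prodMk (measurable_process hX fun ω => (hg ω).right)

/-- Lebesgue measure on the time interval times the given measure. -/
noncomputable def onInterval (Q : Measure Ω) (s t : ℝ) : Measure (ℝ × Ω) :=
  ((volume : Measure ℝ).restrict (Ioc s t)).prod Q

instance : IsFiniteMeasure (onInterval Q s t) := by
  unfold onInterval; infer_instance

lemma ae_onInterval_mem : ∀ᵐ p ∂(onInterval Q s t), p.1 ∈ Ioc s t :=
  Measure.quasiMeasurePreserving_fst.ae (ae_restrict_mem measurableSet_Ioc)

lemma ae_onInterval_timeState (hs : 0 ≤ s) (hg : ∀ ω, GoodPath fun t => X t ω) :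
    ∀ᵐ p ∂(onInterval Q s t), 0 ≤ (timeState X p).1 ∧
      Valid (timeState X p).1 (timeState X p).2 ∧
      (timeState X p).2.carrier ⊆ (X t p.2).carrier := by
  filter_upwards [ae_onInterval_mem] with p hp
  have h0 : 0 ≤ p.1 := hs.trans hp.1.le
  simp only [timeState, max_eq_left h0]
  exact ⟨h0, (hg p.2).valid _ h0, (hg p.2).mono _ _ h0 hp.2⟩

lemma integrable_onInterval (hs : 0 ≤ s)
    (hX : ∀ t, 0 ≤ t → Measurable (X t)) (hg : ∀ ω, GoodPath fun t => X t ω)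
    {g : ℝ × Config 𝔾 → ℝ} (hgm : Measurable g) {C : ℝ}
    (hC : ∀ u a, 0 ≤ u → Valid u a → |g (u, a)| ≤ C) :
    Integrable (fun p => g (timeState X p)) (onInterval Q s t) := by
  refine Integrable.of_bound (hgm.comp (measurable_timeState hX hg)).aestronglyMeasurable C ?_
  filter_upwards [ae_onInterval_timeState hs hg] with p hp
  exact hC _ _ hp.1 hp.2.1

lemma interval_eq_timeState (hs : 0 ≤ s) (hst : s ≤ t) (g : ℝ × Config 𝔾 → ℝ) (ω : Ω) :
    ∫ u in s..t, g (u, X u ω) = ∫ u in Ioc s t, g (timeState X (u, ω)) := by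
  rw [intervalIntegral.integral_of_le hst]
  refine setIntegral_congr_fun measurableSet_Ioc fun u hu => ?_
  simp only [timeState, max_eq_left (hs.trans hu.1.le)]

/-- Fubini's theorem for time integrals along the paths. -/
lemma integral_interval_process (hs : 0 ≤ s) (hst : s ≤ t)
    (hX : ∀ t, 0 ≤ t → Measurable (X t)) (hg : ∀ ω, GoodPath fun t => X t ω)
    {g : ℝ × Config 𝔾 → ℝ} (hgm : Measurable g) {C : ℝ}
    (hC : ∀ u a, 0 ≤ u → Valid u a → |g (u, a)| ≤ C) :
    Integrable (fun ω => ∫ u in s..t, g (u, X u ω)) Q ∧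
    ∫ ω, (∫ u in s..t, g (u, X u ω)) ∂Q = ∫ p, g (timeState X p) ∂(onInterval Q s t) := by
  have hint := integrable_onInterval (Q := Q) (t := t) hs hX hg hgm hC
  simp only [interval_eq_timeState hs hst]
  exact ⟨hint.integral_prod_right, (integral_prod_symm _ hint).symm⟩

variable [StandardBorelSpace 𝔾] {ν : Measure 𝔾} [SigmaFinite ν]
  {I : 𝔾 → 𝔾 → Prop} {body : 𝔾 → Set E} {Λ : Set E}

/-- Local functions with values in `[0, 1]` give test functions. -/
lemma isTest_toReal {f : Config 𝔾 → ENNReal} (hf : Measurable f) (hf1 : ∀ a, f a ≤ 1) {B : Set 𝔾}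
    (hB : MeasurableSet B) (hBfin : ν B < ⊤) (hloc : LocalTo B fun a => (f a).toReal) :
    IsTest ν fun a => (f a).toReal where
  measurable := hf.ennreal_toReal
  bounded := ⟨1, fun a => by
    rw [abs_of_nonneg ENNReal.toReal_nonneg]
    exact ENNReal.toReal_le_of_le_ofReal zero_le_one (by simpa using hf1 a)⟩
  isLocal := ⟨B, hB, hBfin, hloc⟩

lemma measurable_setLIntegral_rate (h : FiniteInfluence ν I body Λ) {D : Set (𝔾 × ℝ)}
    (hD : MeasurableSet D) {g : (ℝ × Config 𝔾) × (𝔾 × ℝ) → ENNReal} (hg : Measurable g) :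
    Measurable fun v : ℝ × Config 𝔾 => ∫⁻ q in D, g (v, q) ∂(rate ν I body Λ v.1 v.2) := by
  have := measurable_lintegral_rate (ν := ν) h.measurable h.measurable_window
    (hg.indicator (measurable_snd hD))
  convert! this using 2 with v
  rw [← lintegral_indicator hD]
  rfl

lemma measurable_rate_apply (h : FiniteInfluence ν I body Λ) {D : Set (𝔾 × ℝ)}
    (hD : MeasurableSet D) :
    Measurable fun v : ℝ × Config 𝔾 => rate ν I body Λ v.1 v.2 D := by
  simpa using measurable_setLIntegral_rate (ν := ν) h hD (measurable_const (a := (1 : ENNReal)))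

/-- The forward equation for local functions. -/
lemma WeakSolution.lintegral_local (h : FiniteInfluence ν I body Λ)
    (hX : WeakSolution Q ν I body Λ s X) (hs : 0 ≤ s) (hst : s ≤ t)
    {f : Config 𝔾 → ENNReal} (hf : Measurable f) (hf1 : ∀ a, f a ≤ 1)
    {B : Set 𝔾} (hB : MeasurableSet B) (hBfin : ν B < ⊤)
    (hloc : LocalTo B fun a => (f a).toReal) :
    ∫⁻ ω, f (X t ω) ∂Q + ∫⁻ p, f (timeState X p).2 *
        rate ν I body Λ (timeState X p).1 (timeState X p).2 (B ×ˢ univ) ∂(onInterval Q s t) =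
      ∫⁻ ω, f (X s ω) ∂Q + ∫⁻ p, (∫⁻ q in B ×ˢ univ,
        f (joined (timeState X p).1 (timeState X p).2 q)
          ∂(rate ν I body Λ (timeState X p).1 (timeState X p).2)) ∂(onInterval Q s t) := by
  set F : Config 𝔾 → ℝ := fun a => (f a).toReal with hF
  have hftop : ∀ a, f a ≠ ⊤ := fun a => ne_top_of_le_ne_top ENNReal.one_ne_top (hf1 a)
  have hFtest : IsTest ν F := isTest_toReal hf hf1 hB hBfin hloc
  have hF1 : ∀ a, |F a| ≤ 1 := fun a => by
    rw [abs_of_nonneg ENNReal.toReal_nonneg]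
    exact ENNReal.toReal_le_of_le_ofReal zero_le_one (by simpa using hf1 a)
  -- Gain and loss of the generator. Each is at most `ν B` on valid configurations, so the
  -- difference can be taken in `ℝ` and the result rearranged into an identity of sums in `[0, ∞]`.
  let gE : ℝ × Config 𝔾 → ENNReal := fun v =>
    ∫⁻ q in B ×ˢ univ, f (joined v.1 v.2 q) ∂(rate ν I body Λ v.1 v.2)
  let lE : ℝ × Config 𝔾 → ENNReal := fun v => f v.2 * rate ν I body Λ v.1 v.2 (B ×ˢ univ)
  have hBu : MeasurableSet (B ×ˢ (univ : Set ℝ)) := hB.prod MeasurableSet.univ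
  have hgE : Measurable gE := measurable_setLIntegral_rate h hBu (hf.comp measurable_joined)
  have hlE : Measurable lE := (hf.comp measurable_snd).mul (measurable_rate_apply h hBu)
  have hrle : ∀ u a, 0 ≤ u → Valid u a → rate ν I body Λ u a (B ×ˢ univ) ≤ ν B :=
    fun u a hu ha => (rate_prod_le_of_valid hB hu ha).trans (measure_mono inter_subset_left)
  have hgle : ∀ u a, 0 ≤ u → Valid u a → gE (u, a) ≤ ν B := fun u a hu ha => by
    refine (lintegral_mono (g := fun _ => 1) fun q => hf1 _).trans ?_
    simpa using hrle u a hu ha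
  have hlle : ∀ u a, 0 ≤ u → Valid u a → lE (u, a) ≤ ν B := fun u a hu ha => by
    refine (mul_le_mul' (hf1 _) (hrle u a hu ha)).trans (by simp)
  have hgen : ∀ u a, 0 ≤ u → Valid u a →
      generator ν I body Λ u F a = (gE (u, a)).toReal - (lE (u, a)).toReal := by
    intro u a hu ha
    rw [generator_eq_setIntegral h.measurable h.measurable_window h.window_lt_top h.lt_top
      hFtest.measurable hF1 hloc]
    have hfin : IsFiniteMeasure ((rate ν I body Λ u a).restrict (B ×ˢ univ)) :=
      ⟨by rw [Measure.restrict_apply_univ]; exact (hrle u a hu ha).trans_lt hBfin⟩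
    rw [integral_sub, integral_const]
    · congr 1
      · exact integral_toReal (hf.comp (measurable_joined_right u a)).aemeasurable
          (ae_of_all _ fun q => (hftop _).lt_top)
      · simp [lE, hF, ENNReal.toReal_mul, Measure.real, mul_comm]
    · exact Integrable.of_bound
        (hFtest.measurable.comp (measurable_joined_right u a)).aestronglyMeasurable 1
        (ae_of_all _ fun q => hF1 _)
    · exact integrable_const _
  have hev := hX.evolution F hFtest s t le_rfl hst univ MeasurableSet.univ
  simp only [preimage_univ, Measure.restrict_univ] at hev
  have hgbd : ∀ u a, 0 ≤ u → Valid u a → |generator ν I body Λ u F a| ≤ 2 * 1 * (ν B).toReal :=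
    fun u a hu ha => abs_generator_le h.measurable h.measurable_window h.window_lt_top h.lt_top
      hFtest.measurable hF1 hB hBfin hloc hu ha
  rw [(integral_interval_process (Q := Q) (g := fun v => generator ν I body Λ v.1 F v.2) hs hst
    hX.measurable hX.good (measurable_generator h.measurable h.measurable_window h.window_lt_top
      h.lt_top hFtest) hgbd).2] at hev
  have hae := ae_onInterval_timeState (Q := Q) (s := s) (t := t) hs hX.good
  have hT := measurable_timeState hX.measurable hX.good
  have hIg : Integrable (fun p => (gE (timeState X p)).toReal) (onInterval Q s t) :=
    integrable_onInterval hs hX.measurable hX.good (g := fun v => (gE v).toReal)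
      hgE.ennreal_toReal (C := (ν B).toReal) fun u a hu ha => by
        rw [abs_of_nonneg ENNReal.toReal_nonneg]
        exact ENNReal.toReal_mono hBfin.ne (hgle u a hu ha)
  have hIl : Integrable (fun p => (lE (timeState X p)).toReal) (onInterval Q s t) :=
    integrable_onInterval hs hX.measurable hX.good (g := fun v => (lE v).toReal)
      hlE.ennreal_toReal (C := (ν B).toReal) fun u a hu ha => by
        rw [abs_of_nonneg ENNReal.toReal_nonneg]
        exact ENNReal.toReal_mono hBfin.ne (hlle u a hu ha)
  have e1 : ∫ p, generator ν I body Λ (timeState X p).1 F (timeState X p).2 ∂(onInterval Q s t) =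
      (∫⁻ p, gE (timeState X p) ∂(onInterval Q s t)).toReal -
      (∫⁻ p, lE (timeState X p) ∂(onInterval Q s t)).toReal := by
    have eg : ∫ p, (gE (timeState X p)).toReal ∂(onInterval Q s t) =
        (∫⁻ p, gE (timeState X p) ∂(onInterval Q s t)).toReal :=
      integral_toReal (hgE.comp hT).aemeasurable (by
        filter_upwards [hae] with p hp
        exact (hgle _ _ hp.1 hp.2.1).trans_lt hBfin)
    have el : ∫ p, (lE (timeState X p)).toReal ∂(onInterval Q s t) =
        (∫⁻ p, lE (timeState X p) ∂(onInterval Q s t)).toReal :=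
      integral_toReal (hlE.comp hT).aemeasurable (by
        filter_upwards [hae] with p hp
        exact (hlle _ _ hp.1 hp.2.1).trans_lt hBfin)
    rw [← eg, ← el, ← integral_sub hIg hIl]
    refine integral_congr_ae ?_
    filter_upwards [hae] with p hp
    exact hgen _ _ hp.1 hp.2.1
  have hFint : ∀ r, 0 ≤ r → Integrable (fun ω => F (X r ω)) Q := fun r hr =>
    Integrable.of_bound (hFtest.measurable.comp (hX.measurable r hr)).aestronglyMeasurable 1
      (ae_of_all _ fun ω => hF1 _)
  have e2 : ∀ r, 0 ≤ r → ∫ ω, F (X r ω) ∂Q = (∫⁻ ω, f (X r ω) ∂Q).toReal := fun r hr =>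
    integral_toReal (hf.comp (hX.measurable r hr)).aemeasurable
      (ae_of_all _ fun q => (hftop _).lt_top)
  rw [e1, integral_sub (hFint t (hs.trans hst)) (hFint s hs), e2 s hs, e2 t (hs.trans hst)] at hev
  have f1 : ∀ r, ∫⁻ ω, f (X r ω) ∂Q ≠ ⊤ := fun r => by
    refine ne_top_of_le_ne_top (measure_ne_top Q univ) ?_
    exact (lintegral_mono (g := fun _ => 1) fun ω => hf1 _).trans (by simp)
  have f2 : ∀ g : ℝ × Config 𝔾 → ENNReal, (∀ u a, 0 ≤ u → Valid u a → g (u, a) ≤ ν B) →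
      ∫⁻ p, g (timeState X p) ∂(onInterval Q s t) ≠ ⊤ := fun g hg => by
    refine ne_top_of_le_ne_top (b := ν B * onInterval Q s t univ)
      (ENNReal.mul_ne_top hBfin.ne (measure_ne_top _ _)) ?_
    rw [← lintegral_const]
    refine lintegral_mono_ae ?_
    filter_upwards [hae] with p hp
    exact hg _ _ hp.1 hp.2.1
  have f3 := f2 gE hgle
  have f4 := f2 lE hlle
  rw [← ENNReal.toReal_eq_toReal_iff' (ENNReal.add_ne_top.mpr ⟨f1 t, f4⟩)
    (ENNReal.add_ne_top.mpr ⟨f1 s, f3⟩), ENNReal.toReal_add (f1 t) f4, ENNReal.toReal_add (f1 s) f3]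
  linarith

/-- A bound for the time spent jumping in one way after having entered an increasing set. -/
lemma WeakSolution.lintegral_generator_le (h : FiniteInfluence ν I body Λ)
    (hX : WeakSolution Q ν I body Λ s X) (hs : 0 ≤ s) (hst : s ≤ t)
    {U : Set (Config 𝔾)} (hU : MeasurableSet U)
    (hUmono : ∀ a b : Config 𝔾, a.carrier ⊆ b.carrier → a ∈ U → b ∈ U)
    {H : Config 𝔾 → ℝ} (hH : Measurable H) (hH0 : ∀ a, 0 ≤ H a) (hH1 : ∀ a, H a ≤ 1)
    (hHmono : ∀ a b : Config 𝔾, a.carrier ⊆ b.carrier → H a ≤ H b)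
    {B : Set 𝔾} (hB : MeasurableSet B) (hBfin : ν B < ⊤) (hloc : LocalTo B H) :
    ∫⁻ p, U.indicator (fun a => ENNReal.ofReal (generator ν I body Λ (timeState X p).1 H a))
      (timeState X p).2 ∂(onInterval Q s t) ≤ Q (X t ⁻¹' U) := by
  have hHa : ∀ a, |H a| ≤ 1 := fun a => by rw [abs_of_nonneg (hH0 a)]; exact hH1 a
  have hHtest : IsTest ν H := ⟨hH, ⟨1, hHa⟩, ⟨B, hB, hBfin, hloc⟩⟩
  set L : ℝ × Config 𝔾 → ℝ := fun v => generator ν I body Λ v.1 H v.2 with hL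
  have hLm : Measurable L := measurable_generator h.measurable h.measurable_window h.window_lt_top
      h.lt_top hHtest
  have hLnn : ∀ u a, 0 ≤ generator ν I body Λ u H a := by
    intro u a
    rw [generator_eq_integral_rate h.measurable h.measurable_window h.window_lt_top h.lt_top hH hHa]
    exact integral_nonneg fun p => sub_nonneg.mpr (hHmono _ _ subset_union_left)
  set C : ℝ := 2 * 1 * (ν B).toReal with hC
  have hLbd : ∀ u a, 0 ≤ u → Valid u a → |L (u, a)| ≤ C :=
    fun u a hu ha => abs_generator_le h.measurable h.measurable_window h.window_lt_top h.lt_top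
      hH hHa hB hBfin hloc hu ha
  have hC0 : 0 ≤ C := by positivity
  let ψ : ℝ × Config 𝔾 → ℝ := (Prod.snd ⁻¹' U).indicator L
  have hψm : Measurable ψ := hLm.indicator (measurable_snd hU)
  have hψbd : ∀ u a, 0 ≤ u → Valid u a → |ψ (u, a)| ≤ C := fun u a hu ha => by
    by_cases haU : a ∈ U
    · simpa [ψ, indicator, haU] using hLbd u a hu ha
    · simpa [ψ, indicator, haU] using hC0
  have hψnn : ∀ v, 0 ≤ ψ v := fun v => indicator_nonneg (fun v _ => hLnn v.1 v.2) v
  have hT := measurable_timeState hX.measurable hX.good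
  -- Discretization: in each cell the indicator of `U` is evaluated at the left grid point, which
  -- makes it an event of the present to which the evolution equation applies.
  let S : ℕ → Ω → ℝ := fun m ω => ∑ k ∈ Finset.range m,
    ∫ u in (grid s t m k)..(grid s t m (k + 1)),
      U.indicator (fun _ => L (timeState X (u, ω))) (X (grid s t m k) ω)
  have hgrid0 : ∀ m k, 0 ≤ grid s t m k := fun m k => hs.trans (le_grid hst m k)
  have hterm : ∀ m k ω, (∫ u in (grid s t m k)..(grid s t m (k + 1)),
      U.indicator (fun _ => L (timeState X (u, ω))) (X (grid s t m k) ω)) =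
      (X (grid s t m k) ⁻¹' U).indicator
        (fun ω => ∫ u in (grid s t m k)..(grid s t m (k + 1)), L (u, X u ω)) ω := by
    intro m k ω
    by_cases hω : X (grid s t m k) ω ∈ U
    · rw [indicator_of_mem (show ω ∈ X (grid s t m k) ⁻¹' U from hω),
        interval_eq_timeState (hgrid0 m k) (grid_mono hst m (Nat.le_succ k)),
        intervalIntegral.integral_of_le (grid_mono hst m (Nat.le_succ k))]
      simp [indicator_of_mem hω]
    · rw [indicator_of_notMem (show ω ∉ X (grid s t m k) ⁻¹' U from hω)]
      simp [indicator_of_notMem hω]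
  have hIk : ∀ m k, Integrable
      (fun ω => ∫ u in (grid s t m k)..(grid s t m (k + 1)), L (u, X u ω)) Q := fun m k =>
    (integral_interval_process (hgrid0 m k) (grid_mono hst m (Nat.le_succ k)) hX.measurable
      hX.good hLm hLbd).1
  have hUm : ∀ r, 0 ≤ r → MeasurableSet (X r ⁻¹' U) := fun r hr => hX.measurable r hr hU
  have hSint : ∀ m, Integrable (S m) Q := by
    intro m
    refine integrable_finsetSum _ fun k _ => ?_
    simp only [hterm]
    exact (hIk m k).indicator (hUm _ (hgrid0 m k))
  have hHint : ∀ r, 0 ≤ r → Integrable (fun ω => H (X r ω)) Q := fun r hr =>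
    Integrable.of_bound (hH.comp (hX.measurable r hr)).aestronglyMeasurable 1
      (ae_of_all _ fun ω => hHa _)
  have ht : 0 ≤ t := hs.trans hst
  have hSle : ∀ m, 0 < m → ∫ ω, S m ω ∂Q ≤ Q.real (X t ⁻¹' U) := by
    intro m hm
    have e1 : ∫ ω, S m ω ∂Q = ∑ k ∈ Finset.range m, ∫ ω in X (grid s t m k) ⁻¹' U,
        (H (X (grid s t m (k + 1)) ω) - H (X (grid s t m k) ω)) ∂Q := by
      rw [integral_finsetSum]
      · refine Finset.sum_congr rfl fun k _ => ?_
        simp only [hterm]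
        rw [integral_indicator (hUm _ (hgrid0 m k)), hX.evolution H hHtest _ _ (le_grid hst m k)
          (grid_mono hst m (Nat.le_succ k)) U hU]
      · intro k _
        simp only [hterm]
        exact (hIk m k).indicator (hUm _ (hgrid0 m k))
    rw [e1]
    -- Increments of `H` are nonnegative and `U` is never left, so every event may be enlarged to `X
    -- t ∈ U`; the sum then telescopes to at most one.
    calc _ ≤ ∑ k ∈ Finset.range m, ∫ ω in X t ⁻¹' U,
        (H (X (grid s t m (k + 1)) ω) - H (X (grid s t m k) ω)) ∂Q := by
          refine Finset.sum_le_sum fun k hk => ?_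
          have hk' : k < m := Finset.mem_range.mp hk
          refine setIntegral_mono_set ((hHint _ (hgrid0 m _)).sub
            (hHint _ (hgrid0 m _))).integrableOn (ae_of_all _ fun ω => ?_) ?_
          · exact sub_nonneg.mpr (hHmono _ _ ((hX.good ω).mono _ _ (hgrid0 m k)
              (grid_mono hst m (Nat.le_succ k))))
          · exact (show X (grid s t m k) ⁻¹' U ⊆ X t ⁻¹' U from fun ω hω =>
              hUmono _ _ ((hX.good ω).mono _ _ (hgrid0 m k) (grid_le hst hk'.le)) hω).eventuallyLE
      _ = ∫ ω in X t ⁻¹' U, (H (X t ω) - H (X s ω)) ∂Q := by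
          rw [← integral_finsetSum]
          · refine integral_congr_ae (ae_of_all _ fun ω => ?_)
            simp only
            rw [Finset.sum_range_sub (fun k => H (X (grid s t m k) ω)), grid_zero, grid_self s t hm]
          · intro k _
            exact ((hHint _ (hgrid0 m _)).sub (hHint _ (hgrid0 m _))).integrableOn
      _ ≤ ∫ ω in X t ⁻¹' U, (1 : ℝ) ∂Q := by
          refine setIntegral_mono ((hHint _ ht).sub (hHint _ hs)).integrableOn
            (integrable_const _) fun ω => ?_
          linarith [hH1 (X t ω), hH0 (X s ω)]
      _ = _ := by simp
  have hSlim : ∀ ω, Tendsto (fun m => S m ω) atTop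
      (𝓝 (∫ u in s..t, ψ (timeState X (u, ω)))) := by
    intro ω
    have := tendsto_sum_grid_integral hst (C := C)
      (φ := fun r u => U.indicator (fun _ => L (timeState X (u, ω))) (X r ω)) ?_ ?_ ?_
    · simp only [S]
      convert! this using 2
      refine intervalIntegral.integral_congr_ae (ae_of_all _ fun u hu => ?_)
      rw [uIoc_of_le hst] at hu
      by_cases hmem : X u ω ∈ U <;>
        simp [timeState, max_eq_left (hs.trans hu.1.le), ψ, indicator, hmem]
    · intro r
      by_cases hr : X r ω ∈ U
      · simp only [indicator_of_mem hr]
        exact hLm.comp (hT.comp measurable_prodMk_right)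
      · simp only [indicator_of_notMem hr]
        exact measurable_const
    · intro r u hr hru _
      have hu : 0 ≤ u := hs.trans (hr.trans hru)
      by_cases hrU : X r ω ∈ U
      · simp only [indicator_of_mem hrU, timeState, max_eq_left hu]
        exact hLbd u _ hu ((hX.good ω).valid u hu)
      · simp only [indicator_of_notMem hrU, abs_zero]
        exact hC0
    -- At almost every time the path is constant nearby, so sampling at grid points to the left is
    -- harmless in the limit.
    · filter_upwards [ae_eventually_eq_of_mono (hX.good ω).mono] with u hu hsu
      refine tendsto_const_nhds.congr' ?_
      filter_upwards [nhdsWithin_le_nhds (hu (hs.trans_lt hsu))] with r hr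
      rw [hr]
  have hSbd : ∀ m ω, ‖S m ω‖ ≤ C * (t - s) := by
    intro m ω
    rcases Nat.eq_zero_or_pos m with rfl | hm
    · have : 0 ≤ t - s := by linarith
      simp only [S, Finset.range_zero, Finset.sum_empty, norm_zero]
      positivity
    · calc ‖S m ω‖ ≤ ∑ k ∈ Finset.range m, C * (grid s t m (k + 1) - grid s t m k) := by
            refine norm_sum_le_of_le _ fun k _ => ?_
            have hmono := grid_mono hst m (Nat.le_succ k)
            refine (intervalIntegral.norm_integral_le_of_norm_le_const (C := C) fun u hu => ?_).trans
              (by rw [abs_of_nonneg (sub_nonneg.mpr hmono)])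
            rw [uIoc_of_le hmono] at hu
            have hu0 : 0 ≤ u := (hgrid0 m k).trans hu.1.le
            by_cases hrU : X (grid s t m k) ω ∈ U
            · simp only [indicator_of_mem hrU, timeState, max_eq_left hu0]
              exact hLbd u _ hu0 ((hX.good ω).valid u hu0)
            · simp only [indicator_of_notMem hrU, norm_zero]
              exact hC0
        _ = C * (t - s) := by
            rw [← Finset.mul_sum, Finset.sum_range_sub, grid_zero, grid_self s t hm]
  have hlim : Tendsto (fun m => ∫ ω, S m ω ∂Q) atTop
      (𝓝 (∫ ω, (∫ u in s..t, ψ (timeState X (u, ω))) ∂Q)) :=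
    tendsto_integral_of_dominated_convergence (fun _ => C * (t - s))
      (fun m => (hSint m).aestronglyMeasurable) (integrable_const _)
      (fun m => ae_of_all _ (hSbd m)) (ae_of_all _ hSlim)
  have hle : ∫ ω, (∫ u in s..t, ψ (timeState X (u, ω))) ∂Q ≤ Q.real (X t ⁻¹' U) := by
    refine le_of_tendsto hlim ?_
    filter_upwards [eventually_gt_atTop 0] with m hm using hSle m hm
  have hψint := integrable_onInterval (Q := Q) (t := t) hs hX.measurable hX.good hψm hψbd
  have e3 : ∫ ω, (∫ u in s..t, ψ (timeState X (u, ω))) ∂Q =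
      ∫ p, ψ (timeState X p) ∂(onInterval Q s t) := by
    rw [onInterval, integral_prod_symm _ hψint]
    simp only [intervalIntegral.integral_of_le hst]
  rw [e3] at hle
  have e4 : ∫⁻ p, U.indicator (fun a => ENNReal.ofReal
      (generator ν I body Λ (timeState X p).1 H a)) (timeState X p).2 ∂(onInterval Q s t) =
      ENNReal.ofReal (∫ p, ψ (timeState X p) ∂(onInterval Q s t)) := by
    rw [ofReal_integral_eq_lintegral_ofReal hψint (ae_of_all _ fun p => hψnn _)]
    refine lintegral_congr fun p => ?_
    by_cases hp : (timeState X p).2 ∈ U <;> simp [ψ, hp, hL, indicator]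
  rw [e4]
  exact (ENNReal.ofReal_le_ofReal hle).trans (by simp [Measure.real])

end WeakSolutions

end BackwardClan

namespace BackwardClan

/-! ### The forward equation for functions of configurations of a given size -/

section Forward

variable {𝔾 E : Type*} [MeasurableSpace 𝔾] [StandardBorelSpace 𝔾]

lemma Config.measurable_ncard_carrier : Measurable fun a : Config 𝔾 => a.carrier.ncard := by
  simpa using Config.measurable_ncard (𝔾 := 𝔾) MeasurableSet.univ

lemma ncard_restrict_joined {B : Set 𝔾} {u : ℝ} {a : Config 𝔾} {p : 𝔾 × ℝ} (hp : p.1 ∈ B)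
    (hpa : ((p.1, -u, p.2) : Cylinder 𝔾) ∉ a.carrier) :
    ((joined u a p).restrict B).carrier.ncard = (a.restrict B).carrier.ncard + 1 := by
  have : ((joined u a p).restrict B).carrier = insert (p.1, -u, p.2) (a.restrict B).carrier := by
    ext C
    simp only [Config.restrict, joined, Config.add, mem_ofPred_eq, mem_union, mem_singleton_iff,
      mem_insert_iff]
    constructor
    · rintro ⟨h | h, hB⟩
      · exact Or.inr ⟨h, hB⟩
      · exact Or.inl h
    · rintro (rfl | ⟨h, hB⟩)
      · exact ⟨Or.inr rfl, hp⟩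
      · exact ⟨Or.inl h, hB⟩
  rw [this, ncard_insert_of_notMem (fun h => hpa h.1) (a.restrict B).finite]

lemma ncard_joined {u : ℝ} {a : Config 𝔾} {p : 𝔾 × ℝ}
    (hpa : ((p.1, -u, p.2) : Cylinder 𝔾) ∉ a.carrier) :
    (joined u a p).carrier.ncard = a.carrier.ncard + 1 := by
  simpa [Config.restrict] using ncard_restrict_joined (B := univ) (mem_univ _) hpa

lemma restrict_eq_self {B : Set 𝔾} {a : Config 𝔾} (h : a.carrier ⊆ Prod.fst ⁻¹' B) :
    a.restrict B = a := by
  ext C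
  exact ⟨fun hC => hC.1, fun hC => ⟨hC, h hC⟩⟩

lemma eventually_subset_spanningSets (ν : Measure 𝔾) [SigmaFinite ν] (a : Config 𝔾) :
    ∀ᶠ k in atTop, a.carrier ⊆ Prod.fst ⁻¹' (spanningSets ν k) := by
  have : ∀ᶠ k in atTop, ∀ C ∈ a.carrier, C.1 ∈ spanningSets ν k := by
    rw [eventually_all_finite a.finite]
    intro C _
    exact eventually_mem_spanningSets ν C.1
  exact this

/-- Indicator of at least `n` cylinders with basis in `B`. -/
noncomputable def atLeast (B : Set 𝔾) (n : ℕ) (a : Config 𝔾) : ℝ :=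
  {a : Config 𝔾 | n ≤ (a.restrict B).carrier.ncard}.indicator 1 a

lemma measurable_atLeast {B : Set 𝔾} (hB : MeasurableSet B) (n : ℕ) : Measurable (atLeast B n) := by
  refine measurable_one.indicator ?_
  exact (Config.measurable_ncard_carrier.comp (Config.measurable_restrict hB)) measurableSet_Ici

lemma atLeast_nonneg (B : Set 𝔾) (n : ℕ) (a : Config 𝔾) : 0 ≤ atLeast B n a :=
  indicator_nonneg (fun _ _ => zero_le_one) a

lemma atLeast_le_one (B : Set 𝔾) (n : ℕ) (a : Config 𝔾) : atLeast B n a ≤ 1 :=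
  indicator_le_self' (fun _ _ => zero_le_one) a

lemma atLeast_mono (B : Set 𝔾) (n : ℕ) {a b : Config 𝔾} (h : a.carrier ⊆ b.carrier) :
    atLeast B n a ≤ atLeast B n b := by
  by_cases ha : n ≤ (a.restrict B).carrier.ncard
  · have hb : n ≤ (b.restrict B).carrier.ncard :=
      ha.trans (ncard_le_ncard (fun C hC => ⟨h hC.1, hC.2⟩) (b.restrict B).finite)
    simp [atLeast, indicator, ha, hb]
  · have : atLeast B n a = 0 := by simp [atLeast, indicator, ha]
    rw [this]
    exact atLeast_nonneg _ _ _

lemma localTo_atLeast (B : Set 𝔾) (n : ℕ) : LocalTo B (atLeast B n) := by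
  intro a a' h
  have : a.restrict B = a'.restrict B := by
    ext C
    exact ⟨fun hC => ⟨(h C hC.2).mp hC.1, hC.2⟩, fun hC => ⟨(h C hC.2).mpr hC.1, hC.2⟩⟩
  simp [atLeast, indicator, this]

variable {ν : Measure 𝔾} [SigmaFinite ν] {I : 𝔾 → 𝔾 → Prop} {body : 𝔾 → Set E} {Λ : Set E}
  {Ω : Type*} [MeasurableSpace Ω] {Q : Measure Ω} [IsFiniteMeasure Q]
  {X : ℝ → Ω → Config 𝔾} {s t : ℝ}

/-- Brings the dominating rate of passing `n` cylinders over `B` into the form that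
`WeakSolution.lintegral_generator_le` bounds. -/
lemma setLIntegral_atLeast_le (h : FiniteInfluence ν I body Λ) {B : Set 𝔾} (hB : MeasurableSet B)
    (n : ℕ) (u : ℝ) (a : Config 𝔾) :
    ∫⁻ q in B ×ˢ univ, ENNReal.ofReal (atLeast B n (joined u a q) - atLeast B n a)
      ∂(rate ν I body Λ u a) ≤ ENNReal.ofReal (generator ν I body Λ u (atLeast B n) a) := by
  have hb : ∀ a, |atLeast B n a| ≤ 1 := fun a => by
    rw [abs_of_nonneg (atLeast_nonneg _ _ _)]; exact atLeast_le_one _ _ _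
  rw [generator_eq_setIntegral h.measurable h.measurable_window h.window_lt_top h.lt_top
    (measurable_atLeast hB n) hb (localTo_atLeast B n), ofReal_integral_eq_lintegral_ofReal]
  · exact (integrable_rate h.window_lt_top h.lt_top u a
      (measurable_increment (measurable_atLeast hB n) u a)
      (fun p => abs_increment_le hb _ _)).integrableOn
  · exact ae_of_all _ fun p => sub_nonneg.mpr (atLeast_mono _ _ subset_union_left)

/-- Configurations with a basis outside of `B`. -/
def leaving (B : Set 𝔾) : Set (Config 𝔾) := {a | a.carrier ⊆ Prod.fst ⁻¹' B}ᶜ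

lemma measurableSet_leaving {B : Set 𝔾} (hB : MeasurableSet B) : MeasurableSet (leaving B) :=
  (Config.measurableSet_subset (measurable_fst hB)).compl

lemma leaving_anti {B B' : Set 𝔾} (h : B ⊆ B') : leaving B' ⊆ leaving B :=
  compl_subset_compl.mpr fun _ ha => ha.trans (preimage_mono h)

lemma tendsto_measure_leaving (hX : Measurable (X t)) :
    Tendsto (fun k => Q (X t ⁻¹' leaving (spanningSets ν k))) atTop (𝓝 0) := by
  have hemp : ⋂ k, X t ⁻¹' leaving (spanningSets ν k) = ∅ := by
    rw [eq_empty_iff_forall_notMem]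
    intro ω hω
    obtain ⟨k, hk⟩ := (eventually_subset_spanningSets ν (X t ω)).exists
    exact (mem_iInter.mp hω k) hk
  rw [← measure_empty (μ := Q), ← hemp]
  refine tendsto_measure_iInter_atTop (fun k => ?_) ?_ ⟨0, measure_ne_top _ _⟩
  · exact (hX (measurableSet_leaving (measurableSet_spanningSets ν k))).nullMeasurableSet
  · intro k l hkl
    exact preimage_mono (leaving_anti (monotone_spanningSets ν hkl))

/-- Occupation integrals of local approximations converge, provided that the approximations are
dominated by the rate at which the number of cylinders passes a certain value. -/
lemma WeakSolution.tendsto_occupation (h : FiniteInfluence ν I body Λ)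
    (hX : WeakSolution Q ν I body Λ s X) (hs : 0 ≤ s) (hst : s ≤ t) (j : ℕ)
    {φ : (ℝ × Config 𝔾) × (𝔾 × ℝ) → ENNReal} (hφ : Measurable φ)
    {φk : ℕ → (ℝ × Config 𝔾) × (𝔾 × ℝ) → ENNReal} (hφk : ∀ k, Measurable (φk k))
    (h1 : ∀ k v q, v.2 ∉ leaving (spanningSets ν k) → q.1 ∈ spanningSets ν k →
      φk k (v, q) = φ (v, q))
    (h2 : ∀ k (v : ℝ × Config 𝔾) (q : 𝔾 × ℝ), q.1 ∈ spanningSets ν k →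
      ((q.1, -v.1, q.2) : Cylinder 𝔾) ∉ v.2.carrier →
      φk k (v, q) ≤ ENNReal.ofReal
        (atLeast (spanningSets ν k) j (joined v.1 v.2 q) - atLeast (spanningSets ν k) j v.2)) :
    Tendsto (fun k => ∫⁻ p, (∫⁻ q in spanningSets ν k ×ˢ univ, φk k (timeState X p, q)
        ∂(rate ν I body Λ (timeState X p).1 (timeState X p).2)) ∂(onInterval Q s t)) atTop
      (𝓝 (∫⁻ p, (∫⁻ q, φ (timeState X p, q)
        ∂(rate ν I body Λ (timeState X p).1 (timeState X p).2)) ∂(onInterval Q s t))) := by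
  have hBm : ∀ k, MeasurableSet (spanningSets ν k ×ˢ (univ : Set ℝ)) := fun k =>
    (measurableSet_spanningSets ν k).prod MeasurableSet.univ
  have hT := measurable_timeState hX.measurable hX.good
  let G : ℕ → ℝ × Config 𝔾 → ENNReal := fun k v =>
    ∫⁻ q in spanningSets ν k ×ˢ univ, φk k (v, q) ∂(rate ν I body Λ v.1 v.2)
  let U : ℕ → Set (ℝ × Config 𝔾) := fun k => Prod.snd ⁻¹' leaving (spanningSets ν k)
  have hUm : ∀ k, MeasurableSet (U k) := fun k =>
    measurable_snd (measurableSet_leaving (measurableSet_spanningSets ν k))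
  have hG : ∀ k, Measurable (G k) := fun k => measurable_setLIntegral_rate h (hBm k) (hφk k)
  -- Separates the configurations with all bases in the `k`-th set, where the approximation is exact
  -- and increases with `k`, from those with a basis outside.
  have hsplit : ∀ k, ∫⁻ p, G k (timeState X p) ∂(onInterval Q s t) =
      ∫⁻ p, (U k)ᶜ.indicator (G k) (timeState X p) ∂(onInterval Q s t) +
      ∫⁻ p, (U k).indicator (G k) (timeState X p) ∂(onInterval Q s t) := by
    intro k
    have hm : Measurable fun p => (U k)ᶜ.indicator (G k) (timeState X p) :=
      ((hG k).indicator (hUm k).compl).comp hT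
    rw [← lintegral_add_left hm]
    refine lintegral_congr fun p => ?_
    exact (congrFun (indicator_compl_add_self (U k) (G k)) _).symm
  have hlim1 : Tendsto (fun k => ∫⁻ p, (U k)ᶜ.indicator (G k) (timeState X p) ∂(onInterval Q s t))
      atTop (𝓝 (∫⁻ p, (∫⁻ q, φ (timeState X p, q)
        ∂(rate ν I body Λ (timeState X p).1 (timeState X p).2)) ∂(onInterval Q s t))) := by
    have hind : ∀ k v, v ∉ U k → G k v =
        ∫⁻ q, (spanningSets ν k ×ˢ univ).indicator (fun q => φ (v, q)) q
          ∂(rate ν I body Λ v.1 v.2) := by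
      intro k v hv
      rw [lintegral_indicator (hBm k)]
      exact setLIntegral_congr_fun (hBm k) fun q hq => h1 k v q hv hq.1
    refine lintegral_tendsto_of_tendsto_of_monotone
      (fun k => (((hG k).indicator (hUm k).compl).comp hT).aemeasurable)
      (ae_of_all _ fun p k l hkl => ?_) (ae_of_all _ fun p => ?_)
    · by_cases hk : timeState X p ∈ U k
      · simp only
        rw [indicator_of_notMem (notMem_compl_iff.mpr hk)]
        exact zero_le
      · have hl : timeState X p ∉ U l := fun hl => hk (leaving_anti (monotone_spanningSets ν hkl) hl)
        simp only
        rw [indicator_of_mem (show _ ∈ (U k)ᶜ from hk), indicator_of_mem (show _ ∈ (U l)ᶜ from hl),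
          hind k _ hk, hind l _ hl]
        refine lintegral_mono fun q => ?_
        exact indicator_le_indicator_of_subset
          (prod_mono_left (monotone_spanningSets ν hkl)) (fun _ => zero_le) q
    · have hev := eventually_subset_spanningSets ν (timeState X p).2
      have hconv : Tendsto (fun k => ∫⁻ q, (spanningSets ν k ×ˢ univ).indicator
          (fun q => φ (timeState X p, q)) q ∂(rate ν I body Λ (timeState X p).1 (timeState X p).2))
          atTop (𝓝 (∫⁻ q, φ (timeState X p, q)
            ∂(rate ν I body Λ (timeState X p).1 (timeState X p).2))) := by
        refine lintegral_tendsto_of_tendsto_of_monotone (fun k =>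
          ((hφ.comp measurable_prodMk_left).indicator (hBm k)).aemeasurable)
          (ae_of_all _ fun q k l hkl => ?_) (ae_of_all _ fun q => ?_)
        · exact indicator_le_indicator_of_subset
            (prod_mono_left (monotone_spanningSets ν hkl)) (fun _ => zero_le) q
        · refine tendsto_const_nhds.congr' ?_
          filter_upwards [eventually_mem_spanningSets ν q.1] with k hk
          rw [indicator_of_mem (show q ∈ spanningSets ν k ×ˢ univ from ⟨hk, mem_univ _⟩)]
      refine hconv.congr' ?_
      filter_upwards [hev] with k hk
      have hk' : timeState X p ∉ U k := fun hc => hc hk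
      rw [indicator_of_mem (show _ ∈ (U k)ᶜ from hk'), hind k _ hk']
  -- On configurations that have left the `k`-th set, the integrand is at most the rate of passing
  -- `j` cylinders over that set. Its time integral is bounded by the probability of having left by
  -- time `t`, which tends to `0`.
  have hlim2 : Tendsto (fun k => ∫⁻ p, (U k).indicator (G k) (timeState X p) ∂(onInterval Q s t))
      atTop (𝓝 0) := by
    refine tendsto_of_tendsto_of_tendsto_of_le_of_le tendsto_const_nhds
      (tendsto_measure_leaving (Q := Q) (ν := ν) (hX.measurable t (hs.trans hst)))
      (fun _ => zero_le) fun k => ?_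
    have hBk := measurableSet_spanningSets ν k
    refine le_trans ?_ (hX.lintegral_generator_le h hs hst (measurableSet_leaving hBk) ?_
      (measurable_atLeast hBk j) (atLeast_nonneg _ _) (atLeast_le_one _ _)
      (fun a b hab => atLeast_mono _ _ hab) hBk (measure_spanningSets_lt_top ν k)
      (localTo_atLeast _ _))
    · refine lintegral_mono fun p => ?_
      by_cases hp : timeState X p ∈ U k
      · rw [indicator_of_mem hp, indicator_of_mem (show (timeState X p).2 ∈ _ from hp)]
        refine le_trans ?_ (setLIntegral_atLeast_le h hBk j _ _)
        refine setLIntegral_mono_ae' (hBm k) ?_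
        filter_upwards [ae_rate_notMem (ν := ν) (I := I) (body := body) (Λ := Λ)
          (timeState X p).1 (timeState X p).2] with q hq hqB
        exact h2 k _ q hqB.1 hq
      · rw [indicator_of_notMem hp]
        exact zero_le
    · intro a b hab ha hb
      exact ha (hab.trans hb)
  have := hlim1.add hlim2
  rw [add_zero] at this
  refine this.congr fun k => (hsplit k).symm

lemma restrict_joined {B : Set 𝔾} {u : ℝ} {a : Config 𝔾} {q : 𝔾 × ℝ}
    (ha : a ∉ leaving B) (hq : q.1 ∈ B) : (joined u a q).restrict B = joined u a q := by
  refine restrict_eq_self ?_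
  rintro C (hC | rfl)
  · exact (not_not.mp ha) hC
  · exact hq

/-- The forward equation for functions supported by the configurations of a given size. -/
lemma WeakSolution.lintegral_forward (h : FiniteInfluence ν I body Λ)
    (hX : WeakSolution Q ν I body Λ s X) (hs : 0 ≤ s) (hst : s ≤ t)
    {f : Config 𝔾 → ENNReal} (hf : Measurable f) (hf1 : ∀ a, f a ≤ 1)
    {n : ℕ} (hn : ∀ a, a.carrier.ncard ≠ n → f a = 0) :
    ∫⁻ ω, f (X t ω) ∂Q + ∫⁻ p, f (timeState X p).2 *
        rate ν I body Λ (timeState X p).1 (timeState X p).2 univ ∂(onInterval Q s t) =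
      ∫⁻ ω, f (X s ω) ∂Q + ∫⁻ p, (∫⁻ q,
        f (joined (timeState X p).1 (timeState X p).2 q)
          ∂(rate ν I body Λ (timeState X p).1 (timeState X p).2)) ∂(onInterval Q s t) := by
  have hBk := measurableSet_spanningSets ν
  -- A function of the size of the whole configuration is not local; it is approximated by functions
  -- of the part over sets of finite measure, which exhaust the space.
  let fk : ℕ → Config 𝔾 → ENNReal := fun k a => f (a.restrict (spanningSets ν k))
  have hfk : ∀ k, Measurable (fk k) := fun k => hf.comp (Config.measurable_restrict (hBk k))
  have hT : ∀ r, 0 ≤ r → Tendsto (fun k => ∫⁻ ω, fk k (X r ω) ∂Q) atTop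
      (𝓝 (∫⁻ ω, f (X r ω) ∂Q)) := by
    intro r hr
    refine tendsto_lintegral_of_dominated_convergence (fun _ => 1)
      (fun k => (hfk k).comp (hX.measurable r hr)) (fun k => ae_of_all _ fun ω => hf1 _)
      (by simp) (ae_of_all _ fun ω => ?_)
    refine tendsto_const_nhds.congr' ?_
    filter_upwards [eventually_subset_spanningSets ν (X r ω)] with k hk
    simp only [fk, restrict_eq_self hk]
  -- A jump out of size `n` passes the value `n + 1`.
  have hloss := hX.tendsto_occupation h hs hst (n + 1)
    (φ := fun z => f z.1.2) (hf.comp (measurable_snd.comp measurable_fst))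
    (φk := fun k z => fk k z.1.2) (fun k => (hfk k).comp (measurable_snd.comp measurable_fst))
    (fun k v q hv _ => by simp only [fk, restrict_eq_self (not_not.mp hv)])
    (fun k v q hq hqa => by
      by_cases hc : (v.2.restrict (spanningSets ν k)).carrier.ncard = n
      · have e1 : atLeast (spanningSets ν k) (n + 1) (joined v.1 v.2 q) = 1 := by
          simp [atLeast, indicator, ncard_restrict_joined hq hqa, hc]
        have e2 : atLeast (spanningSets ν k) (n + 1) v.2 = 0 := by
          simp [atLeast, indicator, hc]
        rw [e1, e2]
        simpa using hf1 _
      · simp only [fk, hn _ hc]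
        exact zero_le)
  -- A jump into size `n` passes the value `n`.
  have hgain := hX.tendsto_occupation h hs hst n
    (φ := fun z => f (joined z.1.1 z.1.2 z.2)) (hf.comp measurable_joined)
    (φk := fun k z => fk k (joined z.1.1 z.1.2 z.2)) (fun k => (hfk k).comp measurable_joined)
    (fun k v q hv hq => by simp only [fk, restrict_joined hv hq])
    (fun k v q hq hqa => by
      by_cases hc : ((joined v.1 v.2 q).restrict (spanningSets ν k)).carrier.ncard = n
      · have hc' := hc
        rw [ncard_restrict_joined hq hqa] at hc'
        have e1 : atLeast (spanningSets ν k) n (joined v.1 v.2 q) = 1 := by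
          simp [atLeast, indicator, hc]
        have e2 : atLeast (spanningSets ν k) n v.2 = 0 := by
          simp [atLeast, indicator, ← hc']
        rw [e1, e2]
        simpa using hf1 _
      · simp only [fk, hn _ hc]
        exact zero_le)
  have hlocal : ∀ k, ∫⁻ ω, fk k (X t ω) ∂Q + ∫⁻ p, (∫⁻ q in spanningSets ν k ×ˢ univ,
        fk k (timeState X p).2 ∂(rate ν I body Λ (timeState X p).1 (timeState X p).2))
        ∂(onInterval Q s t) =
      ∫⁻ ω, fk k (X s ω) ∂Q + ∫⁻ p, (∫⁻ q in spanningSets ν k ×ˢ univ,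
        fk k (joined (timeState X p).1 (timeState X p).2 q)
          ∂(rate ν I body Λ (timeState X p).1 (timeState X p).2)) ∂(onInterval Q s t) := by
    intro k
    have := hX.lintegral_local h hs hst (hfk k) (fun a => hf1 _) (hBk k)
      (measure_spanningSets_lt_top ν k) (by
        intro a a' haa
        have : a.restrict (spanningSets ν k) = a'.restrict (spanningSets ν k) := by
          ext C
          exact ⟨fun hC => ⟨(haa C hC.2).mp hC.1, hC.2⟩, fun hC => ⟨(haa C hC.2).mpr hC.1, hC.2⟩⟩
        simp only [fk, this])
    simpa only [lintegral_const, Measure.restrict_apply_univ] using this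
  have hL := (hT t (hs.trans hst)).add hloss
  have hR := (hT s hs).add hgain
  have hL' := hL.congr hlocal
  have := tendsto_nhds_unique hL' hR
  simpa only [lintegral_const] using this

end Forward

end BackwardClan

namespace BackwardClan

/-! ### Uniqueness in law of weak solutions -/

section Uniqueness

variable {𝔾 E : Type*} [MeasurableSpace 𝔾] [StandardBorelSpace 𝔾]
  {ν : Measure 𝔾} [SigmaFinite ν] {I : 𝔾 → 𝔾 → Prop} {body : 𝔾 → Set E} {Λ : Set E}

/-- Configurations of a given size. -/
def ofSize (𝔾 : Type*) (n : ℕ) : Set (Config 𝔾) := {a | a.carrier.ncard = n}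

lemma measurableSet_ofSize (n : ℕ) : MeasurableSet (ofSize 𝔾 n) :=
  Config.measurable_ncard_carrier (measurableSet_singleton n)

lemma measurable_measure_potential (h : FiniteInfluence ν I body Λ) :
    Measurable fun a : Config 𝔾 => ν (potential I body Λ a) :=
  measurable_measure_prodMk_left (measurableSet_potential_prod h.measurable h.measurable_window)

lemma lintegral_onInterval {Ω : Type*} [MeasurableSpace Ω] {Q : Measure Ω} [IsFiniteMeasure Q]
    {X : ℝ → Ω → Config 𝔾} {s t : ℝ} (hs : 0 ≤ s) (hX : ∀ t, 0 ≤ t → Measurable (X t))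
    (hg : ∀ ω, GoodPath fun t => X t ω) {g : ℝ × Config 𝔾 → ENNReal} (hgm : Measurable g) :
    ∫⁻ p, g (timeState X p) ∂(onInterval Q s t) =
      ∫⁻ u in Ioc s t, (∫⁻ ω, g (u, X u ω) ∂Q) := by
  have hm : Measurable fun p => g (timeState X p) := hgm.comp (measurable_timeState hX hg)
  rw [onInterval, lintegral_prod _ hm.aemeasurable]
  refine setLIntegral_congr_fun measurableSet_Ioc fun u hu => ?_
  simp only [timeState, max_eq_left (hs.trans hu.1.le)]

lemma lintegral_timeState_congr {Ω Ω' : Type*} [MeasurableSpace Ω] {Q : Measure Ω}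
    [MeasurableSpace Ω'] {Q' : Measure Ω'}
    {X : Ω → Config 𝔾} {X' : Ω' → Config 𝔾} (hX : Measurable X) (hX' : Measurable X') {n : ℕ}
    (hlaw : (Q.map X).restrict (ofSize 𝔾 n) = (Q'.map X').restrict (ofSize 𝔾 n))
    {g : Config 𝔾 → ENNReal} (hg : Measurable g) (hn : ∀ a, a ∉ ofSize 𝔾 n → g a = 0) :
    ∫⁻ ω, g (X ω) ∂Q = ∫⁻ ω, g (X' ω) ∂Q' := by
  have hind : (ofSize 𝔾 n).indicator g = g := indicator_eq_self.mpr fun a ha => by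
    by_contra hc
    exact ha (hn a hc)
  rw [← lintegral_map hg hX, ← lintegral_map hg hX', ← hind,
    lintegral_indicator (measurableSet_ofSize n), lintegral_indicator (measurableSet_ofSize n), hlaw]

section Comparison

variable {Ω Ω' : Type*} [MeasurableSpace Ω] {Q : Measure Ω} [IsFiniteMeasure Q]
  [MeasurableSpace Ω'] {Q' : Measure Ω'} [IsFiniteMeasure Q']
  {X : ℝ → Ω → Config 𝔾} {X' : ℝ → Ω' → Config 𝔾} {s t : ℝ}

/-- One step of a Picard iteration. With equal initial values and gains, the sums `value + loss`
agree, so the values differ by at most the difference of the losses; the loss is `M` times a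
function of the same class as `f`, to which the bound `ε` applies. -/
lemma WeakSolution.le_add_of_forall_le (h : FiniteInfluence ν I body Λ)
    (hX : WeakSolution Q ν I body Λ s X) (hX' : WeakSolution Q' ν I body Λ s X')
    (hs : 0 ≤ s) (hst : s ≤ t) {n : ℕ} {M : ENNReal} (hM0 : M ≠ 0) (hMtop : M ≠ ⊤)
    {f : Config 𝔾 → ENNReal} (hf : Measurable f) (hf1 : ∀ a, f a ≤ 1)
    (hsupp : ∀ a, f a ≠ 0 → a.carrier.ncard = n ∧ ν (potential I body Λ a) ≤ M)
    (hinit : ∫⁻ ω, f (X s ω) ∂Q = ∫⁻ ω, f (X' s ω) ∂Q')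
    (hgain : ∫⁻ p, (∫⁻ q, f (joined (timeState X p).1 (timeState X p).2 q)
        ∂(rate ν I body Λ (timeState X p).1 (timeState X p).2)) ∂(onInterval Q s t) =
      ∫⁻ p, (∫⁻ q, f (joined (timeState X' p).1 (timeState X' p).2 q)
        ∂(rate ν I body Λ (timeState X' p).1 (timeState X' p).2)) ∂(onInterval Q' s t))
    {ε : ℝ → ENNReal}
    (hε : ∀ u ∈ Ioc s t, ∀ g : Config 𝔾 → ENNReal, Measurable g → (∀ a, g a ≤ 1) →
      (∀ a, g a ≠ 0 → a.carrier.ncard = n ∧ ν (potential I body Λ a) ≤ M) →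
      ∫⁻ ω, g (X' u ω) ∂Q' ≤ ∫⁻ ω, g (X u ω) ∂Q + ε u) :
    ∫⁻ ω, f (X t ω) ∂Q ≤ ∫⁻ ω, f (X' t ω) ∂Q' + ∫⁻ u in Ioc s t, M * ε u := by
  have hn : ∀ a, a.carrier.ncard ≠ n → f a = 0 := fun a ha => by
    by_contra hc
    exact ha (hsupp a hc).1
  have e := hX.lintegral_forward h hs hst hf hf1 hn
  have e' := hX'.lintegral_forward h hs hst hf hf1 hn
  rw [hinit, hgain, ← e'] at e
  -- Normalized loss. On valid configurations charged by `f` the rate is at most `M` and the minimum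
  -- is not active; it only keeps `g ≤ 1` on all other configurations.
  let g : ℝ → Config 𝔾 → ENNReal := fun u a => f a * min (rate ν I body Λ u a univ / M) 1
  have hgm2 : Measurable fun v : ℝ × Config 𝔾 => g v.1 v.2 :=
    (hf.comp measurable_snd).mul
      (((measurable_rate_apply h MeasurableSet.univ).div_const M).min measurable_const)
  have hgm : ∀ u, Measurable (g u) := fun u => hgm2.comp measurable_prodMk_left
  have hg1 : ∀ u a, g u a ≤ 1 := fun u a =>
    (mul_le_mul' (hf1 a) (min_le_right _ _)).trans (by simp)
  have hgsupp : ∀ u a, g u a ≠ 0 → a.carrier.ncard = n ∧ ν (potential I body Λ a) ≤ M :=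
    fun u a ha => hsupp a fun h0 => ha (by simp [g, h0])
  have hgeq : ∀ u a, 0 ≤ u → Valid u a → f a * rate ν I body Λ u a univ = M * g u a := by
    intro u a hu ha
    by_cases h0 : f a = 0
    · simp [g, h0]
    · have hle : rate ν I body Λ u a univ ≤ M := by
        have := rate_prod_le_of_valid (ν := ν) (I := I) (body := body) (Λ := Λ)
          MeasurableSet.univ hu ha
        rw [univ_prod_univ, univ_inter] at this
        exact this.trans (hsupp a h0).2
      have hle1 : rate ν I body Λ u a univ / M ≤ 1 := ENNReal.div_le_of_le_mul (by simpa using hle)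
      simp only [g, min_eq_left hle1]
      rw [mul_left_comm, ENNReal.mul_div_cancel hM0 hMtop]
  have hlossm : Measurable fun v : ℝ × Config 𝔾 => f v.2 * rate ν I body Λ v.1 v.2 univ :=
    (hf.comp measurable_snd).mul (measurable_rate_apply h MeasurableSet.univ)
  have hl := lintegral_onInterval (Q := Q) (t := t) hs hX.measurable hX.good hlossm
  have hl' := lintegral_onInterval (Q := Q') (t := t) hs hX'.measurable hX'.good hlossm
  have hloss : ∫⁻ u in Ioc s t, (∫⁻ ω, f (X u ω) * rate ν I body Λ u (X u ω) univ ∂Q) =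
      ∫⁻ u in Ioc s t, M * ∫⁻ ω, g u (X u ω) ∂Q := by
    refine setLIntegral_congr_fun measurableSet_Ioc fun u hu => ?_
    have hu0 : 0 ≤ u := hs.trans hu.1.le
    have hm : Measurable fun ω => g u (X u ω) := (hgm u).comp (hX.measurable u hu0)
    rw [← lintegral_const_mul _ hm]
    exact lintegral_congr fun ω => hgeq u _ hu0 ((hX.good ω).valid u hu0)
  have hloss' : ∫⁻ u in Ioc s t, (∫⁻ ω, f (X' u ω) * rate ν I body Λ u (X' u ω) univ ∂Q') =
      ∫⁻ u in Ioc s t, M * ∫⁻ ω, g u (X' u ω) ∂Q' := by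
    refine setLIntegral_congr_fun measurableSet_Ioc fun u hu => ?_
    have hu0 : 0 ≤ u := hs.trans hu.1.le
    have hm : Measurable fun ω => g u (X' u ω) := (hgm u).comp (hX'.measurable u hu0)
    rw [← lintegral_const_mul _ hm]
    exact lintegral_congr fun ω => hgeq u _ hu0 ((hX'.good ω).valid u hu0)
  simp only [hl, hl'] at e
  rw [hloss, hloss'] at e
  have hmeas : Measurable fun u => M * ∫⁻ ω, g (timeState X (u, ω)).1 (timeState X (u, ω)).2 ∂Q :=
    ((hgm2.comp (measurable_timeState hX.measurable hX.good)).lintegral_prod_right').const_mul M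
  have hle : ∫⁻ u in Ioc s t, M * ∫⁻ ω, g u (X' u ω) ∂Q' ≤
      (∫⁻ u in Ioc s t, M * ∫⁻ ω, g u (X u ω) ∂Q) + ∫⁻ u in Ioc s t, M * ε u := by
    have e3 : ∫⁻ u in Ioc s t, M * ∫⁻ ω, g u (X u ω) ∂Q = ∫⁻ u in Ioc s t,
        M * ∫⁻ ω, g (timeState X (u, ω)).1 (timeState X (u, ω)).2 ∂Q := by
      refine setLIntegral_congr_fun measurableSet_Ioc fun u hu => ?_
      simp only [timeState, max_eq_left (hs.trans hu.1.le)]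
    rw [e3, ← lintegral_add_left hmeas]
    refine setLIntegral_mono' measurableSet_Ioc fun u hu => ?_
    simp only [timeState, max_eq_left (hs.trans hu.1.le)]
    rw [← mul_add]
    exact mul_le_mul' le_rfl (hε u hu (g u) (hgm u) (hg1 u) (hgsupp u))
  -- Finiteness of the loss permits its cancellation in `[0, ∞]`.
  have hfin : ∫⁻ u in Ioc s t, M * ∫⁻ ω, g u (X u ω) ∂Q ≠ ⊤ := by
    refine ne_top_of_le_ne_top (b := ∫⁻ _ in Ioc s t, M * Q univ) ?_ ?_
    · rw [setLIntegral_const]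
      exact ENNReal.mul_ne_top (ENNReal.mul_ne_top hMtop (measure_ne_top _ _)) (by simp)
    · refine lintegral_mono fun u => mul_le_mul' le_rfl ?_
      exact (lintegral_mono (g := fun _ => 1) fun ω => hg1 u _).trans (by simp)
  refine (ENNReal.add_le_add_iff_right hfin).mp ?_
  rw [e]
  calc _ ≤ ∫⁻ ω, f (X' t ω) ∂Q' + ((∫⁻ u in Ioc s t, M * ∫⁻ ω, g u (X u ω) ∂Q) +
        ∫⁻ u in Ioc s t, M * ε u) := add_le_add le_rfl hle
    _ = _ := by ring

lemma lintegral_pow_div_factorial {s t : ℝ} (hst : s ≤ t) {M : ℝ} (hM : 0 ≤ M) (c : ENNReal)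
    (j : ℕ) :
    ∫⁻ u in Ioc s t, ENNReal.ofReal M * (c * ENNReal.ofReal ((M * (u - s)) ^ j / j.factorial)) =
      c * ENNReal.ofReal ((M * (t - s)) ^ (j + 1) / (j + 1).factorial) := by
  have hm : Measurable fun u : ℝ => ENNReal.ofReal ((M * (u - s)) ^ j / j.factorial) := by fun_prop
  have e1 : ∀ u : ℝ, ENNReal.ofReal M * (c * ENNReal.ofReal ((M * (u - s)) ^ j / j.factorial)) =
      c * (ENNReal.ofReal M * ENNReal.ofReal ((M * (u - s)) ^ j / j.factorial)) := fun u => by ring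
  simp only [e1]
  rw [lintegral_const_mul _ (hm.const_mul _), lintegral_const_mul _ hm,
    ← ofReal_integral_eq_lintegral_ofReal, ← intervalIntegral.integral_of_le hst,
    ← ENNReal.ofReal_mul hM]
  · congr 2
    have : ∀ u : ℝ, (M * (u - s)) ^ j / j.factorial = M ^ j / j.factorial * (u - s) ^ j := fun u => by
      rw [mul_pow]; ring
    simp only [this]
    rw [intervalIntegral.integral_const_mul,
      intervalIntegral.integral_comp_sub_right (fun u => u ^ j) s, sub_self, integral_pow,
      zero_pow (Nat.succ_ne_zero j), sub_zero, Nat.factorial_succ, mul_pow]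
    push_cast
    field_simp
    ring
  · exact (Continuous.integrableOn_Icc (by fun_prop)).mono_set Ioc_subset_Icc_self
  · refine (ae_restrict_iff' measurableSet_Ioc).mpr (ae_of_all _ fun u hu => ?_)
    have : 0 ≤ u - s := by linarith [hu.1]
    positivity

/-- The Picard step is iterated from the trivial bound by total masses. Both inequalities are
carried along because each one at step `j + 1` uses the opposite one at step `j`. -/
lemma WeakSolution.lintegral_le_of_gain (h : FiniteInfluence ν I body Λ)
    (hX : WeakSolution Q ν I body Λ s X) (hX' : WeakSolution Q' ν I body Λ s X')
    (hs : 0 ≤ s) {n : ℕ} {M : ℝ} (hM : 0 < M)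
    (hinit : Q.map (X s) = Q'.map (X' s))
    (hgain : ∀ t, s ≤ t → ∀ f : Config 𝔾 → ENNReal, Measurable f → (∀ a, f a ≤ 1) →
      (∀ a, a.carrier.ncard ≠ n → f a = 0) →
      ∫⁻ p, (∫⁻ q, f (joined (timeState X p).1 (timeState X p).2 q)
        ∂(rate ν I body Λ (timeState X p).1 (timeState X p).2)) ∂(onInterval Q s t) =
      ∫⁻ p, (∫⁻ q, f (joined (timeState X' p).1 (timeState X' p).2 q)
        ∂(rate ν I body Λ (timeState X' p).1 (timeState X' p).2)) ∂(onInterval Q' s t))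
    (j : ℕ) : ∀ t, s ≤ t → ∀ f : Config 𝔾 → ENNReal, Measurable f → (∀ a, f a ≤ 1) →
      (∀ a, f a ≠ 0 → a.carrier.ncard = n ∧ ν (potential I body Λ a) ≤ ENNReal.ofReal M) →
      ∫⁻ ω, f (X t ω) ∂Q ≤ ∫⁻ ω, f (X' t ω) ∂Q' +
          (Q univ + Q' univ) * ENNReal.ofReal ((M * (t - s)) ^ j / j.factorial) ∧
      ∫⁻ ω, f (X' t ω) ∂Q' ≤ ∫⁻ ω, f (X t ω) ∂Q +
          (Q univ + Q' univ) * ENNReal.ofReal ((M * (t - s)) ^ j / j.factorial) := by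
  have hM0 : ENNReal.ofReal M ≠ 0 := by simpa using hM
  induction j with
  | zero =>
    intro t hst f hf hf1 hsupp
    have b1 : ∫⁻ ω, f (X t ω) ∂Q ≤ Q univ :=
      (lintegral_mono (g := fun _ => 1) fun ω => hf1 _).trans (by simp)
    have b2 : ∫⁻ ω, f (X' t ω) ∂Q' ≤ Q' univ :=
      (lintegral_mono (g := fun _ => 1) fun ω => hf1 _).trans (by simp)
    simp only [pow_zero, Nat.factorial_zero, Nat.cast_one, div_one, ENNReal.ofReal_one, mul_one]
    exact ⟨b1.trans (le_add_left le_self_add), b2.trans (le_add_left le_add_self)⟩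
  | succ j ih =>
    intro t hst f hf hf1 hsupp
    have hi : ∫⁻ ω, f (X s ω) ∂Q = ∫⁻ ω, f (X' s ω) ∂Q' := by
      rw [← lintegral_map hf (hX.measurable s hs), ← lintegral_map hf (hX'.measurable s hs), hinit]
    have hn : ∀ a, a.carrier.ncard ≠ n → f a = 0 := fun a ha => by
      by_contra hc
      exact ha (hsupp a hc).1
    have hg := hgain t hst f hf hf1 hn
    rw [← lintegral_pow_div_factorial hst hM.le]
    exact ⟨hX.le_add_of_forall_le h hX' hs hst hM0 ENNReal.ofReal_ne_top hf hf1 hsupp hi hg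
        fun u hu g hg hg1 hgs => (ih u hu.1.le g hg hg1 hgs).2,
      hX'.le_add_of_forall_le h hX hs hst hM0 ENNReal.ofReal_ne_top hf hf1 hsupp hi.symm hg.symm
        fun u hu g hg hg1 hgs => (ih u hu.1.le g hg hg1 hgs).1⟩

lemma WeakSolution.restrict_map_eq_of_gain (h : FiniteInfluence ν I body Λ)
    (hX : WeakSolution Q ν I body Λ s X) (hX' : WeakSolution Q' ν I body Λ s X')
    (hs : 0 ≤ s) {n : ℕ}
    (hinit : Q.map (X s) = Q'.map (X' s))
    (hgain : ∀ t, s ≤ t → ∀ f : Config 𝔾 → ENNReal, Measurable f → (∀ a, f a ≤ 1) →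
      (∀ a, a.carrier.ncard ≠ n → f a = 0) →
      ∫⁻ p, (∫⁻ q, f (joined (timeState X p).1 (timeState X p).2 q)
        ∂(rate ν I body Λ (timeState X p).1 (timeState X p).2)) ∂(onInterval Q s t) =
      ∫⁻ p, (∫⁻ q, f (joined (timeState X' p).1 (timeState X' p).2 q)
        ∂(rate ν I body Λ (timeState X' p).1 (timeState X' p).2)) ∂(onInterval Q' s t))
    (hst : s ≤ t) :
    (Q.map (X t)).restrict (ofSize 𝔾 n) = (Q'.map (X' t)).restrict (ofSize 𝔾 n) := by
  have ht := hs.trans hst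
  -- Sets of bounded loss rate, exhausting all configurations because every potential set has finite
  -- measure. The summand `1` keeps the bound positive.
  let D : ℕ → Set (Config 𝔾) := fun M => {a | ν (potential I body Λ a) ≤ ENNReal.ofReal (M + 1)}
  have hDm : ∀ M, MeasurableSet (D M) := fun M => measurable_measure_potential h measurableSet_Iic
  have hDmono : Monotone D := fun M N hMN a ha => le_trans (show _ ≤ _ from ha)
    (ENNReal.ofReal_le_ofReal (by gcongr))
  have hDuniv : ⋃ M, D M = univ := by
    rw [eq_univ_iff_forall]
    intro a
    have hlt := measure_potential_lt_top h.window_lt_top h.lt_top a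
    obtain ⟨M, hM⟩ := exists_nat_ge (ν (potential I body Λ a)).toReal
    refine mem_iUnion.mpr ⟨M, ?_⟩
    exact (ENNReal.le_ofReal_iff_toReal_le hlt.ne (by positivity)).mpr (by linarith)
  ext A hA
  have hAn := hA.inter (measurableSet_ofSize (𝔾 := 𝔾) n)
  rw [Measure.restrict_apply hA, Measure.restrict_apply hA, Measure.map_apply (hX.measurable t ht) hAn,
    Measure.map_apply (hX'.measurable t ht) hAn]
  have key : ∀ M, Q (X t ⁻¹' (A ∩ ofSize 𝔾 n ∩ D M)) = Q' (X' t ⁻¹' (A ∩ ofSize 𝔾 n ∩ D M)) := by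
    intro M
    have hset := hAn.inter (hDm M)
    let f : Config 𝔾 → ENNReal := (A ∩ ofSize 𝔾 n ∩ D M).indicator 1
    have hf : Measurable f := measurable_one.indicator hset
    have e1 : ∫⁻ ω, f (X t ω) ∂Q = Q (X t ⁻¹' (A ∩ ofSize 𝔾 n ∩ D M)) := by
      rw [← lintegral_indicator_one (hX.measurable t ht hset)]; rfl
    have e2 : ∫⁻ ω, f (X' t ω) ∂Q' = Q' (X' t ⁻¹' (A ∩ ofSize 𝔾 n ∩ D M)) := by
      rw [← lintegral_indicator_one (hX'.measurable t ht hset)]; rfl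
    have hlim : Tendsto (fun j : ℕ => (Q univ + Q' univ) *
        ENNReal.ofReal ((((M : ℝ) + 1) * (t - s)) ^ j / j.factorial)) atTop (𝓝 0) := by
      have h1 := ENNReal.tendsto_ofReal
        (FloorSemiring.tendsto_pow_div_factorial_atTop (((M : ℝ) + 1) * (t - s)))
      have h2 := ENNReal.Tendsto.const_mul (a := Q univ + Q' univ) h1
        (Or.inr (ENNReal.add_ne_top.mpr ⟨measure_ne_top _ _, measure_ne_top _ _⟩))
      simpa using h2
    have hb := fun j => hX.lintegral_le_of_gain h hX' hs (n := n) (M := (M : ℝ) + 1) (by positivity)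
      hinit hgain j t hst f hf (fun a => indicator_le_self' (fun _ _ => zero_le_one) a)
      (fun a ha => by
        have : a ∈ A ∩ ofSize 𝔾 n ∩ D M := mem_of_indicator_ne_zero ha
        exact ⟨this.1.2, this.2⟩)
    rw [← e1, ← e2]
    refine le_antisymm ?_ ?_
    · have := ge_of_tendsto' (hlim.const_add (∫⁻ ω, f (X' t ω) ∂Q')) fun j => (hb j).1
      simpa using this
    · have := ge_of_tendsto' (hlim.const_add (∫⁻ ω, f (X t ω) ∂Q)) fun j => (hb j).2
      simpa using this
  have hU : A ∩ ofSize 𝔾 n = ⋃ M, A ∩ ofSize 𝔾 n ∩ D M := by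
    rw [← inter_iUnion, hDuniv, inter_univ]
  have hmono : Monotone fun M => A ∩ ofSize 𝔾 n ∩ D M := fun M N hMN =>
    inter_subset_inter_right _ (hDmono hMN)
  rw [hU, preimage_iUnion, preimage_iUnion,
    Monotone.measure_iUnion (fun M N hMN => preimage_mono (hmono hMN)),
    Monotone.measure_iUnion (fun M N hMN => preimage_mono (hmono hMN))]
  simp only [key]

/-- The laws of two weak solutions agree if they agree at the initial time. -/
theorem WeakSolution.map_eq (h : FiniteInfluence ν I body Λ)
    (hX : WeakSolution Q ν I body Λ s X) (hX' : WeakSolution Q' ν I body Λ s X')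
    (hs : 0 ≤ s) (hinit : Q.map (X s) = Q'.map (X' s)) (hst : s ≤ t) :
    Q.map (X t) = Q'.map (X' t) := by
  -- A jump adds exactly one cylinder, so size `n` is entered from size `n - 1` only, and size `0`
  -- is never entered. This closes the induction on the size.
  have hgz : ∀ (n : ℕ) (f : Config 𝔾 → ENNReal), (∀ a, a.carrier.ncard ≠ n → f a = 0) →
      ∀ u (a : Config 𝔾), a.carrier.ncard + 1 ≠ n →
      ∫⁻ q, f (joined u a q) ∂(rate ν I body Λ u a) = 0 := by
    intro n f hf u a ha
    rw [← lintegral_zero (μ := rate ν I body Λ u a)]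
    refine lintegral_congr_ae ?_
    filter_upwards [ae_rate_notMem (ν := ν) (I := I) (body := body) (Λ := Λ) u a] with q hq
    exact hf _ (by rwa [ncard_joined hq])
  have hlevel : ∀ n t, s ≤ t →
      (Q.map (X t)).restrict (ofSize 𝔾 n) = (Q'.map (X' t)).restrict (ofSize 𝔾 n) := by
    intro n
    induction n with
    | zero =>
      intro t hst
      refine hX.restrict_map_eq_of_gain h hX' hs hinit (fun t _ f _ _ hf => ?_) hst
      simp [hgz 0 f hf]
    | succ n ih =>
      intro t hst
      refine hX.restrict_map_eq_of_gain h hX' hs hinit (fun t _ f hfm _ hf => ?_) hst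
      have hgm : Measurable fun v : ℝ × Config 𝔾 =>
          ∫⁻ q, f (joined v.1 v.2 q) ∂(rate ν I body Λ v.1 v.2) :=
        measurable_lintegral_rate h.measurable h.measurable_window (hfm.comp measurable_joined)
      rw [lintegral_onInterval (Q := Q) hs hX.measurable hX.good hgm,
        lintegral_onInterval (Q := Q') hs hX'.measurable hX'.good hgm]
      refine setLIntegral_congr_fun measurableSet_Ioc fun u hu => ?_
      have hu0 := hs.trans hu.1.le
      exact lintegral_timeState_congr (hX.measurable u hu0) (hX'.measurable u hu0)
        (ih u hu.1.le) (hgm.comp measurable_prodMk_left) fun a ha =>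
        hgz (n + 1) f hf u a (fun hc => ha (Nat.succ_injective hc))
  refine Measure.ext_iff_of_iUnion_eq_univ (s := fun n => ofSize 𝔾 n) ?_ |>.mpr
    fun n => hlevel n t hst
  exact eq_univ_of_forall fun a => mem_iUnion.mpr ⟨a.carrier.ncard, rfl⟩

end Comparison

end Uniqueness

end BackwardClan

namespace BackwardClan

/-! ### Laws of solutions of the evolution equation -/

section ConditionalExpectation

variable {Ω : Type*} {m m0 : MeasurableSpace Ω} {P : Measure Ω} [IsFiniteMeasure P]

lemma integral_mul_condExp (hm : m ≤ m0) {W Y : Ω → ℝ} (hW : StronglyMeasurable[m] W) {c : ℝ}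
    (hc : ∀ᵐ ω ∂P, |W ω| ≤ c) (hY : Integrable Y P) :
    ∫ ω, W ω * (P[Y | m]) ω ∂P = ∫ ω, W ω * Y ω ∂P := by
  have h1 := condExp_stronglyMeasurable_mul_of_bound hm hW hY c hc
  rw [← integral_condExp hm (f := fun ω => W ω * Y ω)]
  exact (integral_congr_ae h1).symm

lemma integral_mul_eq_of_condExp_eq (hm : m ≤ m0) {W Y Y' : Ω → ℝ} (hW : StronglyMeasurable[m] W)
    {c : ℝ} (hc : ∀ᵐ ω ∂P, |W ω| ≤ c) (hY : Integrable Y P) (hY' : Integrable Y' P)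
    (h : P[Y | m] =ᵐ[P] P[Y' | m]) : ∫ ω, W ω * Y ω ∂P = ∫ ω, W ω * Y' ω ∂P := by
  rw [← integral_mul_condExp hm hW hc hY, ← integral_mul_condExp hm hW hc hY']
  refine integral_congr_ae ?_
  filter_upwards [h] with ω hω
  rw [hω]

end ConditionalExpectation

/-! ### From solutions of the evolution equation to weighted weak solutions. -/

section Solutions

variable {𝔾 E : Type*} [MeasurableSpace 𝔾]
  {ν : Measure 𝔾} {I : 𝔾 → 𝔾 → Prop} {body : 𝔾 → Set E} {Λ : Set E}

lemma measurableSet_history {Ω : Type*} {X : ℝ → Ω → Config 𝔾} {s : ℝ} {u : ℝ} (hu : 0 ≤ u)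
    (hus : u ≤ s) {D : Set (Config 𝔾)} (hD : MeasurableSet D) :
    MeasurableSet[history X s] (X u ⁻¹' D) :=
  le_iSup₂ (f := fun u (_ : u ∈ Icc (0 : ℝ) s) => MeasurableSpace.comap (X u) inferInstance)
    u ⟨hu, hus⟩ _ ⟨D, hD, rfl⟩

variable {Ω : Type*} [MeasurableSpace Ω] {P : Measure Ω} {X : ℝ → Ω → Config 𝔾}

lemma history_le (hX : ∀ t, 0 ≤ t → Measurable (X t)) (s : ℝ) :
    history X s ≤ ‹MeasurableSpace Ω› :=
  iSup₂_le fun u hu => (hX u hu.1).comap_le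

variable [StandardBorelSpace 𝔾] [SigmaFinite ν] [IsProbabilityMeasure P]

lemma SolvesEvolution.integrable_increment (hX : SolvesEvolution P ν I body Λ X)
    {F : Config 𝔾 → ℝ} (hF : IsTest ν F) {s t : ℝ} (hs : 0 ≤ s) (hst : s ≤ t) :
    Integrable (fun ω => F (X t ω) - F (X s ω)) P := by
  obtain ⟨K, hK⟩ := hF.bounded
  refine Integrable.of_bound (C := 2 * K) ?_ (Eventually.of_forall fun ω => abs_increment_le hK _ _)
  exact ((hF.measurable.comp (hX.measurable t (hs.trans hst))).sub
    (hF.measurable.comp (hX.measurable s hs))).aestronglyMeasurable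

lemma SolvesEvolution.integral_mul (hX : SolvesEvolution P ν I body Λ X)
    {F : Config 𝔾 → ℝ} (hF : IsTest ν F) {s t : ℝ} (hs : 0 ≤ s) (hst : s ≤ t) {W : Ω → ℝ}
    (hW : StronglyMeasurable[history X s] W) {c : ℝ} (hc : ∀ ω, |W ω| ≤ c) :
    ∫ ω, W ω * (F (X t ω) - F (X s ω)) ∂P =
      ∫ ω, W ω * (∫ u in s..t, generator ν I body Λ u F (X u ω)) ∂P :=
  integral_mul_eq_of_condExp_eq (history_le hX.measurable s) hW (Eventually.of_forall hc)
    (hX.integrable_increment hF hs hst) (hX.integrable F hF s t hs hst)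
    (hX.evolution F hF s t hs hst)

/-- The configurations with a cylinder with basis in `B` that is not born in `[-t, 0]`. -/
def misplaced (B : Set 𝔾) (t : ℝ) : Set (Config 𝔾) :=
  {a | ∃ C ∈ a.carrier, C ∈ (B ×ˢ ((Icc (-t) 0)ᶜ ×ˢ univ) : Set (Cylinder 𝔾))}

lemma measurableSet_misplaced {B : Set 𝔾} (hB : MeasurableSet B) (t : ℝ) :
    MeasurableSet (misplaced B t) :=
  Config.measurableSet_exists (f := id) measurable_id
    (measurable_snd (hB.prod (measurableSet_Icc.compl.prod MeasurableSet.univ)))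

/-- At times `u` in `[0, t]` the generator only adds cylinders born at `-u`, which are not
misplaced. So it annihilates the indicator of `misplaced B t`, whose expectation keeps its initial
value `0`. -/
lemma SolvesEvolution.ae_notMem_misplaced (hX : SolvesEvolution P ν I body Λ X) {B : Set 𝔾}
    (hB : MeasurableSet B) (hBfin : ν B < ⊤) {t : ℝ} (ht : 0 ≤ t) :
    ∀ᵐ ω ∂P, X t ω ∉ misplaced B t := by
  set F : Config 𝔾 → ℝ := (misplaced B t).indicator 1 with hFdef
  have hF1 : ∀ a, F a ≤ 1 := fun a => indicator_le_self' (fun _ _ => zero_le_one) a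
  have hF0 : ∀ a, 0 ≤ F a := fun a => indicator_nonneg (fun _ _ => zero_le_one) a
  have hF : IsTest ν F :=
    { measurable := measurable_one.indicator (measurableSet_misplaced hB t)
      bounded := ⟨1, fun a => by rw [abs_of_nonneg (hF0 a)]; exact hF1 a⟩
      isLocal := ⟨B, hB, hBfin, fun a a' h => by
        have : a ∈ misplaced B t ↔ a' ∈ misplaced B t := by
          constructor
          · rintro ⟨C, hC, hCB⟩; exact ⟨C, (h C hCB.1).mp hC, hCB⟩
          · rintro ⟨C, hC, hCB⟩; exact ⟨C, (h C hCB.1).mpr hC, hCB⟩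
        by_cases ha : a ∈ misplaced B t
        · simp [hFdef, ha, this.mp ha]
        · simp [hFdef, ha, mt this.mpr ha]⟩ }
  have hgen : ∀ u ∈ Icc 0 t, ∀ a, generator ν I body Λ u F a = 0 := by
    intro u hu a
    have : ∀ θ s, F (a.add (θ, -u, s)) = F a := by
      intro θ s
      have : a.add (θ, -u, s) ∈ misplaced B t ↔ a ∈ misplaced B t := by
        constructor
        · rintro ⟨C, hC | hC, hCB⟩
          · exact ⟨C, hC, hCB⟩
          · rw [mem_singleton_iff] at hC
            subst hC
            exact absurd ⟨by linarith [hu.2], by linarith [hu.1]⟩ hCB.2.1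
        · rintro ⟨C, hC, hCB⟩; exact ⟨C, Or.inl hC, hCB⟩
      by_cases ha : a ∈ misplaced B t
      · simp [hFdef, ha, this.mpr ha]
      · simp [hFdef, ha, mt this.mp ha]
    simp [generator, this]
  have h1 := hX.integral_mul hF le_rfl ht (W := fun _ => 1) stronglyMeasurable_const (c := 1)
    (by simp)
  have h2 : ∀ ω, ∫ u in (0 : ℝ)..t, generator ν I body Λ u F (X u ω) = 0 := fun ω => by
    rw [intervalIntegral.integral_congr (g := fun _ => 0)]
    · simp
    · intro u hu
      rw [uIcc_of_le ht] at hu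
      exact hgen u hu _
  simp only [one_mul, h2, integral_zero] at h1
  have h3 : ∫ ω, F (X t ω) ∂P = 0 := by
    rw [← h1]
    refine integral_congr_ae ?_
    filter_upwards [hX.init] with ω hω
    have : Config.empty ∉ misplaced B t := by rintro ⟨C, hC, -⟩; exact hC
    simp [hω, hFdef, this]
  have hint : Integrable (fun ω => F (X t ω)) P :=
    Integrable.of_bound (C := 1) (hF.measurable.comp (hX.measurable t ht)).aestronglyMeasurable
      (Eventually.of_forall fun ω => by
        rw [Real.norm_eq_abs, abs_of_nonneg (hF0 _)]; exact hF1 _)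
  rw [integral_eq_zero_iff_of_nonneg (fun ω => hF0 _) hint] at h3
  filter_upwards [h3] with ω hω hmem
  simp [hFdef, hmem] at hω

/-- Almost every path of a solution is growing, constant to the right, and its cylinders are born
in the past. -/
lemma SolvesEvolution.ae_goodPath (hX : SolvesEvolution P ν I body Λ X) :
    ∀ᵐ ω ∂P, GoodPath fun t => X t ω := by
  -- Countably many times and sets of bases suffice: since paths grow, a cylinder present at `t` is
  -- present at every rational `q > t`, and `q ↓ t` gives the bound on its birth.
  have h1 : ∀ᵐ ω ∂P, ∀ q : ℚ, 0 ≤ q → ∀ k, X q ω ∉ misplaced (spanningSets ν k) (q : ℝ) := by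
    refine ae_all_iff.mpr fun q => ?_
    by_cases hq : 0 ≤ q
    · refine (ae_all_iff.mpr fun k => hX.ae_notMem_misplaced (measurableSet_spanningSets ν k)
        (measure_spanningSets_lt_top ν k) (t := q) (by exact_mod_cast hq)).mono fun ω h _ => h
    · exact Eventually.of_forall fun ω h => absurd h hq
  filter_upwards [h1, hX.mono, hX.right_cont] with ω hv hmono hright
  refine ⟨hmono, hright, fun t ht C hC => ?_⟩
  have hkey : ∀ q : ℚ, t < q → -(q : ℝ) ≤ C.birth ∧ C.birth ≤ 0 := fun q hq => by
    have hC' := hmono t q ht hq.le hC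
    obtain ⟨k, hk⟩ := mem_iUnion.mp ((iUnion_spanningSets ν).symm ▸ mem_univ C.basis)
    by_contra hcon
    exact hv q (by exact_mod_cast ht.trans hq.le) k ⟨C, hC', hk, hcon, mem_univ _⟩
  refine ⟨?_, ?_⟩
  · by_contra! hlt
    obtain ⟨q, hq1, hq2⟩ := exists_rat_btwn (show t < -C.birth by linarith)
    linarith [(hkey q hq1).1]
  · obtain ⟨q, hq⟩ := exists_rat_gt t
    exact (hkey q hq).2

lemma goodPath_empty : GoodPath fun _ : ℝ => (Config.empty : Config 𝔾) :=
  ⟨fun _ _ _ _ => Subset.rfl, fun _ _ => Eventually.of_forall fun _ => rfl,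
    fun _ _ _ hC => absurd hC (notMem_empty _)⟩

/-- A modification with good paths only. -/
lemma exists_modification {Ω : Type*} [MeasurableSpace Ω] {P : Measure Ω} {X : ℝ → Ω → Config 𝔾}
    (hX : ∀ t, 0 ≤ t → Measurable (X t)) (hg : ∀ᵐ ω ∂P, GoodPath fun t => X t ω) :
    ∃ Y : ℝ → Ω → Config 𝔾, (∀ t, 0 ≤ t → Measurable (Y t)) ∧ (∀ ω, GoodPath fun t => Y t ω) ∧
      ∀ᵐ ω ∂P, ∀ t, Y t ω = X t ω := by
  classical
  obtain ⟨N, hN, hNm, hN0⟩ := exists_measurable_superset_of_null (ae_iff.mp hg)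
  refine ⟨fun t => N.piecewise (fun _ => Config.empty) (X t), fun t ht =>
    Measurable.piecewise hNm measurable_const (hX t ht), fun ω => ?_, ?_⟩
  · by_cases hω : ω ∈ N
    · simpa [hω] using goodPath_empty
    · simpa [hω] using not_not.mp fun h => hω (hN h)
  · filter_upwards [measure_eq_zero_iff_ae_notMem.mp hN0] with ω hω t
    simp [hω]

/-- Weighted by a function of the history, a solution remains a solution from that time on. -/
lemma SolvesEvolution.weakSolution (hX : SolvesEvolution P ν I body Λ X) {Y : ℝ → Ω → Config 𝔾}
    (hYm : ∀ t, 0 ≤ t → Measurable (Y t)) (hY : ∀ ω, GoodPath fun t => Y t ω)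
    (hYX : ∀ᵐ ω ∂P, ∀ t, Y t ω = X t ω) {s : ℝ} (hs : 0 ≤ s) {Z : Ω → ℝ}
    (hZ : StronglyMeasurable[history X s] Z) (hZ0 : ∀ ω, 0 ≤ Z ω) (hZ1 : ∀ ω, Z ω ≤ 1) :
    WeakSolution (P.withDensity fun ω => ENNReal.ofReal (Z ω)) ν I body Λ s Y := by
  refine ⟨hYm, hY, fun F hF r t hsr hrt V hV => ?_⟩
  have hr := hs.trans hsr
  have hZm : Measurable Z := (hZ.mono (history_le hX.measurable s)).measurable
  have hkey : ∀ f : Ω → ℝ, ∫ ω in Y r ⁻¹' V, f ω ∂(P.withDensity fun ω => ENNReal.ofReal (Z ω)) =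
      ∫ ω, (X r ⁻¹' V).indicator Z ω * f ω ∂P := fun f => by
    rw [setIntegral_withDensity_eq_setIntegral_toReal_smul hZm.ennreal_ofReal
      (Eventually.of_forall fun _ => ENNReal.ofReal_lt_top) _ (hYm r hr hV),
      ← integral_indicator (hYm r hr hV)]
    refine integral_congr_ae ?_
    filter_upwards [hYX] with ω hω
    by_cases hmem : X r ω ∈ V
    · simp [indicator, hω, hmem, ENNReal.toReal_ofReal (hZ0 ω)]
    · simp [indicator, hω, hmem]
  rw [hkey, hkey]
  have hle : history X s ≤ history X r :=
    iSup₂_le fun u hu => le_iSup₂ (f := fun u (_ : u ∈ Icc (0 : ℝ) r) =>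
      MeasurableSpace.comap (X u) inferInstance) u ⟨hu.1, hu.2.trans hsr⟩
  -- The density `Z` times an event of the present at time `r` is a function of the history up to
  -- `r`, because `s ≤ r`.
  have h := hX.integral_mul hF hr hrt (W := (X r ⁻¹' V).indicator Z) (c := 1)
    ((hZ.mono hle).indicator (measurableSet_history hr le_rfl hV)) fun ω => by
      rw [abs_of_nonneg (indicator_nonneg (fun ω _ => hZ0 ω) ω)]
      exact indicator_le' (fun ω _ => hZ1 ω) (fun _ _ => zero_le_one) ω
  convert! h using 1
  all_goals
    refine integral_congr_ae ?_
    filter_upwards [hYX] with ω hω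
    simp [hω]

end Solutions

/-! ### Uniqueness of the finite-dimensional distributions. -/

section Laws

variable {𝔾 E : Type*} [MeasurableSpace 𝔾] [StandardBorelSpace 𝔾]
  {ν : Measure 𝔾} [SigmaFinite ν] {I : 𝔾 → 𝔾 → Prop} {body : 𝔾 → Set E} {Λ : Set E}
  {Ω Ω' : Type*} [MeasurableSpace Ω] {P : Measure Ω} [IsProbabilityMeasure P]
  [MeasurableSpace Ω'] {P' : Measure Ω'} [IsProbabilityMeasure P']
  {X : ℝ → Ω → Config 𝔾} {X' : ℝ → Ω' → Config 𝔾}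

lemma withDensity_preimage {Z : Ω → ℝ} (hZ : Measurable Z) (hZ0 : ∀ ω, 0 ≤ Z ω)
    (hZ1 : ∀ ω, Z ω ≤ 1) {W : Set Ω} (hW : MeasurableSet W) :
    P.withDensity (fun ω => ENNReal.ofReal (Z ω)) W = ENNReal.ofReal (∫ ω in W, Z ω ∂P) := by
  rw [withDensity_apply _ hW, ofReal_integral_eq_lintegral_ofReal _ (Eventually.of_forall hZ0)]
  exact (Integrable.of_bound hZ.aestronglyMeasurable (C := 1) (Eventually.of_forall fun ω => by
    rw [Real.norm_eq_abs, abs_of_nonneg (hZ0 ω)]; exact hZ1 ω)).integrableOn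

/-- Equality of weighted one-dimensional laws propagates in time. -/
lemma SolvesEvolution.setIntegral_eq (h : FiniteInfluence ν I body Λ)
    (hX : SolvesEvolution P ν I body Λ X) (hX' : SolvesEvolution P' ν I body Λ X')
    {s t : ℝ} (hs : 0 ≤ s) (hst : s ≤ t) {Z : Ω → ℝ} {Z' : Ω' → ℝ}
    (hZ : StronglyMeasurable[history X s] Z) (hZ0 : ∀ ω, 0 ≤ Z ω) (hZ1 : ∀ ω, Z ω ≤ 1)
    (hZ' : StronglyMeasurable[history X' s] Z') (hZ0' : ∀ ω, 0 ≤ Z' ω) (hZ1' : ∀ ω, Z' ω ≤ 1)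
    (heq : ∀ D, MeasurableSet D → ∫ ω in X s ⁻¹' D, Z ω ∂P = ∫ ω in X' s ⁻¹' D, Z' ω ∂P')
    {D : Set (Config 𝔾)} (hD : MeasurableSet D) :
    ∫ ω in X t ⁻¹' D, Z ω ∂P = ∫ ω in X' t ⁻¹' D, Z' ω ∂P' := by
  have ht := hs.trans hst
  have hZm : Measurable Z := (hZ.mono (history_le hX.measurable s)).measurable
  have hZm' : Measurable Z' := (hZ'.mono (history_le hX'.measurable s)).measurable
  -- `WeakSolution` asks for good paths at every point of the sample space; the modification
  -- provides them without changing the weighted laws.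
  obtain ⟨Y, hYm, hYg, hYX⟩ := exists_modification hX.measurable hX.ae_goodPath
  obtain ⟨Y', hYm', hYg', hYX'⟩ := exists_modification hX'.measurable hX'.ae_goodPath
  have hY := hX.weakSolution hYm hYg hYX hs hZ hZ0 hZ1
  have hY' := hX'.weakSolution hYm' hYg' hYX' hs hZ' hZ0' hZ1'
  have hmap : ∀ u, 0 ≤ u → ∀ D, MeasurableSet D →
      (P.withDensity fun ω => ENNReal.ofReal (Z ω)).map (Y u) D =
        ENNReal.ofReal (∫ ω in X u ⁻¹' D, Z ω ∂P) := fun u hu D hD => by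
    rw [Measure.map_apply (hYm u hu) hD, withDensity_preimage hZm hZ0 hZ1 (hYm u hu hD)]
    congr 1
    refine setIntegral_congr_set ?_
    filter_upwards [hYX] with ω hω
    exact congrArg (· ∈ D) (hω u)
  have hmap' : ∀ u, 0 ≤ u → ∀ D, MeasurableSet D →
      (P'.withDensity fun ω => ENNReal.ofReal (Z' ω)).map (Y' u) D =
        ENNReal.ofReal (∫ ω in X' u ⁻¹' D, Z' ω ∂P') := fun u hu D hD => by
    rw [Measure.map_apply (hYm' u hu) hD, withDensity_preimage hZm' hZ0' hZ1' (hYm' u hu hD)]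
    congr 1
    refine setIntegral_congr_set ?_
    filter_upwards [hYX'] with ω hω
    exact congrArg (· ∈ D) (hω u)
  have : IsFiniteMeasure (P.withDensity fun ω => ENNReal.ofReal (Z ω)) := ⟨by
    rw [withDensity_preimage hZm hZ0 hZ1 MeasurableSet.univ]; exact ENNReal.ofReal_lt_top⟩
  have : IsFiniteMeasure (P'.withDensity fun ω => ENNReal.ofReal (Z' ω)) := ⟨by
    rw [withDensity_preimage hZm' hZ0' hZ1' MeasurableSet.univ]; exact ENNReal.ofReal_lt_top⟩
  have hfinal := congrArg (fun μ => μ D) (hY.map_eq h hY' hs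
    (Measure.ext fun D hD => by rw [hmap s hs D hD, hmap' s hs D hD, heq D hD]) hst)
  rw [hmap t ht D hD, hmap' t ht D hD, ENNReal.ofReal_eq_ofReal_iff
    (integral_nonneg fun ω => hZ0 ω) (integral_nonneg fun ω => hZ0' ω)] at hfinal
  exact hfinal

/-- Equality of one-dimensional laws on events of the past propagates in time. -/
lemma SolvesEvolution.measure_inter_eq (h : FiniteInfluence ν I body Λ)
    (hX : SolvesEvolution P ν I body Λ X) (hX' : SolvesEvolution P' ν I body Λ X')
    {s t : ℝ} (hs : 0 ≤ s) (hst : s ≤ t) {W : Set Ω} {W' : Set Ω'}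
    (hW : MeasurableSet[history X s] W) (hW' : MeasurableSet[history X' s] W')
    (heq : ∀ D, MeasurableSet D → P (W ∩ X s ⁻¹' D) = P' (W' ∩ X' s ⁻¹' D))
    {D : Set (Config 𝔾)} (hD : MeasurableSet D) :
    P (W ∩ X t ⁻¹' D) = P' (W' ∩ X' t ⁻¹' D) := by
  have hWm := history_le hX.measurable s _ hW
  have hWm' := history_le hX'.measurable s _ hW'
  have e : ∀ u D, ∫ ω in X u ⁻¹' D, W.indicator (fun _ => (1 : ℝ)) ω ∂P =
      P.real (W ∩ X u ⁻¹' D) := fun u D => by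
    rw [setIntegral_indicator hWm, setIntegral_const, smul_eq_mul, mul_one, inter_comm]
  have e' : ∀ u D, ∫ ω in X' u ⁻¹' D, W'.indicator (fun _ => (1 : ℝ)) ω ∂P' =
      P'.real (W' ∩ X' u ⁻¹' D) := fun u D => by
    rw [setIntegral_indicator hWm', setIntegral_const, smul_eq_mul, mul_one, inter_comm]
  have := hX.setIntegral_eq h hX' hs hst (Z := W.indicator fun _ => 1)
    (Z' := W'.indicator fun _ => 1)
    (stronglyMeasurable_const.indicator hW) (fun ω => indicator_nonneg (fun _ _ => zero_le_one) ω)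
    (fun ω => indicator_le_self' (fun _ _ => zero_le_one) ω)
    (stronglyMeasurable_const.indicator hW') (fun ω => indicator_nonneg (fun _ _ => zero_le_one) ω)
    (fun ω => indicator_le_self' (fun _ _ => zero_le_one) ω)
    (fun D hD => by rw [e, e', Measure.real, Measure.real, heq D hD]) hD
  rw [e, e'] at this
  exact (measureReal_eq_measureReal_iff).mp this

lemma SolvesEvolution.measure_zero_eq (hX : SolvesEvolution P ν I body Λ X)
    (hX' : SolvesEvolution P' ν I body Λ X') (D : Set (Config 𝔾)) :
    P (X 0 ⁻¹' D) = P' (X' 0 ⁻¹' D) := by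
  have e : X 0 ⁻¹' D =ᵐ[P] {_ω | Config.empty ∈ D} := by
    filter_upwards [hX.init] with ω hω
    exact congrArg (· ∈ D) hω
  have e' : X' 0 ⁻¹' D =ᵐ[P'] {_ω | Config.empty ∈ D} := by
    filter_upwards [hX'.init] with ω hω
    exact congrArg (· ∈ D) hω
  rw [measure_congr e, measure_congr e']
  by_cases h : Config.empty ∈ D <;> simp [h]

/-- Times are added in increasing order. The inductive claim carries one further event at a later
time `u`, since the propagation lemma needs the joint law of the past event with the present state.
-/
lemma SolvesEvolution.measure_biInter_eq (h : FiniteInfluence ν I body Λ)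
    (hX : SolvesEvolution P ν I body Λ X) (hX' : SolvesEvolution P' ν I body Λ X')
    {ι : Type*} {t : ι → ℝ} (ht : ∀ i, 0 ≤ t i) {D : ι → Set (Config 𝔾)}
    (hD : ∀ i, MeasurableSet (D i)) (S : Finset ι) :
    P (⋂ i ∈ S, X (t i) ⁻¹' D i) = P' (⋂ i ∈ S, X' (t i) ⁻¹' D i) := by
  classical
  have key : ∀ u, 0 ≤ u → (∀ i ∈ S, t i ≤ u) → ∀ D', MeasurableSet D' →
      P ((⋂ i ∈ S, X (t i) ⁻¹' D i) ∩ X u ⁻¹' D') =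
        P' ((⋂ i ∈ S, X' (t i) ⁻¹' D i) ∩ X' u ⁻¹' D') := by
    induction S using Finset.induction_on_max_value t with
    | empty =>
      intro u hu _ D' hD'
      simp only [Finset.notMem_empty, iInter_of_empty, iInter_univ]
      exact hX.measure_inter_eq h hX' le_rfl hu MeasurableSet.univ MeasurableSet.univ
        (fun D _ => by simpa using hX.measure_zero_eq hX' D) hD'
    | insert j S hj hmax ih =>
      intro u hu hle D' hD'
      refine hX.measure_inter_eq h hX' (ht j) (hle j (Finset.mem_insert_self _ _)) ?_
        ?_ (fun D'' hD'' => ?_) hD'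
      iterate 2
        exact Finset.measurableSet_biInter _ fun i hi => measurableSet_history (ht i)
          (by rcases Finset.mem_insert.mp hi with rfl | hi; exacts [le_rfl, hmax i hi]) (hD i)
      · have := ih (t j) (ht j) hmax (D j ∩ D'') ((hD j).inter hD'')
        convert! this using 2
        all_goals
          rw [Finset.set_biInter_insert, preimage_inter]
          ac_rfl
  rcases S.eq_empty_or_nonempty with rfl | hS
  · simp
  · simpa using key (S.sup' hS t) ((ht _).trans (Finset.le_sup' t hS.choose_spec))
      (fun i hi => Finset.le_sup' t hi) univ MeasurableSet.univ

/-- Two solutions have the same law. -/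
theorem SolvesEvolution.identDistrib (h : FiniteInfluence ν I body Λ)
    (hX : SolvesEvolution P ν I body Λ X) (hX' : SolvesEvolution P' ν I body Λ X')
    {ι : Type*} {t : ι → ℝ} (ht : ∀ i, 0 ≤ t i) :
    IdentDistrib (fun ω i => X (t i) ω) (fun ω i => X' (t i) ω) P P' := by
  have hm : Measurable fun ω i => X (t i) ω :=
    measurable_pi_lambda _ fun i => hX.measurable _ (ht i)
  have hm' : Measurable fun ω i => X' (t i) ω :=
    measurable_pi_lambda _ fun i => hX'.measurable _ (ht i)
  refine ⟨hm.aemeasurable, hm'.aemeasurable, ?_⟩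
  have := Measure.isProbabilityMeasure_map (μ := P) hm.aemeasurable
  have := Measure.isProbabilityMeasure_map (μ := P') hm'.aemeasurable
  refine ext_of_generate_finite _ generateFrom_squareCylinders.symm
    (isPiSystem_squareCylinders (fun _ => MeasurableSpace.isPiSystem_measurableSet) (by simp)) ?_ (by simp)
  rintro _ ⟨S, D, hD, rfl⟩
  have hD' : ∀ i, MeasurableSet (D i) := fun i => hD i (mem_univ i)
  have hc : MeasurableSet ((S : Set ι).pi D) :=
    MeasurableSet.pi S.countable_toSet fun i _ => hD' i
  rw [Measure.map_apply hm hc, Measure.map_apply hm' hc]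
  convert! hX.measure_biInter_eq h hX' ht hD' S using 2
  all_goals ext ω; simp [Set.mem_pi]

end Laws

/-! ### The limit of a growing process -/

/-- The number of points of the union of an increasing sequence of sets. -/
lemma encard_iUnion_of_monotone {α : Type*} {S : ℕ → Set α} (hS : Monotone S) :
    (⋃ k, S k).encard = ⨆ k, (S k).encard := by
  refine le_antisymm ?_ (iSup_le fun k => encard_le_encard (subset_iUnion S k))
  refine ENat.forall_natCast_le_iff_le.mp fun n hn => ?_
  obtain ⟨T, hT, hTn⟩ := exists_subset_encard_eq hn
  have hfin : T.Finite := finite_of_encard_eq_coe hTn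
  obtain ⟨k, hk⟩ := Directed.exists_mem_subset_of_finset_subset_biUnion
    hS.directed_le (s := hfin.toFinset) (by simpa using hT)
  rw [← hTn]
  exact (encard_le_encard (by simpa using hk)).trans (le_iSup (fun k => (S k).encard) k)

/-- Number of points in `D` of the limit of a sequence of configurations. -/
noncomputable def limitCount {𝔾 : Type*} (D : Set (Cylinder 𝔾)) (x : ℕ → Config 𝔾) : ℕ∞ :=
  ⨆ k, ((x k).carrier ∩ D).encard

lemma encard_iUnion_inter {𝔾 : Type*} {x : ℝ → Config 𝔾}
    (h : ∀ s t, 0 ≤ s → s ≤ t → (x s).carrier ⊆ (x t).carrier) (D : Set (Cylinder 𝔾)) :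
    ((⋃ t ∈ Ici (0 : ℝ), (x t).carrier) ∩ D).encard = limitCount D fun k : ℕ => x k := by
  rw [limitCount, ← encard_iUnion_of_monotone]
  · congr 1
    ext C
    simp only [mem_inter_iff, mem_iUnion, mem_Ici]
    constructor
    · rintro ⟨⟨t, ht, hC⟩, hD⟩
      obtain ⟨k, hk⟩ := exists_nat_ge t
      exact ⟨k, h t k ht hk hC, hD⟩
    · rintro ⟨k, hC, hD⟩
      exact ⟨⟨k, k.cast_nonneg, hC⟩, hD⟩
  · intro k l hkl
    exact inter_subset_inter_left _ (h k l k.cast_nonneg (by exact_mod_cast hkl))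

section Limit

variable {𝔾 E : Type*} [MeasurableSpace 𝔾] [StandardBorelSpace 𝔾]
  {ν : Measure 𝔾} [SigmaFinite ν] {I : 𝔾 → 𝔾 → Prop} {body : 𝔾 → Set E} {Λ : Set E}
  {Ω Ω' : Type*} [MeasurableSpace Ω] {P : Measure Ω} [IsProbabilityMeasure P]
  [MeasurableSpace Ω'] {P' : Measure Ω'} [IsProbabilityMeasure P']
  {X : ℝ → Ω → Config 𝔾} {X' : ℝ → Ω' → Config 𝔾}

lemma measurable_limitCount {D : Set (Cylinder 𝔾)} (hD : MeasurableSet D) :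
    Measurable (limitCount D) := by
  have : ∀ k : ℕ, Measurable fun x : ℕ → Config 𝔾 => ((x k).carrier ∩ D).encard := fun k =>
    (Config.hitMeasurable_carrier.encard hD).comp (measurable_pi_apply k)
  have hsup : Measurable fun x => (limitCount D x : ENNReal) := by
    simp only [limitCount, ENat.toENNReal_iSup]
    exact Measurable.iSup fun k => (measurable_of_countable ENat.toENNReal).comp (this k)
  refine measurable_to_countable' fun n => ?_
  convert! hsup (measurableSet_singleton (n : ENNReal)) using 1
  ext x
  simp

/-- The limits of two solutions have the same law. -/
theorem SolvesEvolution.identDistrib_limit (h : FiniteInfluence ν I body Λ)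
    (hX : SolvesEvolution P ν I body Λ X) (hX' : SolvesEvolution P' ν I body Λ X')
    {ι : Type*} [Countable ι] {D : ι → Set (Cylinder 𝔾)} (hD : ∀ i, MeasurableSet (D i)) :
    IdentDistrib (fun ω i => ((⋃ t ∈ Ici (0 : ℝ), (X t ω).carrier) ∩ D i).encard)
      (fun ω i => ((⋃ t ∈ Ici (0 : ℝ), (X' t ω).carrier) ∩ D i).encard) P P' := by
  have hu : Measurable fun (x : ℕ → Config 𝔾) i => limitCount (D i) x :=
    measurable_pi_lambda _ fun i => measurable_limitCount (hD i)
  have h1 := (hX.identDistrib h hX' (t := fun k : ℕ => (k : ℝ)) fun k => k.cast_nonneg).comp hu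
  have e : (fun ω i => ((⋃ t ∈ Ici (0 : ℝ), (X t ω).carrier) ∩ D i).encard) =ᵐ[P]
      fun ω i => limitCount (D i) fun k : ℕ => X k ω := by
    filter_upwards [hX.mono] with ω hω
    exact funext fun i => encard_iUnion_inter hω (D i)
  have e' : (fun ω i => ((⋃ t ∈ Ici (0 : ℝ), (X' t ω).carrier) ∩ D i).encard) =ᵐ[P']
      fun ω i => limitCount (D i) fun k : ℕ => X' k ω := by
    filter_upwards [hX'.mono] with ω hω
    exact funext fun i => encard_iUnion_inter hω (D i)
  exact ((IdentDistrib.of_ae_eq h1.aemeasurable_fst e.symm).symm.trans h1).trans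
    (IdentDistrib.of_ae_eq h1.aemeasurable_snd e'.symm)

end Limit

/-! ### The Markov property as a consequence of uniqueness. -/

section MarkovProperty

variable {𝔾 E : Type*} [MeasurableSpace 𝔾] [StandardBorelSpace 𝔾]
  {ν : Measure 𝔾} [SigmaFinite ν] {I : 𝔾 → 𝔾 → Prop} {body : 𝔾 → Set E} {Λ : Set E}

/-- For `W` in the history, the weights `1_W` and `P(W | X s)` give `X s` the same weighted law.
Uniqueness, applied to the solution and itself, carries the equality over to `X t`; conditional
expectation being self-adjoint, this identifies the two conditional probabilities. -/
lemma SolvesEvolution.condExp_history_eq {Ω : Type*} {σ : MeasurableSpace Ω} [MeasurableSpace Ω]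
    {P : Measure Ω} [IsProbabilityMeasure P] {X : ℝ → Ω → Config 𝔾}
    (h : FiniteInfluence ν I body Λ)
    (hX : SolvesEvolution P ν I body Λ X) {s t : ℝ} (hs : 0 ≤ s) (hst : s ≤ t)
    {D : Set (Config 𝔾)} (hD : MeasurableSet D)
    (hσ : σ = MeasurableSpace.comap (X s) inferInstance) :
    P[(X t ⁻¹' D).indicator (fun _ => (1 : ℝ)) | history X s] =ᵐ[P]
      P[(X t ⁻¹' D).indicator (fun _ => (1 : ℝ)) | σ] := by
  have hhist := history_le hX.measurable s
  have hσh : σ ≤ history X s := hσ ▸ le_iSup₂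
    (f := fun u (_ : u ∈ Icc (0 : ℝ) s) => MeasurableSpace.comap (X u) inferInstance) s ⟨hs, le_rfl⟩
  have hσm : σ ≤ ‹MeasurableSpace Ω› := hσh.trans hhist
  have hDt := hX.measurable t (hs.trans hst) hD
  set f : Ω → ℝ := (X t ⁻¹' D).indicator fun _ => (1 : ℝ) with hf
  have hint : ∀ {W : Set Ω}, MeasurableSet W → Integrable (W.indicator fun _ => (1 : ℝ)) P :=
    fun hW => (integrable_const 1).indicator hW
  have hbdd : ∀ W : Set Ω, ∀ᵐ ω ∂P, |(P[W.indicator (fun _ => (1 : ℝ)) | σ]) ω| ≤ 1 :=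
    fun W => ae_bdd_abs_condExp_of_ae_bdd_abs (Eventually.of_forall fun ω => by
      by_cases hω : ω ∈ W <;> simp [hω])
  refine (ae_eq_condExp_of_forall_setIntegral_eq hhist (hint hDt)
    (fun W _ _ => integrable_condExp.integrableOn) (fun W hW _ => ?_)
    (stronglyMeasurable_condExp.mono hσh).aestronglyMeasurable).symm
  have hWm := hhist _ hW
  set p := P[W.indicator (fun _ => (1 : ℝ)) | σ] with hp
  -- The conditional probability lies in `[0, 1]` only almost surely, whereas a weight must do so
  -- everywhere.
  set Z : Ω → ℝ := fun ω => max 0 (min 1 (p ω)) with hZ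
  have hp0 : 0 ≤ᵐ[P] p := condExp_nonneg (Eventually.of_forall fun ω =>
    indicator_nonneg (fun _ _ => zero_le_one) ω)
  have hZp : Z =ᵐ[P] p := by
    filter_upwards [hp0, hbdd W] with ω h0 h1
    have h1' : p ω ≤ 1 := (le_abs_self _).trans (by simpa using h1)
    simp only [hZ, min_eq_right h1', max_eq_right (show 0 ≤ p ω from h0)]
  have hZσ : StronglyMeasurable[σ] Z :=
    (measurable_const.max (measurable_const.min
      (stronglyMeasurable_condExp (m := σ) (f := W.indicator (fun _ => (1 : ℝ)))
        (μ := P)).measurable)).stronglyMeasurable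
  have hWind : ∀ g : Ω → ℝ, ∫ ω in W, g ω ∂P = ∫ ω, W.indicator (fun _ => 1) ω * g ω ∂P :=
    fun g => by
      rw [← integral_indicator hWm]
      exact integral_congr_ae (Eventually.of_forall fun ω => by
        by_cases hω : ω ∈ W <;> simp [hω])
  have hflip : ∀ (g : Ω → ℝ) (u : ℝ) (D : Set (Config 𝔾)), 0 ≤ u → MeasurableSet D →
      ∫ ω in X u ⁻¹' D, g ω ∂P = ∫ ω, (X u ⁻¹' D).indicator (fun _ => 1) ω * g ω ∂P :=
    fun g u D hu hD => by
      rw [← integral_indicator (hX.measurable u hu hD)]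
      exact integral_congr_ae (Eventually.of_forall fun ω => by
        by_cases hω : ω ∈ X u ⁻¹' D <;> simp [hω])
  have hsm : ∀ {m' : MeasurableSpace Ω} {W : Set Ω}, MeasurableSet[m'] W →
      StronglyMeasurable[m'] (W.indicator fun _ => (1 : ℝ)) :=
    fun hW => stronglyMeasurable_const.indicator hW
  have hone : ∀ W : Set Ω, ∀ᵐ ω ∂P, |W.indicator (fun _ => (1 : ℝ)) ω| ≤ 1 := fun W =>
    Eventually.of_forall fun ω => by by_cases hω : ω ∈ W <;> simp [hω]
  have hstep := hX.setIntegral_eq h hX hs hst (Z := W.indicator fun _ => 1) (Z' := Z)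
    (hsm hW) (fun ω => indicator_nonneg (fun _ _ => zero_le_one) ω)
    (fun ω => indicator_le_self' (fun _ _ => zero_le_one) ω)
    (hZσ.mono hσh) (fun ω => le_max_left _ _) (fun ω => max_le zero_le_one (min_le_left _ _))
    (fun D' hD' => by
      rw [hflip _ s D' hs hD', hflip _ s D' hs hD', ← integral_mul_condExp hσm
        (hsm (m' := σ) (hσ ▸ ⟨D', hD', rfl⟩)) (hone _) (hint hWm)]
      exact integral_congr_ae (by filter_upwards [hZp] with ω hω; rw [hω]))
    hD
  rw [hflip _ t D (hs.trans hst) hD, hflip _ t D (hs.trans hst) hD] at hstep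
  rw [hWind, hWind]
  calc ∫ ω, W.indicator (fun _ => 1) ω * (P[f | σ]) ω ∂P
      = ∫ ω, (P[f | σ]) ω * W.indicator (fun _ => 1) ω ∂P := by simp only [mul_comm]
    _ = ∫ ω, (P[f | σ]) ω * p ω ∂P :=
        (integral_mul_condExp hσm stronglyMeasurable_condExp (hbdd _) (hint hWm)).symm
    _ = ∫ ω, p ω * (P[f | σ]) ω ∂P := by simp only [mul_comm]
    _ = ∫ ω, p ω * f ω ∂P :=
        integral_mul_condExp hσm stronglyMeasurable_condExp (hbdd W) (hint hDt)
    _ = ∫ ω, f ω * Z ω ∂P := integral_congr_ae (by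
        filter_upwards [hZp] with ω hω; rw [hω, mul_comm])
    _ = ∫ ω, f ω * W.indicator (fun _ => 1) ω ∂P := hstep.symm
    _ = ∫ ω, W.indicator (fun _ => 1) ω * f ω ∂P := by simp only [mul_comm]

/-- Solutions of the evolution equation have the Markov property. -/
theorem SolvesEvolution.markov {Ω : Type*} [MeasurableSpace Ω] {P : Measure Ω}
    [IsProbabilityMeasure P] {X : ℝ → Ω → Config 𝔾} (h : FiniteInfluence ν I body Λ)
    (hX : SolvesEvolution P ν I body Λ X) {s t : ℝ} (hs : 0 ≤ s) (hst : s ≤ t)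
    {D : Set (Config 𝔾)} (hD : MeasurableSet D) :
    P[(X t ⁻¹' D).indicator (fun _ => (1 : ℝ)) | history X s] =ᵐ[P]
      P[(X t ⁻¹' D).indicator (fun _ => (1 : ℝ)) | MeasurableSpace.comap (X s) inferInstance] :=
  hX.condExp_history_eq h hs hst hD rfl

end MarkovProperty

end BackwardClan

namespace BackwardClan

/-! ### The clan of a fixed set of cylinders -/

section Generations

variable {𝔾 E : Type*}

/-- The members of the clan that are separated by `n` ancestral steps from a cylinder alive at time
`0`. -/
def generation (I : 𝔾 → 𝔾 → Prop) (body : 𝔾 → Set E) (Λ : Set E) (𝒞 : Set (Cylinder 𝔾)) :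
    ℕ → Set (Cylinder 𝔾)
  | 0 => aliveAtZero body Λ 𝒞
  | n + 1 => {C | ∃ C' ∈ generation I body Λ 𝒞 n, FirstAncestor I 𝒞 C' C}

variable {I : 𝔾 → 𝔾 → Prop} {body : 𝔾 → Set E} {Λ : Set E} {𝒞 : Set (Cylinder 𝔾)}

/-- Replaces the transitive closure by a recursion on generations, the form suited to inductions and
to proving measurability. -/
lemma clan_eq_iUnion_generation :
    clan I body Λ 𝒞 = ⋃ n, generation I body Λ 𝒞 n := by
  ext C
  simp only [clan, mem_union, mem_iUnion, exists_prop]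
  constructor
  · rintro (h | ⟨C', hC', h⟩)
    · exact ⟨0, h⟩
    · induction h with
      | single h => exact ⟨1, C', hC', h⟩
      | tail _ h ih =>
        obtain ⟨n, hn⟩ := ih
        exact ⟨n + 1, _, hn, h⟩
  · rintro ⟨n, hn⟩
    induction n generalizing C with
    | zero => exact Or.inl hn
    | succ n ih =>
      obtain ⟨C', hC', h⟩ := hn
      rcases ih _ hC' with h' | ⟨D, hD, h'⟩
      · exact Or.inr ⟨C', h', Relation.TransGen.single h⟩
      · exact Or.inr ⟨D, hD, h'.tail h⟩

lemma mem_clan_iff_exists {C : Cylinder 𝔾} : C ∈ clan I body Λ 𝒞 ↔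
    C ∈ aliveAtZero body Λ 𝒞 ∨ ∃ C' ∈ clan I body Λ 𝒞, FirstAncestor I 𝒞 C' C := by
  simp only [clan_eq_iUnion_generation, mem_iUnion]
  constructor
  · rintro ⟨_ | n, hn⟩
    · exact Or.inl hn
    · obtain ⟨C', hC', h⟩ := hn
      exact Or.inr ⟨C', ⟨n, hC'⟩, h⟩
  · rintro (h | ⟨C', ⟨n, hn⟩, h⟩)
    · exact ⟨0, h⟩
    · exact ⟨n + 1, C', hn, h⟩

lemma generation_subset (n : ℕ) : generation I body Λ 𝒞 n ⊆ 𝒞 := by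
  cases n with
  | zero => exact fun C h => h.1
  | succ n => rintro C ⟨C', -, h⟩; exact h.1

lemma clan_subset : clan I body Λ 𝒞 ⊆ 𝒞 := by
  rw [clan_eq_iUnion_generation]
  exact iUnion_subset generation_subset

/-- Being alive at time `0` allows birth at `0` itself; excluding such births, a null event for the
free process, makes the inequality strict. -/
lemma birth_lt_zero_of_mem_clan (h0 : ∀ C ∈ 𝒞, C.birth ≠ 0) {C : Cylinder 𝔾}
    (hC : C ∈ clan I body Λ 𝒞) : C.birth < 0 := by
  rw [clan_eq_iUnion_generation] at hC
  obtain ⟨n, hn⟩ := mem_iUnion.mp hC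
  induction n generalizing C with
  | zero => exact lt_of_le_of_ne hn.2.2.1 (h0 C hn.1)
  | succ n ih =>
    obtain ⟨C', hC', h⟩ := hn
    exact h.2.2.1.trans (ih (mem_iUnion.mpr ⟨n, hC'⟩) hC')

/-- The members of the clan born in `[-t, 0)` only depend on the cylinders born in `[-t, 0)`. -/
lemma clan_inter_eq_clanSince (h0 : ∀ C ∈ 𝒞, C.birth ≠ 0) (t : ℝ) :
    clan I body Λ (𝒞 ∩ {C | -t ≤ C.birth ∧ C.birth < 0}) = clanSince I body Λ 𝒞 t := by
  apply Subset.antisymm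
  · intro C hC
    refine ⟨?_, (clan_subset hC).2⟩
    rw [clan_eq_iUnion_generation] at hC
    obtain ⟨n, hn⟩ := mem_iUnion.mp hC
    induction n generalizing C with
    | zero => exact Or.inl ⟨hn.1.1, hn.2⟩
    | succ n ih =>
      obtain ⟨C', hC', h⟩ := hn
      exact mem_clan_iff_exists.mpr
        (Or.inr ⟨C', ih (mem_iUnion.mpr ⟨n, hC'⟩) hC', h.1.1, h.2⟩)
  · rintro C ⟨hC, hCt⟩
    rw [clan_eq_iUnion_generation] at hC
    obtain ⟨n, hn⟩ := mem_iUnion.mp hC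
    induction n generalizing C with
    | zero => exact Or.inl ⟨⟨hn.1, hCt⟩, hn.2⟩
    | succ n ih =>
      obtain ⟨C', hC', h⟩ := hn
      have hC'm := mem_iUnion.mpr ⟨n, hC'⟩
      -- Ancestral steps lead back in time: the descendant `C'` is born after `C`, hence also within
      -- `[-t, 0)`.
      refine mem_clan_iff_exists.mpr (Or.inr ⟨C', ih hC'm ⟨hCt.1.trans h.2.2.1.le, ?_⟩ hC',
        ⟨h.1, hCt⟩, h.2⟩)
      exact birth_lt_zero_of_mem_clan h0 (clan_eq_iUnion_generation ▸ hC'm)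

end Generations

/-! ### Deciding membership in the clan from its later-born members. -/

section Attached

variable {𝔾 E : Type*} [MeasurableSpace 𝔾] [StandardBorelSpace 𝔾]

/-- The cylinders that would be members of the clan if `a` were the set of its later members. -/
def attached (I : 𝔾 → 𝔾 → Prop) (body : 𝔾 → Set E) (Λ : Set E) (a : Config 𝔾) :
    Set (Cylinder 𝔾) :=
  {C | C.basis ∈ potential I body Λ a ∧ TI I a C.basis ≤ C.death}

variable {I : 𝔾 → 𝔾 → Prop} {body : 𝔾 → Set E} {Λ : Set E} {𝒞 : Set (Cylinder 𝔾)}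

/-- If `C` influences some member of `a`, surviving until `TI` means being alive at the birth of the
earliest such member, so `C` is its ancestor. Otherwise `TI` is `0`, and `C` meets the window and is
alive at time `0`. -/
lemma mem_clan_of_mem_attached {a : Config 𝔾} (ha : a.carrier ⊆ clan I body Λ 𝒞)
    {C : Cylinder 𝔾} (hC : C ∈ 𝒞) (hb : ∀ C' ∈ a.carrier, C.birth < C'.birth) (hC0 : C.birth < 0)
    (h : C ∈ attached I body Λ a) : C ∈ clan I body Λ 𝒞 := by
  by_cases hex : ∃ C' ∈ a.carrier, I C'.basis C.basis
  · obtain ⟨C', hC', hI, hTI⟩ := exists_birth_eq_TI hex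
    exact mem_clan_iff_exists.mpr (Or.inr ⟨C', ha hC', hC, hI, hb C' hC', (hb C' hC').le,
      hTI ▸ h.2⟩)
  · have hTI := h.2
    rw [TI_eq_zero hex] at hTI
    exact Or.inl ⟨hC, h.1.resolve_left hex, hC0.le, hTI⟩

/-- A clan member outlives the birth of some descendant in `a`, or time `0`; both are at least `TI`,
since `TI` is a minimum of births and members of the clan are born before `0`. -/
lemma mem_attached_of_mem_clan (h0 : ∀ C ∈ 𝒞, C.birth ≠ 0) {a : Config 𝔾} {C : Cylinder 𝔾}
    (hC : C ∈ clan I body Λ 𝒞) (ha : a.carrier ⊆ clan I body Λ 𝒞)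
    (hb : ∀ C' ∈ clan I body Λ 𝒞, C.birth < C'.birth → C' ∈ a.carrier) :
    C ∈ attached I body Λ a := by
  rcases mem_clan_iff_exists.mp hC with h | ⟨C', hC', h⟩
  · refine ⟨Or.inr h.2.1, le_trans ?_ h.2.2.2⟩
    by_cases hex : ∃ C' ∈ a.carrier, I C'.basis C.basis
    · obtain ⟨C', hC', -, hTI⟩ := exists_birth_eq_TI hex
      exact hTI ▸ (birth_lt_zero_of_mem_clan h0 (ha hC')).le
    · exact (TI_eq_zero hex).le
  · have hmem := hb C' hC' h.2.2.1
    exact ⟨Or.inl ⟨C', hmem, h.2.1⟩, (TI_le hmem h.2.1).trans h.2.2.2.2⟩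

end Attached

/-! ### Paths of the clan process and their increments. -/

section Path

variable {𝔾 E : Type*} [MeasurableSpace 𝔾] [StandardBorelSpace 𝔾] {I : 𝔾 → 𝔾 → Prop} {body : 𝔾 → Set E} {Λ : Set E} {𝒞 : Set (Cylinder 𝔾)}

lemma carrier_clanConfig (hfin : ∀ t, (clanSince I body Λ 𝒞 t).Finite) (t : ℝ) :
    (clanConfig I body Λ 𝒞 t).carrier = clanSince I body Λ 𝒞 t := by
  rw [clanConfig, dif_pos (hfin t)]

lemma clanSince_mono {s t : ℝ} (hst : s ≤ t) :
    clanSince I body Λ 𝒞 s ⊆ clanSince I body Λ 𝒞 t :=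
  fun _ hC => ⟨hC.1, (neg_le_neg hst).trans hC.2.1, hC.2.2⟩

lemma clanConfig_zero : clanConfig I body Λ 𝒞 0 = Config.empty := by
  have : clanSince I body Λ 𝒞 0 = ∅ := by
    refine eq_empty_of_forall_notMem fun C hC => ?_
    have := hC.2
    rw [neg_zero] at this
    exact absurd this.2 (not_lt.mpr this.1)
  rw [clanConfig, dif_pos (this ▸ finite_empty)]
  exact Config.ext this

lemma goodPath_clanConfig (hfin : ∀ t, (clanSince I body Λ 𝒞 t).Finite) :
    GoodPath (clanConfig I body Λ 𝒞) := by
  refine ⟨fun s t _ hst => ?_, fun t _ => ?_, fun t _ C hC => ?_⟩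
  · rw [carrier_clanConfig hfin, carrier_clanConfig hfin]
    exact clanSince_mono hst
  · have h1 : ∀ᶠ u in 𝓝[>] t, ∀ C ∈ clanSince I body Λ 𝒞 (t + 1), t < -C.birth → u < -C.birth := by
      refine (eventually_all_finite (hfin (t + 1))).mpr fun C _ => ?_
      by_cases hC : t < -C.birth
      · filter_upwards [mem_nhdsWithin_of_mem_nhds (gt_mem_nhds hC)] with u hu _
        exact hu
      · exact Eventually.of_forall fun u h => absurd h hC
    filter_upwards [h1, self_mem_nhdsWithin,
      mem_nhdsWithin_of_mem_nhds (gt_mem_nhds (show t < t + 1 by linarith))] with u hu htu hut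
    refine Config.ext ?_
    rw [carrier_clanConfig hfin, carrier_clanConfig hfin]
    refine Subset.antisymm (fun C hC => ⟨hC.1, ?_, hC.2.2⟩) (clanSince_mono (le_of_lt htu))
    by_contra! hlt
    have := hu C (clanSince_mono (le_of_lt hut) hC) (by linarith)
    linarith [hC.2.1]
  · rw [carrier_clanConfig hfin] at hC
    exact ⟨hC.2.1, hC.2.2.le⟩

lemma iUnion_clanConfig (hfin : ∀ t, (clanSince I body Λ 𝒞 t).Finite)
    (h0 : ∀ C ∈ 𝒞, C.birth ≠ 0) :
    ⋃ t ∈ Ici (0 : ℝ), (clanConfig I body Λ 𝒞 t).carrier = clan I body Λ 𝒞 := by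
  ext C
  simp only [mem_iUnion, carrier_clanConfig hfin, mem_Ici]
  constructor
  · rintro ⟨t, -, h⟩; exact h.1
  · intro h
    have := birth_lt_zero_of_mem_clan h0 h
    exact ⟨-C.birth, by linarith, h, by simp, this⟩

/-- The cylinders born in `[-r', -r)`. -/
def strip (𝔾 : Type*) (r r' : ℝ) : Set (Cylinder 𝔾) := {C | -r' ≤ C.birth ∧ C.birth < -r}

open Classical in
/-- The contribution of the cylinder `C` to the increment of `F` between the times `r` and `r'`,
when `a` is the configuration at time `r`. -/
noncomputable def jump (I : 𝔾 → 𝔾 → Prop) (body : 𝔾 → Set E) (Λ : Set E) (F : Config 𝔾 → ℝ)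
    (r r' : ℝ) (a : Config 𝔾) (C : Cylinder 𝔾) : ℝ :=
  if C ∈ strip 𝔾 r r' ∧ C ∈ attached I body Λ a then F (a.add C) - F a else 0

variable {J : Type*} {x : J → Cylinder 𝔾}

/-- Attachment is tested against the configuration at time `r` only. This would miss a cylinder
whose sole descendants are born in the strip itself, which cannot happen when the strip holds at
most one clan member. -/
lemma increment_eq_tsum_jump (hfin : ∀ t, (clanSince I body Λ (range x) t).Finite)
    (hinj : ∀ i j, (x i).birth = (x j).birth → i = j) (h0 : ∀ i, (x i).birth ≠ 0)
    {r r' : ℝ} (hr : 0 ≤ r) (hrr : r ≤ r')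
    (hsub : (clan I body Λ (range x) ∩ strip 𝔾 r r').Subsingleton) (F : Config 𝔾 → ℝ) :
    F (clanConfig I body Λ (range x) r') - F (clanConfig I body Λ (range x) r) =
      ∑' i, jump I body Λ F r r' (clanConfig I body Λ (range x) r) (x i) := by
  set a := clanConfig I body Λ (range x) r with ha
  have h0' : ∀ C ∈ range x, C.birth ≠ 0 := by rintro _ ⟨i, rfl⟩; exact h0 i
  have hac : a.carrier = clanSince I body Λ (range x) r := carrier_clanConfig hfin r
  have hclan : a.carrier ⊆ clan I body Λ (range x) := hac ▸ fun C hC => hC.1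
  have hmem : ∀ i, x i ∈ strip 𝔾 r r' → x i ∈ attached I body Λ a →
      x i ∈ clan I body Λ (range x) := fun i hi hatt =>
    mem_clan_of_mem_attached hclan (mem_range_self i)
      (fun C' hC' => lt_of_lt_of_le hi.2 (by rw [hac] at hC'; exact hC'.2.1))
      (by linarith [hi.2]) hatt
  have hnext : clanSince I body Λ (range x) r' = a.carrier ∪ (clan I body Λ (range x) ∩ strip 𝔾 r r') := by
    rw [hac]
    ext C
    constructor
    · rintro ⟨hC, h1, h2⟩
      by_cases h : -r ≤ C.birth
      · exact Or.inl ⟨hC, h, h2⟩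
      · exact Or.inr ⟨hC, h1, not_le.mp h⟩
    · rintro (hC | ⟨hC, h1, h2⟩)
      · exact clanSince_mono hrr hC
      · exact ⟨hC, h1, by linarith⟩
  rcases (clan I body Λ (range x) ∩ strip 𝔾 r r').eq_empty_or_nonempty with hemp | ⟨C, hC, hCs⟩
  · have h1 : clanConfig I body Λ (range x) r' = a := by
      refine Config.ext ?_
      rw [carrier_clanConfig hfin, hnext, hemp, union_empty]
    have h2 : ∀ i, jump I body Λ F r r' a (x i) = 0 := fun i => by
      rw [jump, if_neg]
      rintro ⟨hi, hatt⟩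
      exact (eq_empty_iff_forall_notMem.mp hemp) (x i) ⟨hmem i hi hatt, hi⟩
    simp [h1, h2]
  · obtain ⟨i, rfl⟩ := clan_subset hC
    have hatt : x i ∈ attached I body Λ a := by
      -- A clan member born after the given one lies outside the strip, by uniqueness, so it already
      -- belongs to `a`.
      refine mem_attached_of_mem_clan h0' hC hclan fun C' hC' hlt => ?_
      rw [hac]
      refine ⟨hC', ?_, birth_lt_zero_of_mem_clan h0' hC'⟩
      by_contra! hlt'
      have := hsub ⟨hC', hCs.1.trans hlt.le, hlt'⟩ ⟨hC, hCs⟩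
      exact absurd hlt (this ▸ lt_irrefl _)
    have h1 : clanConfig I body Λ (range x) r' = a.add (x i) := by
      refine Config.ext ?_
      rw [carrier_clanConfig hfin, hnext, hsub.eq_singleton_of_mem ⟨hC, hCs⟩]
      rfl
    rw [h1, tsum_eq_single i fun j hj => ?_]
    · rw [jump, if_pos ⟨hCs, hatt⟩]
    · rw [jump, if_neg]
      rintro ⟨hjs, hja⟩
      exact hj (hinj j i (congrArg _ (hsub ⟨hmem j hjs hja, hjs⟩ ⟨hC, hCs⟩)))

/-- On fine grids, the increment is the sum of the contributions of all cylinders. -/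
lemma eventually_increment_eq_sum (hfin : ∀ t, (clanSince I body Λ (range x) t).Finite)
    (hinj : ∀ i j, (x i).birth = (x j).birth → i = j) (h0 : ∀ i, (x i).birth ≠ 0)
    {s t : ℝ} (hs : 0 ≤ s) (hst : s ≤ t) (F : Config 𝔾 → ℝ) :
    ∀ᶠ m in atTop,
      F (clanConfig I body Λ (range x) t) - F (clanConfig I body Λ (range x) s) =
        ∑ k ∈ Finset.range m, ∑' i, jump I body Λ F (grid s t m k) (grid s t m (k + 1))
          (clanConfig I body Λ (range x) (grid s t m k)) (x i) := by
  -- The finitely many births in `[-t, 0)` are distinct, so the mesh eventually falls below their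
  -- smallest gap.
  have hsep : ∀ᶠ m : ℕ in atTop, ∀ C ∈ clanSince I body Λ (range x) t,
      ∀ C' ∈ clanSince I body Λ (range x) t, C ≠ C' → (t - s) / m < |C.birth - C'.birth| := by
    refine (eventually_all_finite (hfin t)).mpr fun C hC =>
      (eventually_all_finite (hfin t)).mpr fun C' hC' => ?_
    by_cases hne : C = C'
    · exact Eventually.of_forall fun m h => absurd hne h
    · have hpos : 0 < |C.birth - C'.birth| := by
        refine abs_pos.mpr (sub_ne_zero.mpr fun hb => hne ?_)
        obtain ⟨i, rfl⟩ := clan_subset hC.1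
        obtain ⟨j, rfl⟩ := clan_subset hC'.1
        rw [hinj i j hb]
      filter_upwards [(tendsto_const_div_atTop_nhds_zero_nat (t - s)).eventually
        (gt_mem_nhds hpos)] with m hm _
      exact hm
  filter_upwards [hsep, eventually_gt_atTop 0] with m hm hm0
  have htel := Finset.sum_range_sub
    (fun k => F (clanConfig I body Λ (range x) (grid s t m k))) m
  simp only [grid_self s t hm0, grid_zero] at htel
  rw [← htel]
  refine Finset.sum_congr rfl fun k hk => ?_
  have hk1 : k + 1 ≤ m := Finset.mem_range.mp hk
  have hle : grid s t m k ≤ grid s t m (k + 1) := grid_mono hst m k.le_succ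
  have hr0 : 0 ≤ grid s t m k := hs.trans (le_grid hst m k)
  refine increment_eq_tsum_jump hfin hinj h0 hr0 hle ?_ F
  rintro C ⟨hC, hCs⟩ C' ⟨hC', hCs'⟩
  by_contra hne
  have ht' := grid_le hst hk1
  have hmem : ∀ C ∈ clan I body Λ (range x), C ∈ strip 𝔾 (grid s t m k) (grid s t m (k + 1)) →
      C ∈ clanSince I body Λ (range x) t := fun C hC hCs =>
    ⟨hC, by linarith [hCs.1], by linarith [hCs.2]⟩
  have h1 := hm C (hmem C hC hCs) C' (hmem C' hC' hCs') hne
  rw [← grid_succ_sub s t m k] at h1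
  refine absurd h1 (not_lt.mpr ((abs_sub_lt_iff.mpr ⟨?_, ?_⟩).le)) <;>
    linarith [hCs.1, hCs.2, hCs'.1, hCs'.2]

end Path

end BackwardClan

namespace BackwardClan

/-! ### Measurability of the clan -/

section Measurability

variable {𝔾 E : Type*} [MeasurableSpace 𝔾] [StandardBorelSpace 𝔾]
  {I : 𝔾 → 𝔾 → Prop} {body : 𝔾 → Set E} {Λ : Set E}

/-- A random set of cylinders is jointly measurable if it can be told whether it meets a measurable
set that depends on an additional cylinder. -/
def JointHit {α : Type*} (m : MeasurableSpace α) (𝒮 : α → Set (Cylinder 𝔾)) : Prop :=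
  ∀ R : Set ((α × Cylinder 𝔾) × Cylinder 𝔾), MeasurableSet R →
    MeasurableSet {p : α × Cylinder 𝔾 | ∃ C ∈ 𝒮 p.1, (p, C) ∈ R}

variable {α : Type*} {m : MeasurableSpace α} {𝒮 𝒯 : α → Set (Cylinder 𝔾)}

lemma JointHit.hitMeasurable (h : JointHit m 𝒮) : HitMeasurable m 𝒮 := by
  intro B hB
  rcases isEmpty_or_nonempty (Cylinder 𝔾) with hE | ⟨⟨C₀⟩⟩
  · convert! MeasurableSet.empty
    exact eq_empty_of_forall_notMem fun ω ⟨C, _⟩ => hE.elim C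
  · exact measurable_prodMk_right (y := C₀) (h (Prod.snd ⁻¹' B) (measurable_snd hB))

lemma HitMeasurable.jointHit (h : HitMeasurable m 𝒮) {B : ℕ → Set (Cylinder 𝔾)}
    (hB : ∀ k, MeasurableSet (B k)) (hcov : ⋃ k, B k = univ)
    (hfin : ∀ ω k, (𝒮 ω ∩ B k).Finite) : JointHit m 𝒮 := by
  intro R hR
  have h' : HitMeasurable inferInstance fun p : α × Cylinder 𝔾 => 𝒮 p.1 :=
    fun D hD => measurable_fst (h D hD)
  exact h'.exists_mem hB hcov (fun p k => hfin p.1 k) hR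

lemma jointHit_range {J : Type*} [Countable J] {x : J → α → Cylinder 𝔾}
    (hx : ∀ i, Measurable (x i)) : JointHit m fun ω => range fun i => x i ω := by
  intro R hR
  have : {p : α × Cylinder 𝔾 | ∃ C ∈ range fun i => x i p.1, (p, C) ∈ R} =
      ⋃ i, {p : α × Cylinder 𝔾 | (p, x i p.1) ∈ R} := by
    ext p; simp
  rw [this]
  exact MeasurableSet.iUnion fun i => (measurable_id.prodMk ((hx i).comp measurable_fst)) hR

lemma JointHit.inter (h : JointHit m 𝒮) {D : Set (Cylinder 𝔾)} (hD : MeasurableSet D) :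
    JointHit m fun ω => 𝒮 ω ∩ D := by
  intro R hR
  convert! h (R ∩ Prod.snd ⁻¹' D) (hR.inter (measurable_snd hD)) using 1
  ext p
  simp only [mem_ofPred_eq, mem_inter_iff, mem_preimage]
  exact exists_congr fun C => by tauto

lemma JointHit.iUnion {ι : Type*} [Countable ι] {𝒮 : ι → α → Set (Cylinder 𝔾)}
    (h : ∀ i, JointHit m (𝒮 i)) : JointHit m fun ω => ⋃ i, 𝒮 i ω := by
  intro R hR
  convert! MeasurableSet.iUnion fun i => h i R hR using 1
  ext p
  simp only [mem_ofPred_eq, mem_iUnion]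
  constructor
  · rintro ⟨C, ⟨i, hi⟩, hC⟩; exact ⟨i, C, hi, hC⟩
  · rintro ⟨i, C, hi, hC⟩; exact ⟨C, ⟨i, hi⟩, hC⟩

lemma measurable_birth : Measurable (Cylinder.birth : Cylinder 𝔾 → ℝ) :=
  measurable_fst.comp measurable_snd

lemma measurable_death : Measurable (Cylinder.death : Cylinder 𝔾 → ℝ) :=
  (measurable_fst.comp measurable_snd).add (measurable_snd.comp measurable_snd)

lemma measurable_basis : Measurable (Cylinder.basis : Cylinder 𝔾 → 𝔾) := measurable_fst

lemma JointHit.generation (hI : MeasurableSet {p : 𝔾 × 𝔾 | I p.1 p.2})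
    (hΛ : MeasurableSet (meeting body Λ)) (h : JointHit m 𝒮) (n : ℕ) :
    JointHit m fun ω => generation I body Λ (𝒮 ω) n := by
  induction n with
  | zero =>
    have hD : MeasurableSet {C : Cylinder 𝔾 | C.basis ∈ meeting body Λ ∧ (0 : ℝ) ∈ C.life} :=
      (measurable_basis hΛ).inter ((measurableSet_le measurable_birth measurable_const).inter
        (measurableSet_le measurable_const measurable_death))
    exact h.inter hD
  | succ n ih =>
    intro R hR
    have hrel : MeasurableSet {q : (α × Cylinder 𝔾) × Cylinder 𝔾 | I q.2.basis q.1.2.basis ∧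
        q.1.2.birth < q.2.birth ∧ q.1.2.birth ≤ q.2.birth ∧ q.2.birth ≤ q.1.2.death} := by
      have m1 : Measurable fun q : (α × Cylinder 𝔾) × Cylinder 𝔾 => q.1.2 := by fun_prop
      exact ((((measurable_basis.comp measurable_snd).prodMk (measurable_basis.comp m1)) hI).inter
        ((measurableSet_lt (measurable_birth.comp m1) (measurable_birth.comp measurable_snd)).inter
        ((measurableSet_le (measurable_birth.comp m1) (measurable_birth.comp measurable_snd)).inter
        (measurableSet_le (measurable_birth.comp measurable_snd) (measurable_death.comp m1)))))
    -- The additional cylinder in `JointHit` plays the candidate ancestor here: being an ancestor of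
    -- some member of generation `n` is a measurable condition on it and `ω`.
    have hpre := ih _ hrel
    have m2 : Measurable fun q : (α × Cylinder 𝔾) × Cylinder 𝔾 => (q.1.1, q.2) := by fun_prop
    convert! h (R ∩ (fun q => (q.1.1, q.2)) ⁻¹' _) (hR.inter (m2 hpre)) using 1
    ext p
    simp only [BackwardClan.generation, FirstAncestor, mem_ofPred_eq, mem_inter_iff, mem_preimage,
      Cylinder.life, mem_Icc]
    constructor
    · rintro ⟨C, ⟨C', h1, h2, h3⟩, hR⟩
      exact ⟨C, h2, hR, C', h1, h3⟩
    · rintro ⟨C, h2, hR, C', h1, h3⟩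
      exact ⟨C, ⟨C', h1, h2, h3⟩, hR⟩

lemma JointHit.clan (hI : MeasurableSet {p : 𝔾 × 𝔾 | I p.1 p.2})
    (hΛ : MeasurableSet (meeting body Λ)) (h : JointHit m 𝒮) :
    JointHit m fun ω => clan I body Λ (𝒮 ω) := by
  simp only [clan_eq_iUnion_generation]
  exact JointHit.iUnion fun n => h.generation hI hΛ n

lemma measurableSet_born (r r' : ℝ) :
    MeasurableSet {C : Cylinder 𝔾 | r ≤ C.birth ∧ C.birth < r'} :=
  (measurableSet_le measurable_const measurable_birth).inter
    (measurableSet_lt measurable_birth measurable_const)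

/-- Measurability of the part of the clan born after `-t`. -/
lemma JointHit.measurable_clanConfig (hI : MeasurableSet {p : 𝔾 × 𝔾 | I p.1 p.2})
    (hΛ : MeasurableSet (meeting body Λ)) (h : JointHit m 𝒮) (t : ℝ) :
    Measurable fun ω => clanConfig I body Λ (𝒮 ω) t := by
  have hS : HitMeasurable m fun ω => clanSince I body Λ (𝒮 ω) t :=
    ((h.clan hI hΛ).inter (measurableSet_born (-t) 0)).hitMeasurable
  have hF : MeasurableSet {ω | (clanSince I body Λ (𝒮 ω) t).Finite} := by
    have := (hS.encard MeasurableSet.univ) (measurableSet_singleton (⊤ : ℕ∞)).compl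
    convert! this using 1
    ext ω
    simp [encard_eq_top_iff]
  refine Config.measurable_of_hitMeasurable fun B hB => ?_
  convert! hF.inter (hS B hB) using 1
  ext ω
  by_cases hω : (clanSince I body Λ (𝒮 ω) t).Finite
  · simp [clanConfig, hω]
  · simp [clanConfig, hω, Config.empty]

end Measurability

end BackwardClan

namespace BackwardClan

/-! ### Random families of points and the events that a set contains none of them -/

section Families

variable {Ω J X : Type*} [MeasurableSpace Ω] [MeasurableSpace X] [Countable J]
  {P : Measure Ω} {m : Measure X} {x : J → Ω → X}

/-- The event that no point lies in `B`. -/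
def void (x : J → Ω → X) (B : Set X) : Set Ω := {ω | ∀ i, x i ω ∉ B}

/-- The measure with the number of points in `D` as its density. -/
noncomputable def countMeasure (P : Measure Ω) (x : J → Ω → X) (D : Set X) : Measure Ω :=
  Measure.sum fun i => P.restrict (x i ⁻¹' D)

/-- The σ-algebra generated by the events that a subset of `R` contains no point. -/
@[reducible]
def voidSpace (x : J → Ω → X) (R : Set X) : MeasurableSpace Ω :=
  MeasurableSpace.generateFrom {V | ∃ B, MeasurableSet B ∧ B ⊆ R ∧ V = void x B}

/-- The completion of `voidSpace`. -/
@[reducible]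
def observable (P : Measure Ω) (x : J → Ω → X) (R : Set X) : MeasurableSpace Ω :=
  @eventuallyMeasurableSpace Ω (voidSpace x R) (ae P) _

/-- The number of points outside `R` has a given mean and does not depend on the points in `R`. -/
def IndependentOutside (P : Measure Ω) (m : Measure X) (x : J → Ω → X) (R : Set X) : Prop :=
  ∀ B, MeasurableSet B → B ⊆ R → ∀ D, MeasurableSet D → D ⊆ Rᶜ → m D < ⊤ →
    countMeasure P x D (void x B) = P (void x B) * m D

lemma measurableSet_void (hx : ∀ i, Measurable (x i)) {B : Set X} (hB : MeasurableSet B) :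
    MeasurableSet (void x B) := by
  have : void x B = ⋂ i, x i ⁻¹' Bᶜ := by ext; simp [void]
  rw [this]
  exact MeasurableSet.iInter fun i => hx i hB.compl

lemma void_empty : void x ∅ = univ := by simp [void]

lemma void_union (B B' : Set X) : void x (B ∪ B') = void x B ∩ void x B' := by
  ext; simp [void, forall_and]

lemma voidSpace_le (hx : ∀ i, Measurable (x i)) (R : Set X) :
    voidSpace x R ≤ ‹MeasurableSpace Ω› := by
  refine MeasurableSpace.generateFrom_le ?_
  rintro _ ⟨B, hB, -, rfl⟩
  exact measurableSet_void hx hB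

lemma countMeasure_absolutelyContinuous (D : Set X) : countMeasure P x D ≪ P :=
  Measure.absolutelyContinuous_sum_left fun _ => Measure.restrict_le_self.absolutelyContinuous

/-- Void events are stable under intersection and generate the σ-algebra, so the product formula
extends from them; completion is harmless because the count measure is absolutely continuous. -/
lemma IndependentOutside.countMeasure_apply [IsProbabilityMeasure P] {R : Set X}
    (h : IndependentOutside P m x R) (hx : ∀ i, Measurable (x i))
    {D : Set X} (hD : MeasurableSet D) (hDR : D ⊆ Rᶜ) (hDfin : m D < ⊤) {V : Set Ω}
    (hV : MeasurableSet[observable P x R] V) : countMeasure P x D V = P V * m D := by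
  obtain ⟨W, hW, hVW⟩ := hV
  have huniv : countMeasure P x D univ = m D := by
    simpa [void_empty] using h ∅ MeasurableSet.empty (empty_subset _) D hD hDR hDfin
  have : IsFiniteMeasure (countMeasure P x D) := ⟨huniv ▸ hDfin⟩
  rw [measure_congr ((countMeasure_absolutelyContinuous D).ae_le hVW), measure_congr hVW]
  have key := ext_on_measurableSpace_of_generate_finite (μ := countMeasure P x D)
    (ν := m D • P) _ {V | ∃ B, MeasurableSet B ∧ B ⊆ R ∧ V = void x B} ?_
    (voidSpace_le hx R) rfl ?_ ?_ hW
  · rw [key, Measure.smul_apply, smul_eq_mul, mul_comm]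
  · rintro _ ⟨B, hB, hBR, rfl⟩
    rw [h B hB hBR D hD hDR hDfin, Measure.smul_apply, smul_eq_mul, mul_comm]
  · rintro _ ⟨B, hB, hBR, rfl⟩ _ ⟨B', hB', hBR', rfl⟩ -
    exact ⟨B ∪ B', hB.union hB', union_subset hBR hBR', (void_union B B').symm⟩
  · rw [huniv, Measure.smul_apply, smul_eq_mul, measure_univ, mul_one]

lemma hitMeasurable_observable {R : Set X} (hR : MeasurableSet R) :
    HitMeasurable (observable P x R) fun ω => (range fun i => x i ω) ∩ R := by
  intro B hB
  refine @le_eventuallyMeasurableSpace Ω (voidSpace x R) (ae P) _ _ ?_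
  have : {ω | ((range fun i => x i ω) ∩ R ∩ B).Nonempty} = (void x (R ∩ B))ᶜ := by
    ext ω
    simp only [void, mem_ofPred_eq, mem_compl_iff, not_forall, not_not]
    constructor
    · rintro ⟨_, ⟨⟨i, rfl⟩, h1⟩, h2⟩; exact ⟨i, h1, h2⟩
    · rintro ⟨i, h1, h2⟩; exact ⟨_, ⟨⟨i, rfl⟩, h1⟩, h2⟩
  rw [this]
  exact MeasurableSet.compl (MeasurableSpace.measurableSet_generateFrom
    ⟨R ∩ B, hR.inter hB, inter_subset_left, rfl⟩)

/-- The number of points in `D`. -/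
noncomputable def number (x : J → Ω → X) (D : Set X) (ω : Ω) : ENNReal :=
  ∑' i, D.indicator 1 (x i ω)

lemma number_eq_encard (D : Set X) (ω : Ω) :
    number x D ω = ({i | x i ω ∈ D}.encard : ENNReal) := by
  rw [← ENNReal.tsum_set_one, tsum_subtype {i | x i ω ∈ D} (fun _ => (1 : ENNReal))]
  rfl

lemma measurable_number (hx : ∀ i, Measurable (x i)) {D : Set X} (hD : MeasurableSet D) :
    Measurable (number x D) :=
  Measurable.tsum fun i => (measurable_one.indicator hD).comp (hx i)

lemma measurable_encard (hx : ∀ i, Measurable (x i)) {D : Set X} (hD : MeasurableSet D) :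
    Measurable fun ω => {i | x i ω ∈ D}.encard := by
  refine measurable_to_countable' fun n => ?_
  convert! measurable_number hx hD (measurableSet_singleton (n : ENNReal)) using 1
  ext ω
  simp [number_eq_encard]

lemma setLIntegral_number (hx : ∀ i, Measurable (x i)) {D : Set X} (hD : MeasurableSet D)
    {V : Set Ω} (hV : MeasurableSet V) :
    ∫⁻ ω in V, number x D ω ∂P = countMeasure P x D V := by
  unfold number
  have hm : ∀ i, Measurable fun ω => D.indicator (1 : X → ENNReal) (x i ω) :=
    fun i => (measurable_one.indicator hD).comp (hx i)
  rw [lintegral_tsum fun i => (hm i).aemeasurable, countMeasure, Measure.sum_apply _ hV]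
  refine tsum_congr fun i => ?_
  have : (fun ω => D.indicator (1 : X → ENNReal) (x i ω)) = (x i ⁻¹' D).indicator 1 := rfl
  rw [this, lintegral_indicator_one (hx i hD), Measure.restrict_apply (hx i hD),
    Measure.restrict_apply hV, inter_comm]

end Families

/-! ### Poisson processes -/

section Poisson

variable {Ω J X : Type*} [MeasurableSpace Ω] [MeasurableSpace X] [Countable J]
  {P : Measure Ω} [IsProbabilityMeasure P] {m : Measure X} {x : J → Ω → X}

lemma IsPoisson.ae_encard_ne_top (h : IsPoisson P m x) {D : Set X} (hD : MeasurableSet D)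
    (hDfin : m D < ⊤) : ∀ᵐ ω ∂P, {i | x i ω ∈ D}.encard ≠ ⊤ := by
  have hm := measurable_encard h.measurable hD
  have h1 : P (⋃ k : ℕ, {ω | {i | x i ω ∈ D}.encard = (k : ℕ∞)}) = 1 := by
    rw [measure_iUnion]
    · simp_rw [h.law D hD hDfin]
      have := hasSum_one_poissonMeasure (m D).toNNReal
      rw [ENNReal.coe_toNNReal_eq_toReal] at this
      rw [← ENNReal.ofReal_tsum_of_nonneg (fun n => by positivity) this.summable]
      · simpa using congrArg ENNReal.ofReal this.tsum_eq
    · intro k l hkl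
      refine disjoint_left.mpr fun ω h1 h2 => hkl ?_
      simp only [mem_ofPred_eq] at h1 h2
      exact_mod_cast h1.symm.trans h2
    · exact fun k => hm (measurableSet_singleton _)
  have h2 := (prob_compl_eq_zero_iff (MeasurableSet.iUnion fun k : ℕ =>
    hm (measurableSet_singleton (k : ℕ∞)))).mpr h1
  filter_upwards [measure_eq_zero_iff_ae_notMem.mp h2] with ω hω htop
  refine hω fun hmem => ?_
  obtain ⟨k, hk⟩ := mem_iUnion.mp hmem
  simp only [mem_preimage, mem_singleton_iff] at hk
  exact ENat.natCast_ne_top k (hk.symm.trans htop)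

lemma tsum_natCast_mul_poisson (l : ℝ) (hl : 0 ≤ l) :
    ∑' k : ℕ, (k : ENNReal) * ENNReal.ofReal (Real.exp (-l) * l ^ k / (Nat.factorial k : ℝ)) =
      ENNReal.ofReal l := by
  rw [tsum_eq_zero_add' ENNReal.summable]
  have h1 : ∀ k : ℕ, ((k + 1 : ℕ) : ENNReal) *
      ENNReal.ofReal (Real.exp (-l) * l ^ (k + 1) / (Nat.factorial (k + 1) : ℝ)) =
      ENNReal.ofReal l * ENNReal.ofReal (Real.exp (-l) * l ^ k / (Nat.factorial k : ℝ)) := by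
    intro k
    rw [← ENNReal.ofReal_natCast, ← ENNReal.ofReal_mul (by positivity), ← ENNReal.ofReal_mul hl]
    congr 1
    rw [Nat.factorial_succ]
    push_cast
    field_simp
    ring
  simp only [h1, ENNReal.tsum_mul_left]
  have := hasSum_one_poissonMeasure l.toNNReal
  rw [Real.coe_toNNReal _ hl] at this
  rw [← ENNReal.ofReal_tsum_of_nonneg (fun n => by positivity) this.summable, this.tsum_eq]
  simp

lemma IsPoisson.lintegral_number (h : IsPoisson P m x) {D : Set X} (hD : MeasurableSet D)
    (hDfin : m D < ⊤) : ∫⁻ ω, number x D ω ∂P = m D := by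
  have hm := measurable_encard h.measurable hD
  have h1 : ∫⁻ ω, number x D ω ∂P = ∫⁻ ω, ∑' k : ℕ,
      {ω | {i | x i ω ∈ D}.encard = (k : ℕ∞)}.indicator (fun _ => (k : ENNReal)) ω ∂P := by
    refine lintegral_congr_ae ?_
    filter_upwards [h.ae_encard_ne_top hD hDfin] with ω hω
    obtain ⟨n, hn⟩ := ENat.ne_top_iff_exists.mp hω
    rw [number_eq_encard, tsum_eq_single n fun k hk => ?_]
    · simp [← hn]
    · refine indicator_of_notMem (fun hmem => hk ?_) _
      simp only [mem_ofPred_eq, ← hn] at hmem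
      exact_mod_cast hmem.symm
  have hset : ∀ k : ℕ, MeasurableSet {ω | {i | x i ω ∈ D}.encard = (k : ℕ∞)} :=
    fun k => hm (measurableSet_singleton _)
  rw [h1, lintegral_tsum fun k => (measurable_const.indicator (hset k)).aemeasurable]
  simp_rw [lintegral_indicator_const (hset _), h.law D hD hDfin]
  rw [tsum_natCast_mul_poisson _ ENNReal.toReal_nonneg, ENNReal.ofReal_toReal hDfin.ne]

/-- The mean measure of a Poisson process. -/
lemma IsPoisson.sum_map [SigmaFinite m] (h : IsPoisson P m x) :
    Measure.sum (fun i => P.map (x i)) = m := by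
  have h1 : ∀ D, MeasurableSet D → m D < ⊤ → Measure.sum (fun i => P.map (x i)) D = m D := by
    intro D hD hDfin
    rw [Measure.sum_apply _ hD, ← h.lintegral_number hD hDfin, ← setLIntegral_univ,
      setLIntegral_number h.measurable hD MeasurableSet.univ, countMeasure,
      Measure.sum_apply _ MeasurableSet.univ]
    exact tsum_congr fun i => by simp [Measure.map_apply (h.measurable i) hD]
  refine (Measure.ext_iff_of_iUnion_eq_univ (iUnion_spanningSets m)).mpr fun k => ?_
  refine Measure.ext fun D hD => ?_
  rw [Measure.restrict_apply hD, Measure.restrict_apply hD]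
  exact h1 _ (hD.inter (measurableSet_spanningSets m k))
    ((measure_mono inter_subset_right).trans_lt (measure_spanningSets_lt_top m k))

/-- The count in `B` is independent of the count in the disjoint set `D`, so the expectation of
`1{no point in B}` times the number of points in `D` factorizes. -/
lemma IsPoisson.independentOutside (h : IsPoisson P m x) (R : Set X) :
    IndependentOutside P m x R := by
  intro B hB hBR D hD hDR hDfin
  rw [← setLIntegral_number h.measurable hD (measurableSet_void h.measurable hB),
    ← lintegral_indicator (measurableSet_void h.measurable hB)]
  have hdisj : Disjoint B D := disjoint_left.mpr fun y hy hy' => hDR hy' (hBR hy)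
  -- Independence is stated for sequences of disjoint sets; the pair is completed by empty sets.
  let Bs : ℕ → Set X := fun k => if k = 0 then B else if k = 1 then D else ∅
  have hindep := h.indep Bs (fun k => by
      by_cases h0 : k = 0
      · simpa [Bs, h0] using hB
      · by_cases h1 : k = 1
        · simpa [Bs, h1] using hD
        · simp [Bs, h0, h1]) (fun k l hkl => by
      by_cases h0 : k = 0 <;> by_cases h1 : k = 1 <;> by_cases h2 : l = 0 <;>
        by_cases h3 : l = 1 <;> simp_all [Bs, hdisj.symm])
  have h01 := hindep.indepFun (show (0 : ℕ) ≠ 1 by decide)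
  have e0 : Bs 0 = B := rfl
  have e1 : Bs 1 = D := rfl
  rw [e0, e1] at h01
  have hprod := lintegral_mul_eq_lintegral_mul_lintegral_of_indepFun
    (μ := P) (f := fun ω => ({0} : Set ℕ∞).indicator (1 : ℕ∞ → ENNReal) {i | x i ω ∈ B}.encard)
    (g := fun ω => ENat.toENNReal {i | x i ω ∈ D}.encard)
    ((measurable_of_countable (({0} : Set ℕ∞).indicator (1 : ℕ∞ → ENNReal))).comp
      (measurable_encard h.measurable hB))
    ((measurable_of_countable ENat.toENNReal).comp (measurable_encard h.measurable hD))
    (h01.comp (measurable_of_countable (({0} : Set ℕ∞).indicator (1 : ℕ∞ → ENNReal)))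
      (measurable_of_countable ENat.toENNReal))
  have hvoid : ∀ ω, ({0} : Set ℕ∞).indicator (1 : ℕ∞ → ENNReal) {i | x i ω ∈ B}.encard =
      (void x B).indicator 1 ω := by
    intro ω
    have : {i | x i ω ∈ B}.encard ∈ ({0} : Set ℕ∞) ↔ ω ∈ void x B := by
      rw [mem_singleton_iff, encard_eq_zero, eq_empty_iff_forall_notMem]; rfl
    by_cases hω : ω ∈ void x B
    · rw [indicator_of_mem (this.mpr hω), indicator_of_mem hω]; rfl
    · rw [indicator_of_notMem (mt this.mp hω), indicator_of_notMem hω]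
  simp only [Pi.mul_apply, hvoid, ← number_eq_encard] at hprod
  rw [lintegral_indicator_one (measurableSet_void h.measurable hB),
    h.lintegral_number hD hDfin] at hprod
  rw [← hprod]
  refine lintegral_congr fun ω => ?_
  by_cases hω : ω ∈ void x B <;> simp [hω]

lemma one_sub_sq_le (l : ℝ) (hl : 0 ≤ l) :
    1 - l ^ 2 ≤ Real.exp (-l) + Real.exp (-l) * l := by
  have h1 := Real.add_one_le_exp (-l)
  nlinarith [mul_le_mul_of_nonneg_right h1 (show (0 : ℝ) ≤ 1 + l by linarith)]

/-- Two points in a small set are unlikely. -/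
lemma IsPoisson.measure_two_le (h : IsPoisson P m x) {D : Set X} (hD : MeasurableSet D)
    (hDfin : m D < ⊤) : P {ω | ∃ i j, i ≠ j ∧ x i ω ∈ D ∧ x j ω ∈ D} ≤ m D ^ 2 := by
  have hm := measurable_encard h.measurable hD
  set S : ℕ → Set Ω := fun k => {ω | {i | x i ω ∈ D}.encard = (k : ℕ∞)} with hS
  have hSm : ∀ k, MeasurableSet (S k) := fun k => hm (measurableSet_singleton _)
  have hdisj : Disjoint (S 0) (S 1) := disjoint_left.mpr fun ω h1 h2 => by
    simp only [hS, mem_ofPred_eq] at h1 h2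
    rw [h1] at h2
    exact absurd h2 (by decide)
  have hsub : {ω | ∃ i j, i ≠ j ∧ x i ω ∈ D ∧ x j ω ∈ D} ⊆ (S 0 ∪ S 1)ᶜ := by
    rintro ω ⟨i, j, hij, hi, hj⟩ (h0 | h1)
    · simp only [hS, mem_ofPred_eq, Nat.cast_zero, encard_eq_zero] at h0
      exact (h0 ▸ (show i ∈ {i | x i ω ∈ D} from hi) : i ∈ (∅ : Set J))
    · simp only [hS, mem_ofPred_eq, Nat.cast_one, encard_eq_one] at h1
      obtain ⟨a, ha⟩ := h1
      have hi' : i ∈ ({a} : Set J) := ha ▸ hi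
      have hj' : j ∈ ({a} : Set J) := ha ▸ hj
      exact hij (hi'.trans hj'.symm)
  refine (measure_mono hsub).trans ?_
  set l := (m D).toReal with hl
  have hl0 : 0 ≤ l := ENNReal.toReal_nonneg
  rw [prob_compl_eq_one_sub ((hSm 0).union (hSm 1)), measure_union hdisj (hSm 1)]
  simp only [hS, h.law D hD hDfin]
  rw [← ENNReal.ofReal_add (by positivity) (by positivity), ← hl,
    show m D = ENNReal.ofReal l from (ENNReal.ofReal_toReal hDfin.ne).symm, ← ENNReal.ofReal_pow hl0, ← ENNReal.ofReal_one, ← ENNReal.ofReal_sub _ (by positivity)]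
  refine ENNReal.ofReal_le_ofReal ?_
  have := one_sub_sq_le l hl0
  simp only [pow_zero, pow_one, Nat.factorial, mul_one, Nat.cast_one, div_one]
  linarith

end Poisson

end BackwardClan

namespace BackwardClan

/-! ### Infinite products as exponentials of series -/

section InfiniteProducts

/-- `exp (-s)` for `s` in `[0, ∞]`. -/
noncomputable def expNeg (s : ENNReal) : ENNReal := (EReal.exp (s : EReal))⁻¹

/-- `-log w` for `w` in `[0, 1]`. -/
noncomputable def negLog (w : ENNReal) : ENNReal := (ENNReal.log w⁻¹).toENNReal

lemma expNeg_negLog {w : ENNReal} (hw : w ≤ 1) : expNeg (negLog w) = w := by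
  have : 0 ≤ ENNReal.log w⁻¹ := by
    rw [← ENNReal.log_one]
    exact ENNReal.log_monotone (ENNReal.one_le_inv.mpr hw)
  rw [expNeg, negLog, EReal.coe_toENNReal this, ENNReal.exp_log, inv_inv]

lemma negLog_one : negLog 1 = 0 := by simp [negLog]

lemma expNeg_zero : expNeg 0 = 1 := by simp [expNeg]

lemma expNeg_add (a b : ENNReal) : expNeg (a + b) = expNeg a * expNeg b := by
  have h : ∀ c : ENNReal, EReal.exp (c : EReal) ≠ 0 := fun c => by simp
  rw [expNeg, EReal.coe_ennreal_add, EReal.exp_add, ENNReal.mul_inv (Or.inl (h a)) (Or.inr (h b))]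
  rfl

lemma continuous_expNeg : Continuous expNeg :=
  continuous_inv.comp (ENNReal.continuous_exp.comp continuous_coe_ennreal_ereal)

lemma measurable_negLog : Measurable negLog :=
  (ENNReal.measurable_log.comp measurable_inv).ereal_toENNReal

/-- A series over the indices can be read as an integral against the counting measure of the random
set of points. In this form the infinite product is seen to depend measurably on the set alone, not
on its labelling. -/
lemma tprod_eq_expNeg {ι : Type*} {w : ι → ENNReal} (hw : ∀ i, w i ≤ 1) :
    ∏' i, w i = expNeg (∑' i, negLog (w i)) := by
  have h1 : Tendsto (fun s : Finset ι => ∏ i ∈ s, w i) atTop (𝓝 (∏' i, w i)) := by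
    rw [ENNReal.tprod_eq_iInf_prod hw]
    exact tendsto_atTop_iInf (Finset.prod_anti_set_of_le_one' hw)
  have h2 : Tendsto (fun s : Finset ι => expNeg (∑ i ∈ s, negLog (w i))) atTop
      (𝓝 (expNeg (∑' i, negLog (w i)))) :=
    (continuous_expNeg.tendsto _).comp ENNReal.summable.hasSum
  have h3 : ∀ s : Finset ι, expNeg (∑ i ∈ s, negLog (w i)) = ∏ i ∈ s, w i := by
    classical
    intro s
    induction s using Finset.induction_on with
    | empty => simp [expNeg_zero]
    | insert i s hi ih =>
      rw [Finset.sum_insert hi, Finset.prod_insert hi, expNeg_add, ih, expNeg_negLog (hw i)]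
  simp only [h3] at h2
  exact tendsto_nhds_unique h1 h2

/-- The replaced factor is `1`, so nothing has to be divided out, even if the product vanishes. -/
lemma tprod_update_of_eq_one {ι : Type*} [DecidableEq ι] {w : ι → ENNReal} (hw : ∀ i, w i ≤ 1)
    {i : ι} (hi : w i = 1) {a : ENNReal} (ha : a ≤ 1) :
    ∏' j, Function.update w i a j = a * ∏' j, w j := by
  have hu : ∀ j, Function.update w i a j ≤ 1 := fun j => by
    by_cases h : j = i
    · subst h; simpa using ha
    · simpa [h] using hw j
  rw [tprod_eq_expNeg hu, tprod_eq_expNeg hw]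
  have : ∀ j, negLog (Function.update w i a j) = (if j = i then negLog a else 0) + negLog (w j) := by
    intro j
    by_cases h : j = i
    · subst h; simp [hi, negLog_one]
    · simp [h]
  simp only [this]
  rw [ENNReal.tsum_add, tsum_ite_eq, expNeg_add, expNeg_negLog ha]

end InfiniteProducts

/-! ### Functionals of the observed points -/

section Functionals

lemma HitMeasurable.lintegral_count {α X : Type*} [MeasurableSpace X] [MeasurableSpace.CountablyGenerated X]
    [MeasurableSpace.SeparatesPoints X] {m : MeasurableSpace α} {𝒮 : α → Set X} (h : HitMeasurable m 𝒮)
    (hc : ∀ ω, (𝒮 ω).Countable) {φ : X → ENNReal} (hφ : Measurable φ) :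
    Measurable fun ω => ∫⁻ y in 𝒮 ω, φ y ∂Measure.count := by
  have : MeasurableSingletonClass X := MeasurableSpace.measurableSingletonClass_of_countablySeparated
  have : Measurable fun ω => Measure.count.restrict (𝒮 ω) := by
    refine Measure.measurable_of_measurable_coe _ fun B hB => ?_
    have : ∀ ω, Measure.count.restrict (𝒮 ω) B = ((𝒮 ω ∩ B).encard : ENNReal) := fun ω => by
      rw [Measure.restrict_apply hB, inter_comm,
        Measure.count_apply ((hc ω).mono inter_subset_left).measurableSet]
    simp only [this]
    exact (measurable_of_countable ENat.toENNReal).comp (h.encard hB)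
  exact (Measure.measurable_lintegral hφ).comp this

/-- Injectivity makes the sum over points a sum over indices; points outside `R` contribute nothing.
-/
lemma setLIntegral_count_range {J X : Type*} [Countable J] [MeasurableSpace X]
    [MeasurableSingletonClass X] {y : J → X} (hy : Function.Injective y) {R : Set X}
    {φ : X → ENNReal} (hφ : ∀ z ∉ R, φ z = 0) :
    ∫⁻ z in range y ∩ R, φ z ∂Measure.count = ∑' j, φ (y j) := by
  have h1 : ∀ z, (R.indicator φ) z = φ z := fun z => by
    by_cases hz : z ∈ R
    · simp [hz]
    · simp [hz, hφ z hz]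
  rw [lintegral_countable _ ((countable_range y).mono inter_subset_left)]
  simp only [Measure.count_singleton, mul_one]
  rw [tsum_subtype (range y ∩ R) φ, ← indicator_indicator]
  simp only [← tsum_subtype (range y), h1]
  exact tsum_range φ hy

end Functionals

/-! ### The cylinders of the free process -/

section Births

variable {𝔾 Ω J : Type*} [MeasurableSpace 𝔾] [MeasurableSpace Ω] [Countable J]
  {P : Measure Ω} [IsProbabilityMeasure P] {ν : Measure 𝔾} [SigmaFinite ν]
  {Γ : J → Ω → 𝔾} {T : J → Ω → ℝ}

/-- The expected number of births at exactly `b` is the mean measure of a time slice, which is zero.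
-/
lemma ae_birth_ne (h : IsPoisson P (ν.prod (volume : Measure ℝ)) fun i ω => (Γ i ω, T i ω))
    (b : ℝ) : ∀ᵐ ω ∂P, ∀ i, T i ω ≠ b := by
  have hset : MeasurableSet ((univ : Set 𝔾) ×ˢ ({b} : Set ℝ)) :=
    MeasurableSet.univ.prod (measurableSet_singleton b)
  have h0 := congrArg (fun μ => μ ((univ : Set 𝔾) ×ˢ ({b} : Set ℝ))) h.sum_map
  simp only [Measure.prod_prod, Real.volume_singleton, mul_zero] at h0
  rw [Measure.sum_apply _ hset, ENNReal.tsum_eq_zero] at h0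
  refine ae_all_iff.mpr fun i => ?_
  have := h0 i
  rw [Measure.map_apply (h.measurable i) hset] at this
  filter_upwards [measure_eq_zero_iff_ae_notMem.mp this] with ω hω hb
  exact hω ⟨mem_univ _, hb⟩

lemma ae_finite_births (h : IsPoisson P (ν.prod (volume : Measure ℝ)) fun i ω => (Γ i ω, T i ω)) :
    ∀ᵐ ω ∂P, ∀ k : ℕ, {i | Γ i ω ∈ spanningSets ν k ∧ T i ω ∈ Icc (-(k : ℝ)) k}.Finite := by
  refine ae_all_iff.mpr fun k => ?_
  have := h.ae_encard_ne_top (D := spanningSets ν k ×ˢ Icc (-(k : ℝ)) k)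
    ((measurableSet_spanningSets ν k).prod measurableSet_Icc) (by
      rw [Measure.prod_prod, Real.volume_Icc]
      exact ENNReal.mul_lt_top (measure_spanningSets_lt_top ν k) ENNReal.ofReal_lt_top)
  filter_upwards [this] with ω hω
  exact encard_ne_top_iff.mp hω

/-- Almost surely no two cylinders are born at the same time. -/
lemma ae_birth_injective
    (h : IsPoisson P (ν.prod (volume : Measure ℝ)) fun i ω => (Γ i ω, T i ω)) :
    ∀ᵐ ω ∂P, ∀ i j, T i ω = T j ω → i = j := by
  have key : ∀ k : ℕ, P {ω | ∃ i j, i ≠ j ∧ T i ω = T j ω ∧ Γ i ω ∈ spanningSets ν k ∧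
      Γ j ω ∈ spanningSets ν k ∧ T i ω ∈ Ioc (-(k : ℝ)) k} = 0 := by
    intro k
    set a : ℝ := (ν (spanningSets ν k)).toReal * (2 * k) with ha
    have hν := measure_spanningSets_lt_top ν k
    have hkk : -(k : ℝ) ≤ k := by linarith [k.cast_nonneg (α := ℝ)]
    -- A coincidence puts two points into one of `M` equal cells of mean `a / M`. Each cell
    -- contributes at most `(a / M) ^ 2`, in total `a ^ 2 / M`, which tends to `0`.
    have hbound : ∀ M : ℕ, 0 < M → P {ω | ∃ i j, i ≠ j ∧ T i ω = T j ω ∧ Γ i ω ∈ spanningSets ν k ∧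
        Γ j ω ∈ spanningSets ν k ∧ T i ω ∈ Ioc (-(k : ℝ)) k} ≤ ENNReal.ofReal (a ^ 2 / M) := by
      intro M hM
      set cell : ℕ → Set (𝔾 × ℝ) := fun c =>
        spanningSets ν k ×ˢ Ioc (grid (-(k : ℝ)) k M c) (grid (-(k : ℝ)) k M (c + 1)) with hcell
      have hcm : ∀ c, (ν.prod (volume : Measure ℝ)) (cell c) = ENNReal.ofReal (a / M) := fun c => by
        rw [hcell, Measure.prod_prod, Real.volume_Ioc, grid_succ_sub,
          ← ENNReal.ofReal_toReal hν.ne, ← ENNReal.ofReal_mul ENNReal.toReal_nonneg, ha]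
        congr 1
        ring
      have hsub : {ω | ∃ i j, i ≠ j ∧ T i ω = T j ω ∧ Γ i ω ∈ spanningSets ν k ∧
          Γ j ω ∈ spanningSets ν k ∧ T i ω ∈ Ioc (-(k : ℝ)) k} ⊆
          ⋃ c ∈ Finset.range M, {ω | ∃ i j, i ≠ j ∧ (Γ i ω, T i ω) ∈ cell c ∧
            (Γ j ω, T j ω) ∈ cell c} := by
        rintro ω ⟨i, j, hij, hT, hi, hj, hk⟩
        have hunion := (grid_mono hkk M).biUnion_Ico_Ioc_map_succ 0 M
        rw [grid_zero, grid_self _ _ hM] at hunion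
        rw [← hunion] at hk
        simp only [mem_iUnion, exists_prop, mem_Ico] at hk
        obtain ⟨c, hc, hmem⟩ := hk
        exact mem_biUnion (Finset.mem_coe.mpr (Finset.mem_range.mpr hc.2))
          ⟨i, j, hij, ⟨hi, hmem⟩, ⟨hj, hT ▸ hmem⟩⟩
      refine (measure_mono hsub).trans ((measure_biUnion_finset_le _ _).trans ?_)
      refine (Finset.sum_le_sum fun c _ => h.measure_two_le (D := cell c)
        ((measurableSet_spanningSets ν k).prod measurableSet_Ioc)
        (by rw [hcm]; exact ENNReal.ofReal_lt_top)).trans ?_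
      have hM' : (0 : ℝ) < M := by exact_mod_cast hM
      have ha0 : 0 ≤ a := by positivity
      simp only [hcm, Finset.sum_const, Finset.card_range, nsmul_eq_mul]
      rw [← ENNReal.ofReal_natCast, ← ENNReal.ofReal_pow (by positivity),
        ← ENNReal.ofReal_mul (by positivity)]
      refine ENNReal.ofReal_le_ofReal (le_of_eq ?_)
      field_simp
    have hlim : Tendsto (fun M : ℕ => ENNReal.ofReal (a ^ 2 / M)) atTop (𝓝 0) := by
      have := (ENNReal.continuous_ofReal.tendsto 0).comp
        (tendsto_const_div_atTop_nhds_zero_nat (a ^ 2))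
      simpa [Function.comp_def] using this
    exact le_antisymm (ge_of_tendsto hlim ((eventually_gt_atTop 0).mono hbound)) zero_le
  filter_upwards [ae_all_iff.mpr fun k => measure_eq_zero_iff_ae_notMem.mp (key k)] with ω hω i j hT
  by_contra hne
  have hspan : ∀ g, ∀ᶠ k in atTop, g ∈ spanningSets ν k := fun g => by
    obtain ⟨k, hk⟩ := mem_iUnion.mp ((iUnion_spanningSets ν).symm ▸ mem_univ g)
    filter_upwards [eventually_ge_atTop k] with l hl
    exact monotone_spanningSets ν hl hk
  have hIoc : ∀ᶠ k : ℕ in atTop, T i ω ∈ Ioc (-(k : ℝ)) k := by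
    filter_upwards [tendsto_natCast_atTop_atTop.eventually_gt_atTop (|T i ω|)] with k hk
    exact ⟨(abs_lt.mp hk).1, (abs_lt.mp hk).2.le⟩
  obtain ⟨k, h1, h2, h3⟩ := ((hspan (Γ i ω)).and ((hspan (Γ j ω)).and hIoc)).exists
  exact hω k ⟨i, j, hne, hT, h1, h2, h3⟩

end Births

/-! ### Lifetimes as independent marks, and independence of cylinders by their births. -/

section Marks

variable {𝔾 Ω J : Type*} [MeasurableSpace 𝔾] [MeasurableSpace Ω]
  {P : Measure Ω} {ν : Measure 𝔾} {Γ : J → Ω → 𝔾} {T S : J → Ω → ℝ}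

/-- The cylinders of the free process. -/
def cylinder (Γ : J → Ω → 𝔾) (T S : J → Ω → ℝ) (i : J) (ω : Ω) : Cylinder 𝔾 :=
  (Γ i ω, T i ω, S i ω)

/-- The cylinders with basis and birth in `R`. -/
def bornIn (R : Set (𝔾 × ℝ)) : Set (Cylinder 𝔾) := {C | (C.1, C.2.1) ∈ R}

/-- The probability that a cylinder with given basis and birth belongs to `D`. -/
noncomputable def markProb (D : Set (Cylinder 𝔾)) (y : 𝔾 × ℝ) : ENNReal :=
  expMeasure 1 {s | ((y.1, y.2, s) : Cylinder 𝔾) ∈ D}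

/-- The mean measure of the cylinders. -/
noncomputable def meanMeasure (ν : Measure 𝔾) : Measure (Cylinder 𝔾) :=
  ν.prod ((volume : Measure ℝ).prod (expMeasure 1))

instance : IsProbabilityMeasure (expMeasure 1) := isProbabilityMeasure_expMeasure one_pos

lemma measurable_markProb {D : Set (Cylinder 𝔾)} (hD : MeasurableSet D) :
    Measurable (markProb D) := by
  have h : Measurable fun q : (𝔾 × ℝ) × ℝ => ((q.1.1, q.1.2, q.2) : Cylinder 𝔾) := by fun_prop
  exact measurable_measure_prodMk_left (h hD)

lemma markProb_le_one (D : Set (Cylinder 𝔾)) (y : 𝔾 × ℝ) : markProb D y ≤ 1 := prob_le_one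

lemma meanMeasure_apply [SigmaFinite ν] {D : Set (Cylinder 𝔾)} (hD : MeasurableSet D) :
    meanMeasure ν D = ∫⁻ y, markProb D y ∂(ν.prod (volume : Measure ℝ)) := by
  have h : Measurable fun q : (𝔾 × ℝ) × ℝ => ((q.1.1, q.1.2, q.2) : Cylinder 𝔾) := by fun_prop
  rw [meanMeasure, ← Measure.prodAssoc_prod, Measure.map_apply (MeasurableEquiv.measurable _) hD,
    Measure.prod_apply (MeasurableEquiv.prodAssoc.measurable hD)]
  rfl

lemma markProb_eq_zero {R : Set (𝔾 × ℝ)} {D : Set (Cylinder 𝔾)} (hD : D ⊆ bornIn R) {y : 𝔾 × ℝ}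
    (hy : y ∉ R) : markProb D y = 0 := by
  have : {s | ((y.1, y.2, s) : Cylinder 𝔾) ∈ D} = ∅ :=
    eq_empty_of_forall_notMem fun s hs => hy (hD hs)
  rw [markProb, this, measure_empty]

lemma markProb_compl_eq_one {R : Set (𝔾 × ℝ)} {B : Set (Cylinder 𝔾)} (hB : B ⊆ bornIn R)
    {y : 𝔾 × ℝ} (hy : y ∉ R) : markProb Bᶜ y = 1 := by
  have : {s | ((y.1, y.2, s) : Cylinder 𝔾) ∈ Bᶜ} = univ :=
    eq_univ_of_forall fun s hs => hy (hB hs)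
  rw [markProb, this, measure_univ]

lemma measurable_cylinder (h : IsFreeCylinders P ν Γ T S) (i : J) :
    Measurable (cylinder Γ T S i) :=
  (measurable_fst.comp (h.poisson.measurable i)).prodMk
    ((measurable_snd.comp (h.poisson.measurable i)).prodMk (h.measurable_lifetime i))

variable [Countable J] [IsProbabilityMeasure P] [SigmaFinite ν]

/-- Integration over the lifetimes, given bases and births. -/
lemma IsFreeCylinders.measure_eq_lintegral (h : IsFreeCylinders P ν Γ T S)
    {K : Set ((J → ℝ) × (J → 𝔾 × ℝ))} (hK : MeasurableSet K) :
    P {ω | ((fun i => S i ω), fun i => (Γ i ω, T i ω)) ∈ K} =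
      ∫⁻ ω, Measure.infinitePi (fun _ : J => expMeasure 1)
        {s | (s, fun i => (Γ i ω, T i ω)) ∈ K} ∂P := by
  have hS : Measurable fun ω i => S i ω := measurable_pi_lambda _ h.measurable_lifetime
  have hY : Measurable fun ω i => (Γ i ω, T i ω) := measurable_pi_lambda _ h.poisson.measurable
  have hmap := (indepFun_iff_map_prod_eq_prod_map_map hS.aemeasurable hY.aemeasurable).mp
    h.indep_poisson
  rw [h.indep_lifetime.map_fun_eq_infinitePi_map h.measurable_lifetime] at hmap
  simp only [h.law_lifetime] at hmap
  have h1 : P {ω | ((fun i => S i ω), fun i => (Γ i ω, T i ω)) ∈ K} =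
      P.map (fun ω => ((fun i => S i ω), fun i => (Γ i ω, T i ω))) K :=
    (Measure.map_apply (hS.prodMk hY) hK).symm
  have : IsProbabilityMeasure (P.map fun ω i => (Γ i ω, T i ω)) :=
    Measure.isProbabilityMeasure_map hY.aemeasurable
  rw [h1, hmap, Measure.prod_apply_symm hK, lintegral_map (measurable_measure_prodMk_right hK) hY]
  rfl

/-- The conditional probability, given bases and births, that no cylinder lies in `B`. -/
noncomputable def voidProb (Γ : J → Ω → 𝔾) (T : J → Ω → ℝ) (B : Set (Cylinder 𝔾)) (ω : Ω) :
    ENNReal :=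
  expNeg (∑' i, negLog (markProb Bᶜ (Γ i ω, T i ω)))

lemma measurable_voidProb (h : IsFreeCylinders P ν Γ T S) {B : Set (Cylinder 𝔾)}
    (hB : MeasurableSet B) : Measurable (voidProb Γ T B) := by
  refine continuous_expNeg.measurable.comp (Measurable.tsum fun i => ?_)
  have : Measurable fun ω => (Γ i ω, T i ω) := h.poisson.measurable i
  exact measurable_negLog.comp ((measurable_markProb hB.compl).comp this)

lemma measurableSet_section {B : Set (Cylinder 𝔾)} (hB : MeasurableSet B) (y : 𝔾 × ℝ) :
    MeasurableSet {s | ((y.1, y.2, s) : Cylinder 𝔾) ∈ B} := by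
  have h : Measurable fun s : ℝ => ((y.1, y.2, s) : Cylinder 𝔾) := by fun_prop
  exact h hB

lemma infinitePi_void (y : J → 𝔾 × ℝ) {B : Set (Cylinder 𝔾)} (hB : MeasurableSet B) :
    Measure.infinitePi (fun _ : J => expMeasure 1)
      {s | ∀ j, (((y j).1, (y j).2, s j) : Cylinder 𝔾) ∉ B} = ∏' j, markProb Bᶜ (y j) := by
  have : {s : J → ℝ | ∀ j, (((y j).1, (y j).2, s j) : Cylinder 𝔾) ∉ B} =
      univ.pi fun j => {s | (((y j).1, (y j).2, s) : Cylinder 𝔾) ∈ Bᶜ} := by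
    ext s; simp [Set.mem_pi]
  rw [this, Measure.infinitePi_pi_univ _ fun j => measurableSet_section hB.compl (y j)]
  rfl

/-- If the `i`-th birth lies outside `R`, avoiding `B` is no constraint on the `i`-th lifetime,
whose coordinate is free to carry `D`. If it lies in `R`, both sides vanish. -/
lemma infinitePi_void_inter [DecidableEq J] (y : J → 𝔾 × ℝ) {R : Set (𝔾 × ℝ)}
    {B D : Set (Cylinder 𝔾)} (hB : MeasurableSet B) (hBR : B ⊆ bornIn R) (hD : MeasurableSet D)
    (hDR : D ⊆ bornIn Rᶜ) (i : J) :
    Measure.infinitePi (fun _ : J => expMeasure 1)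
      {s | (((y i).1, (y i).2, s i) : Cylinder 𝔾) ∈ D ∧
        ∀ j, (((y j).1, (y j).2, s j) : Cylinder 𝔾) ∉ B} =
      markProb D (y i) * ∏' j, markProb Bᶜ (y j) := by
  by_cases hi : y i ∈ R
  · rw [markProb_eq_zero hDR (not_not.mpr hi), zero_mul]
    convert! measure_empty (μ := Measure.infinitePi (fun _ : J => expMeasure 1))
    exact eq_empty_of_forall_notMem fun s hs => hDR hs.1 hi
  · have : {s : J → ℝ | (((y i).1, (y i).2, s i) : Cylinder 𝔾) ∈ D ∧
        ∀ j, (((y j).1, (y j).2, s j) : Cylinder 𝔾) ∉ B} =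
        univ.pi fun j => {s | (((y j).1, (y j).2, s) : Cylinder 𝔾) ∈ if j = i then D else Bᶜ} := by
      ext s
      simp only [mem_ofPred_eq, Set.mem_pi, mem_univ, forall_const]
      constructor
      · rintro ⟨h1, h2⟩ j
        by_cases hj : j = i
        · subst hj; simpa using h1
        · simpa [hj] using h2 j
      · intro h
        refine ⟨by simpa using h i, fun j => ?_⟩
        by_cases hj : j = i
        · subst hj; exact fun hm => hi (hBR hm)
        · simpa [hj] using h j
    rw [this, Measure.infinitePi_pi_univ _ fun j => measurableSet_section
      (by split_ifs; exacts [hD, hB.compl]) (y j),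
      ← tprod_update_of_eq_one (fun j => markProb_le_one _ (y j)) (markProb_compl_eq_one hBR hi)
        (markProb_le_one D (y i))]
    refine tprod_congr fun j => ?_
    by_cases hj : j = i
    · subst hj; simp [markProb]
    · simp [hj, markProb]

lemma IsFreeCylinders.measure_void (h : IsFreeCylinders P ν Γ T S) {B : Set (Cylinder 𝔾)}
    (hB : MeasurableSet B) :
    P (void (cylinder Γ T S) B) = ∫⁻ ω, voidProb Γ T B ω ∂P := by
  have hm : ∀ j : J, Measurable fun q : (J → ℝ) × (J → 𝔾 × ℝ) =>
      (((q.2 j).1, (q.2 j).2, q.1 j) : Cylinder 𝔾) := fun j => by fun_prop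
  have hK : MeasurableSet {q : (J → ℝ) × (J → 𝔾 × ℝ) |
      ∀ j, (((q.2 j).1, (q.2 j).2, q.1 j) : Cylinder 𝔾) ∉ B} := by
    rw [ofPred_forall]
    exact MeasurableSet.iInter fun j => hm j hB.compl
  refine (h.measure_eq_lintegral hK).trans (lintegral_congr fun ω => ?_)
  refine (infinitePi_void (fun i => (Γ i ω, T i ω)) hB).trans ?_
  exact tprod_eq_expNeg fun j => markProb_le_one _ _

lemma IsFreeCylinders.measure_void_inter (h : IsFreeCylinders P ν Γ T S) {R : Set (𝔾 × ℝ)}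
    {B D : Set (Cylinder 𝔾)} (hB : MeasurableSet B) (hBR : B ⊆ bornIn R) (hD : MeasurableSet D)
    (hDR : D ⊆ bornIn Rᶜ) (i : J) :
    P (cylinder Γ T S i ⁻¹' D ∩ void (cylinder Γ T S) B) =
      ∫⁻ ω, markProb D (Γ i ω, T i ω) * voidProb Γ T B ω ∂P := by
  classical
  have hm : ∀ j : J, Measurable fun q : (J → ℝ) × (J → 𝔾 × ℝ) =>
      (((q.2 j).1, (q.2 j).2, q.1 j) : Cylinder 𝔾) := fun j => by fun_prop
  have hK : MeasurableSet {q : (J → ℝ) × (J → 𝔾 × ℝ) |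
      (((q.2 i).1, (q.2 i).2, q.1 i) : Cylinder 𝔾) ∈ D ∧
      ∀ j, (((q.2 j).1, (q.2 j).2, q.1 j) : Cylinder 𝔾) ∉ B} := by
    have hV : MeasurableSet {q : (J → ℝ) × (J → 𝔾 × ℝ) |
        ∀ j, (((q.2 j).1, (q.2 j).2, q.1 j) : Cylinder 𝔾) ∉ B} := by
      rw [ofPred_forall]
      exact MeasurableSet.iInter fun j => hm j hB.compl
    exact (hm i hD).inter hV
  refine (h.measure_eq_lintegral hK).trans (lintegral_congr fun ω => ?_)
  refine (infinitePi_void_inter (fun i => (Γ i ω, T i ω)) hB hBR hD hDR i).trans ?_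
  rw [tprod_eq_expNeg fun j => markProb_le_one _ _]
  rfl

/-- Measures that agree outside `R` on sets of finite measure. -/
lemma restrict_compl_eq_of_forall {X : Type*} [MeasurableSpace X] {μ μ' m : Measure X}
    [SigmaFinite m] {R : Set X} (hR : MeasurableSet R)
    (h : ∀ D, MeasurableSet D → D ⊆ Rᶜ → m D < ⊤ → μ D = μ' D) :
    μ.restrict Rᶜ = μ'.restrict Rᶜ := by
  refine (Measure.ext_iff_of_iUnion_eq_univ (iUnion_spanningSets m)).mpr fun k => ?_
  refine Measure.ext fun D hD => ?_
  have hDk := hD.inter (measurableSet_spanningSets m k)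
  rw [Measure.restrict_apply hD, Measure.restrict_apply hD, Measure.restrict_apply hDk,
    Measure.restrict_apply hDk]
  exact h _ (hDk.inter hR.compl) inter_subset_right
    ((measure_mono (inter_subset_left.trans inter_subset_right)).trans_lt
      (measure_spanningSets_lt_top m k))

variable [StandardBorelSpace 𝔾]

/-- The cylinders born outside `R` are independent of those born in `R`. -/
theorem IsFreeCylinders.independentOutside (h : IsFreeCylinders P ν Γ T S) {R : Set (𝔾 × ℝ)}
    (hR : MeasurableSet R) :
    IndependentOutside P (meanMeasure ν) (cylinder Γ T S) (bornIn R) := by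
  intro B hB hBR D hD hDR hDfin
  set y : J → Ω → 𝔾 × ℝ := fun i ω => (Γ i ω, T i ω) with hy
  have hym : ∀ i, Measurable (y i) := h.poisson.measurable
  set M := voidProb Γ T B with hM
  have hMm : Measurable M := measurable_voidProb h hB
  -- Factors of births outside `R` equal `1`, so the conditional void probability is a function of
  -- the births in `R`. Reading the sum over indices as one over points requires distinct births,
  -- hence the completed σ-algebra.
  have hobs : Measurable[observable P y R] M := by
    have h1 : Measurable[observable P y R] fun ω => expNeg (∫⁻ z in (range fun i => y i ω) ∩ R,
        negLog (markProb Bᶜ z) ∂Measure.count) :=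
      continuous_expNeg.measurable.comp (HitMeasurable.lintegral_count
        (hitMeasurable_observable hR) (fun ω => (countable_range _).mono inter_subset_left)
        (measurable_negLog.comp (measurable_markProb hB.compl)))
    refine @EventuallyMeasurable.congr Ω (voidSpace y R) (ae P) _ _ _ _ _ h1 ?_
    filter_upwards [ae_birth_injective h.poisson] with ω hω
    rw [setLIntegral_count_range (fun i j hij => hω i j (congrArg Prod.snd hij))
      (fun z hz => by rw [markProb_compl_eq_one hBR hz, negLog_one])]
    rfl
  have hindep := h.poisson.independentOutside R
  -- The number of births outside `R` is uncorrelated with every function of the births in `R`, in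
  -- particular with `M`.
  have hM0 : ∀ D₀, MeasurableSet D₀ → D₀ ⊆ Rᶜ → (ν.prod (volume : Measure ℝ)) D₀ < ⊤ →
      ∫⁻ ω, M ω ∂(countMeasure P y D₀) =
        (ν.prod (volume : Measure ℝ)) D₀ * ∫⁻ ω, M ω ∂P := by
    intro D₀ hD₀ hD₀R hfin
    have hmap : (countMeasure P y D₀).map M = (ν.prod (volume : Measure ℝ)) D₀ • P.map M :=
      Measure.ext fun A hA => by
        rw [Measure.map_apply hMm hA, Measure.smul_apply, Measure.map_apply hMm hA, smul_eq_mul,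
          hindep.countMeasure_apply hym hD₀ hD₀R hfin (hobs hA), mul_comm]
    rw [← lintegral_map (f := fun z => z) measurable_id hMm, hmap, lintegral_smul_measure,
      lintegral_map (f := fun z => z) measurable_id hMm, smul_eq_mul]
  -- Mean measure of the births under the weight `M`. Outside `R` it is the original mean measure
  -- times the mean of `M`, and `markProb D` vanishes in `R`.
  set ρ : Measure (𝔾 × ℝ) := Measure.sum fun i => (P.withDensity M).map (y i) with hρ
  have hρR : ρ.restrict Rᶜ =
      ((∫⁻ ω, M ω ∂P) • (ν.prod (volume : Measure ℝ))).restrict Rᶜ := by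
    refine restrict_compl_eq_of_forall (m := ν.prod (volume : Measure ℝ)) hR
      fun D₀ hD₀ hD₀R hfin => ?_
    rw [Measure.smul_apply, smul_eq_mul, mul_comm, ← hM0 D₀ hD₀ hD₀R hfin, countMeasure,
      lintegral_sum_measure, hρ, Measure.sum_apply _ hD₀]
    refine tsum_congr fun i => ?_
    rw [Measure.map_apply (hym i) hD₀, withDensity_apply _ (hym i hD₀)]
  have hp := measurable_markProb hD
  have hzero : ∀ μ : Measure (𝔾 × ℝ), ∫⁻ z in Rᶜ, markProb D z ∂μ = ∫⁻ z, markProb D z ∂μ := by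
    intro μ
    rw [← lintegral_indicator hR.compl]
    refine lintegral_congr fun z => ?_
    by_cases hz : z ∈ Rᶜ
    · simp [hz]
    · rw [indicator_of_notMem hz, markProb_eq_zero hDR hz]
  calc countMeasure P (cylinder Γ T S) D (void (cylinder Γ T S) B)
      = ∑' i, ∫⁻ ω, markProb D (y i ω) * M ω ∂P := by
        rw [countMeasure, Measure.sum_apply _ (measurableSet_void (measurable_cylinder h) hB)]
        refine tsum_congr fun i => ?_
        rw [Measure.restrict_apply (measurableSet_void (measurable_cylinder h) hB), inter_comm]
        exact h.measure_void_inter hB hBR hD hDR i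
    _ = ∫⁻ z, markProb D z ∂ρ := by
        rw [hρ, lintegral_sum_measure]
        refine tsum_congr fun i => ?_
        have hpi : Measurable fun ω => markProb D (y i ω) := hp.comp (hym i)
        rw [lintegral_map hp (hym i), lintegral_withDensity_eq_lintegral_mul _ hMm hpi]
        exact lintegral_congr fun ω => mul_comm _ _
    _ = (∫⁻ ω, M ω ∂P) * ∫⁻ z, markProb D z ∂(ν.prod (volume : Measure ℝ)) := by
        rw [← hzero, hρR, hzero, lintegral_smul_measure, smul_eq_mul]
    _ = P (void (cylinder Γ T S) B) * meanMeasure ν D := by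
        rw [h.measure_void hB, meanMeasure_apply hD]

end Marks

end BackwardClan

namespace BackwardClan

/-! ### The clan and the cylinders born before a given time -/

section ClanProcess

variable {𝔾 E : Type*} [MeasurableSpace 𝔾] [StandardBorelSpace 𝔾]
  {ν : Measure 𝔾} [SigmaFinite ν] {I : 𝔾 → 𝔾 → Prop} {body : 𝔾 → Set E} {Λ : Set E}
  {Ω J : Type*} [MeasurableSpace Ω] {P : Measure Ω} [IsProbabilityMeasure P] [Countable J]
  {Γ : J → Ω → 𝔾} {T S : J → Ω → ℝ}

/-- The members of the clan born in `[-t, 0)`, as a process. -/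
noncomputable def clanProcess (I : 𝔾 → 𝔾 → Prop) (body : 𝔾 → Set E) (Λ : Set E)
    (Γ : J → Ω → 𝔾) (T S : J → Ω → ℝ) (t : ℝ) (ω : Ω) : Config 𝔾 :=
  clanConfig I body Λ (cylinders Γ T S ω) t

lemma measurable_clanProcess (h : FiniteInfluence ν I body Λ) (hf : IsFreeCylinders P ν Γ T S)
    (t : ℝ) : Measurable (clanProcess I body Λ Γ T S t) :=
  (jointHit_range (measurable_cylinder hf)).measurable_clanConfig h.measurable
    h.measurable_window t

lemma clanConfig_congr {𝒞 𝒞' : Set (Cylinder 𝔾)} {t : ℝ}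
    (h : clanSince I body Λ 𝒞 t = clanSince I body Λ 𝒞' t) :
    clanConfig I body Λ 𝒞 t = clanConfig I body Λ 𝒞' t := by
  unfold clanConfig
  split_ifs with h1 h2 h2
  · exact Config.ext h
  · exact absurd (h ▸ h1) h2
  · exact absurd (h ▸ h2) h1
  · rfl

/-- The bases and births from time `-r` on. -/
def recent (𝔾 : Type*) (r : ℝ) : Set (𝔾 × ℝ) := univ ×ˢ Ici (-r)

lemma measurableSet_recent (r : ℝ) : MeasurableSet (recent 𝔾 r) :=
  MeasurableSet.univ.prod measurableSet_Ici

lemma mem_bornIn_recent {r : ℝ} {C : Cylinder 𝔾} : C ∈ bornIn (recent 𝔾 r) ↔ -r ≤ C.birth := by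
  simp [bornIn, recent, Cylinder.birth]

lemma measurableSet_bornIn {R : Set (𝔾 × ℝ)} (hR : MeasurableSet R) :
    MeasurableSet (bornIn R) := by
  have : Measurable fun C : Cylinder 𝔾 => (C.1, C.2.1) := by fun_prop
  exact this hR

/-- The part of the clan born from `-r` on is determined by the cylinders born from `-r` on. -/
lemma measurable_observable_clanProcess (h : FiniteInfluence ν I body Λ)
    (hf : IsFreeCylinders P ν Γ T S) (r : ℝ) :
    Measurable[observable P (cylinder Γ T S) (bornIn (recent 𝔾 r))]
      (clanProcess I body Λ Γ T S r) := by
  classical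
  set x := cylinder Γ T S with hx
  -- A full event with finitely many births in each bounded piece and none at time `0`. Off this
  -- event the random set is emptied, because joint measurability asks for finiteness at every `ω`.
  set G : Set Ω := {ω | (∀ i, T i ω ≠ 0) ∧
    ∀ k : ℕ, {i | Γ i ω ∈ spanningSets ν k ∧ T i ω ∈ Icc (-(k : ℝ)) k}.Finite} with hG
  have hGae : ∀ᵐ ω ∂P, ω ∈ G := (ae_birth_ne hf.poisson 0).and (ae_finite_births hf.poisson)
  set W : Set (Cylinder 𝔾) := {C | -r ≤ C.birth ∧ C.birth < 0} with hW
  set 𝒮 : Ω → Set (Cylinder 𝔾) := fun ω => if ω ∈ G then range (fun i => x i ω) ∩ W else ∅ with h𝒮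
  have hhit : HitMeasurable (observable P x (bornIn (recent 𝔾 r))) 𝒮 := by
    intro B hB
    have h1 := hitMeasurable_observable (P := P) (x := x)
      (measurableSet_bornIn (measurableSet_recent (𝔾 := 𝔾) r)) (W ∩ B)
      ((measurableSet_born (-r) 0).inter hB)
    refine @EventuallyMeasurableSet.congr Ω (voidSpace x (bornIn (recent 𝔾 r))) _ _ (ae P) _ h1 ?_
    filter_upwards [hGae] with ω hω
    refine propext ?_
    change (𝒮 ω ∩ B).Nonempty ↔
      ((range fun i => x i ω) ∩ bornIn (recent 𝔾 r) ∩ (W ∩ B)).Nonempty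
    simp only [h𝒮, if_pos hω]
    constructor
    · rintro ⟨C, ⟨h1, h2⟩, h3⟩
      exact ⟨C, ⟨h1, mem_bornIn_recent.mpr h2.1⟩, h2, h3⟩
    · rintro ⟨C, ⟨h1, -⟩, h2, h3⟩
      exact ⟨C, ⟨h1, h2⟩, h3⟩
  have hfin : ∀ ω k, (𝒮 ω ∩ Prod.fst ⁻¹' (spanningSets ν k)).Finite := by
    intro ω k
    by_cases hω : ω ∈ G
    · obtain ⟨l, hl⟩ := exists_nat_ge (max (k : ℝ) r)
      refine ((hω.2 l).image fun i => x i ω).subset ?_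
      rintro C ⟨hC, hCk⟩
      simp only [h𝒮, if_pos hω] at hC
      obtain ⟨⟨i, rfl⟩, h1, h2⟩ := hC
      have hkl : (k : ℝ) ≤ l := (le_max_left _ _).trans hl
      refine ⟨i, ⟨monotone_spanningSets ν (by exact_mod_cast hkl) hCk, ?_, ?_⟩, rfl⟩
      · have : -r ≤ T i ω := h1
        linarith [(le_max_right (k : ℝ) r).trans hl]
      · have : T i ω < 0 := h2
        linarith [l.cast_nonneg (α := ℝ)]
    · simp [h𝒮, hω]
  have hjoint := hhit.jointHit (fun k => measurable_fst (measurableSet_spanningSets ν k))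
    (by rw [← preimage_iUnion, iUnion_spanningSets, preimage_univ]) hfin
  refine @EventuallyMeasurable.congr Ω (voidSpace x (bornIn (recent 𝔾 r))) (ae P) _ _ _ _ _
    (hjoint.measurable_clanConfig h.measurable h.measurable_window r) ?_
  filter_upwards [hGae] with ω hω
  refine clanConfig_congr ?_
  have h0 : ∀ C ∈ cylinders Γ T S ω, C.birth ≠ 0 := by rintro _ ⟨i, rfl⟩; exact hω.1 i
  have e : 𝒮 ω = cylinders Γ T S ω ∩ W := by simp only [h𝒮, if_pos hω]; rfl
  -- The clan built from the truncated set is already the part of the clan born in `[-r, 0)`, so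
  -- truncating it again changes nothing.
  have h1 := clan_inter_eq_clanSince (I := I) (body := body) (Λ := Λ) h0 r
  rw [e, ← h1]
  refine Subset.antisymm (fun C hC => ⟨hC, (clan_subset hC).2⟩) fun C hC => hC.1

lemma observable_mono {x : J → Ω → Cylinder 𝔾} {R R' : Set (Cylinder 𝔾)} (h : R ⊆ R') :
    observable P x R ≤ observable P x R' := by
  rintro V ⟨W, hW, hVW⟩
  refine ⟨W, ?_, hVW⟩
  refine MeasurableSpace.generateFrom_mono ?_ _ hW
  rintro _ ⟨B, hB, hBR, rfl⟩
  exact ⟨B, hB, hBR.trans h, rfl⟩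

lemma history_clanProcess_le (h : FiniteInfluence ν I body Λ)
    (hf : IsFreeCylinders P ν Γ T S) (r : ℝ) :
    history (clanProcess I body Λ Γ T S) r ≤
      observable P (cylinder Γ T S) (bornIn (recent 𝔾 r)) := by
  refine iSup₂_le fun u hu => ?_
  rintro V ⟨D, hD, rfl⟩
  refine observable_mono (fun C hC => ?_) _ (measurable_observable_clanProcess h hf u hD)
  rw [mem_bornIn_recent] at hC ⊢
  linarith [hu.2]

/-- Averaging over the cylinders born before `-r`, given the history of the clan up to time `r`. -/
theorem setIntegral_tsum_cylinder (h : FiniteInfluence ν I body Λ)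
    (hf : IsFreeCylinders P ν Γ T S) {r : ℝ} (hr : 0 ≤ r) {V : Set Ω}
    (hV : MeasurableSet[history (clanProcess I body Λ Γ T S) r] V) {D : Set (Cylinder 𝔾)}
    (hD : MeasurableSet D) (hDr : D ⊆ (bornIn (recent 𝔾 r))ᶜ) (hDfin : meanMeasure ν D < ⊤)
    {g : Config 𝔾 × Cylinder 𝔾 → ℝ} (hg : Measurable g) {K : ℝ} (hK : ∀ p, |g p| ≤ K) :
    ∫ ω in V, (∑' i, D.indicator (fun C => g (clanProcess I body Λ Γ T S r ω, C))
        (cylinder Γ T S i ω)) ∂P =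
      ∫ ω in V, (∫ C in D, g (clanProcess I body Λ Γ T S r ω, C) ∂(meanMeasure ν)) ∂P := by
  set x := cylinder Γ T S with hx
  set A := clanProcess I body Λ Γ T S with hA
  have hxm : ∀ i, Measurable (x i) := measurable_cylinder hf
  have hAm : ∀ t, Measurable (A t) := measurable_clanProcess h hf
  have hVm : MeasurableSet V := history_le (fun t _ => hAm t) r _ hV
  have hcount : ∀ D, MeasurableSet D → D ⊆ (bornIn (recent 𝔾 r))ᶜ → meanMeasure ν D < ⊤ →
      ∀ W, MeasurableSet[history A r] W → countMeasure P x D W = P W * meanMeasure ν D :=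
    fun D hD hDr hDfin W hW => (hf.independentOutside (measurableSet_recent r)).countMeasure_apply
      hxm hD hDr hDfin (history_clanProcess_le h hf r _ hW)
  have : IsFiniteMeasure ((meanMeasure ν).restrict D) := ⟨by simpa using hDfin⟩
  set μ : Measure (Config 𝔾 × Cylinder 𝔾) := Measure.sum fun i =>
    (P.restrict (V ∩ x i ⁻¹' D)).map fun ω => (A r ω, x i ω) with hμ
  -- The expected point measure of pairs (state at time `r`, cylinder in `D`) is a product: the
  -- state and `V` depend on births from `-r` on, while `D` contains only earlier births.
  have hprod : ((P.restrict V).map (A r)).prod ((meanMeasure ν).restrict D) = μ := by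
    refine Measure.prod_eq fun U D' hU hD' => ?_
    rw [hμ, Measure.sum_apply _ (hU.prod hD'), Measure.map_apply (hAm r) hU,
      Measure.restrict_apply (hAm r hU), Measure.restrict_apply hD', ← hcount (D' ∩ D)
        (hD'.inter hD) (inter_subset_right.trans hDr) ((measure_mono inter_subset_right).trans_lt
          hDfin) _ ((measurableSet_history hr le_rfl hU).inter hV), countMeasure,
      Measure.sum_apply _ ((hAm r hU).inter hVm)]
    refine tsum_congr fun i => ?_
    rw [Measure.map_apply ((hAm r).prodMk (hxm i)) (hU.prod hD'),
      Measure.restrict_apply (((hAm r).prodMk (hxm i)) (hU.prod hD')),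
      Measure.restrict_apply ((hAm r hU).inter hVm)]
    congr 1
    ext ω
    simp only [mem_inter_iff, mem_preimage, mem_prod]
    tauto
  have : IsFiniteMeasure μ := hprod ▸ inferInstance
  have hgint : Integrable g μ := Integrable.of_bound hg.aestronglyMeasurable K
    (Eventually.of_forall hK)
  have hterm : ∀ i, ∫ p, g p ∂((P.restrict (V ∩ x i ⁻¹' D)).map fun ω => (A r ω, x i ω)) =
      ∫ ω in V, D.indicator (fun C => g (A r ω, C)) (x i ω) ∂P := by
    intro i
    rw [integral_map ((hAm r).prodMk (hxm i)).aemeasurable hg.aestronglyMeasurable, inter_comm,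
      ← Measure.restrict_restrict (hxm i hD), ← integral_indicator (hxm i hD)]
    rfl
  have hm : ∀ i, Measurable fun ω => D.indicator (fun C => g (A r ω, C)) (x i ω) := fun i =>
    (hg.comp ((hAm r).prodMk (hxm i))).indicator (hxm i hD)
  have hbd : ∀ i ω, ‖D.indicator (fun C => g (A r ω, C)) (x i ω)‖ ≤
      (x i ⁻¹' D).indicator (fun _ => K) ω := by
    intro i ω
    by_cases hi : x i ω ∈ D
    · simpa [hi, indicator] using hK _
    · simp [hi, indicator]
  have hint : ∀ i, Integrable (fun ω => D.indicator (fun C => g (A r ω, C)) (x i ω))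
      (P.restrict V) := fun i =>
    ((integrable_const K).indicator (hxm i hD)).mono' (hm i).aestronglyMeasurable
      (Eventually.of_forall (hbd i))
  have hsum : Summable fun i => ∫ ω in V, ‖D.indicator (fun C => g (A r ω, C)) (x i ω)‖ ∂P := by
    have h1 : Summable fun i => (P.restrict V).real (x i ⁻¹' D) * K := by
      refine Summable.mul_right K (ENNReal.summable_toReal ?_)
      have := hcount D hD hDr hDfin V hV
      rw [countMeasure, Measure.sum_apply _ hVm] at this
      have e : ∀ i, (P.restrict V) (x i ⁻¹' D) = (P.restrict (x i ⁻¹' D)) V := fun i => by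
        rw [Measure.restrict_apply (hxm i hD), Measure.restrict_apply hVm, inter_comm]
      simp only [e, this]
      exact (ENNReal.mul_lt_top (measure_lt_top _ _) hDfin).ne
    refine Summable.of_nonneg_of_le (fun i => integral_nonneg fun ω => norm_nonneg _)
      (fun i => ?_) h1
    refine (integral_mono (hint i).norm ((integrable_const K).indicator (hxm i hD))
      (hbd i)).trans ?_
    rw [integral_indicator_const _ (hxm i hD), smul_eq_mul]
  rw [← integral_tsum_of_summable_integral_norm hint hsum]
  simp only [← hterm]
  rw [← integral_sum_measure (hμ ▸ hgint), ← hμ, ← hprod, integral_prod _ (hprod ▸ hgint),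
    integral_map (hAm r).aemeasurable]
  exact (hg.stronglyMeasurable.integral_prod_right').aestronglyMeasurable

end ClanProcess

end BackwardClan

namespace BackwardClan

/-! ### The mean contribution of a strip of cylinders -/

section MeanJump

variable {𝔾 E : Type*} [MeasurableSpace 𝔾] [StandardBorelSpace 𝔾]
  {ν : Measure 𝔾} [SigmaFinite ν] {I : 𝔾 → 𝔾 → Prop} {body : 𝔾 → Set E} {Λ : Set E}

lemma expMeasure_one_eq : expMeasure 1 = expDensity.restrict (Ioi 0) := by
  rw [expDensity, restrict_withDensity measurableSet_Ioi, restrict_Ioi_eq_restrict_Ici,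
    ← withDensity_indicator measurableSet_Ici]
  refine congrArg (Measure.withDensity volume) (funext fun s => ?_)
  change exponentialPDF 1 s = _
  by_cases hs : 0 ≤ s
  · rw [exponentialPDF_of_nonneg hs, indicator_of_mem (mem_Ici.mpr hs)]
    simp
  · rw [exponentialPDF_of_neg (not_le.mp hs), indicator_of_notMem (mt mem_Ici.mp hs)]

lemma measurableSet_attached (h : FiniteInfluence ν I body Λ) :
    MeasurableSet {p : Config 𝔾 × Cylinder 𝔾 | p.2 ∈ attached I body Λ p.1} := by
  have h1 : Measurable fun p : Config 𝔾 × Cylinder 𝔾 => (p.1, p.2.basis) :=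
    measurable_fst.prodMk (measurable_basis.comp measurable_snd)
  exact (h1 (measurableSet_potential_prod h.measurable h.measurable_window)).inter
    (measurableSet_le ((measurable_TI h.measurable).comp h1) (measurable_death.comp measurable_snd))

lemma measurableSet_strip (r r' : ℝ) : MeasurableSet (strip 𝔾 r r') :=
  measurableSet_born (-r') (-r)

lemma measurable_jump (h : FiniteInfluence ν I body Λ) {F : Config 𝔾 → ℝ} (hF : Measurable F)
    (r r' : ℝ) :
    Measurable fun p : Config 𝔾 × Cylinder 𝔾 => jump I body Λ F r r' p.1 p.2 :=
  Measurable.ite ((measurable_snd (measurableSet_strip r r')).inter (measurableSet_attached h))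
    ((hF.comp Config.measurable_add).sub (hF.comp measurable_fst)) measurable_const

lemma abs_jump_le {F : Config 𝔾 → ℝ} {K : ℝ} (hK : ∀ a, |F a| ≤ K) (r r' : ℝ) (a : Config 𝔾)
    (C : Cylinder 𝔾) : |jump I body Λ F r r' a C| ≤ 2 * K := by
  rw [jump]
  split_ifs
  · exact abs_increment_le hK _ _
  · have := (abs_nonneg _).trans (hK a)
    simpa using this

/-- The cylinders born in `[-r', -r)` with basis in `B`. -/
def stripOver (B : Set 𝔾) (r r' : ℝ) : Set (Cylinder 𝔾) :=
  strip 𝔾 r r' ∩ Cylinder.basis ⁻¹' B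

lemma measurableSet_stripOver {B : Set 𝔾} (hB : MeasurableSet B) (r r' : ℝ) :
    MeasurableSet (stripOver B r r') :=
  (measurableSet_strip r r').inter (measurable_basis hB)

lemma jump_eq_zero {F : Config 𝔾 → ℝ} {B : Set 𝔾} (hloc : LocalTo B F) {r r' : ℝ} {a : Config 𝔾}
    {C : Cylinder 𝔾} (hC : C ∉ stripOver B r r') : jump I body Λ F r r' a C = 0 := by
  rw [jump]
  split_ifs with h
  · have hB : C.basis ∉ B := fun hB => hC ⟨h.1, hB⟩
    have := hloc.joined_eq (u := -C.birth) (a := a) (p := (C.1, C.2.2)) hB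
    rw [joined, neg_neg] at this
    exact sub_eq_zero.mpr this
  · rfl

lemma meanMeasure_stripOver_lt_top {B : Set 𝔾} (hBfin : ν B < ⊤) (r r' : ℝ) :
    meanMeasure ν (stripOver B r r') < ⊤ := by
  have : stripOver B r r' = B ×ˢ (Ico (-r') (-r) ×ˢ univ) := by
    ext C
    simp only [stripOver, strip, Cylinder.birth, Cylinder.basis, mem_inter_iff, mem_ofPred_eq,
      mem_preimage, mem_prod, mem_Ico, mem_univ, and_true]
    tauto
  rw [this, meanMeasure, Measure.prod_prod, Measure.prod_prod, Real.volume_Ico, measure_univ,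
    mul_one]
  exact ENNReal.mul_lt_top hBfin ENNReal.ofReal_lt_top

/-- The mean measure, disintegrated along the time axis. -/
lemma measurePreserving_cylinder : MeasurePreserving
    (fun q : ℝ × (𝔾 × ℝ) => ((q.2.1, -q.1, q.2.2) : Cylinder 𝔾))
    ((volume : Measure ℝ).prod (ν.prod (expMeasure 1))) (meanMeasure ν) := by
  have h1 := (measurePreserving_prodAssoc (volume : Measure ℝ) ν (expMeasure 1)).symm
  have h2 := (Measure.measurePreserving_swap (μ := (volume : Measure ℝ)) (ν := ν)).prod
    (MeasurePreserving.id (expMeasure 1))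
  have h3 := measurePreserving_prodAssoc ν (volume : Measure ℝ) (expMeasure 1)
  have h4 := (MeasurePreserving.id ν).prod ((Measure.measurePreserving_neg (volume : Measure ℝ)).prod
    (MeasurePreserving.id (expMeasure 1)))
  exact h4.comp (h3.comp (h2.comp h1))

/-- Two discrepancies disappear: equality of death and `TI` is a null event, and the positivity of
lifetimes is automatic because `u + TI` is nonnegative for a valid configuration. -/
lemma restrict_attached_eq_rate (h : FiniteInfluence ν I body Λ) {u : ℝ} (hu : 0 ≤ u)
    {a : Config 𝔾} (ha : Valid u a) :
    (ν.prod (expMeasure 1)).restrict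
      {p : 𝔾 × ℝ | ((p.1, -u, p.2) : Cylinder 𝔾) ∈ attached I body Λ a} =
      rate ν I body Λ u a := by
  have hatt : MeasurableSet {p : 𝔾 × ℝ | ((p.1, -u, p.2) : Cylinder 𝔾) ∈ attached I body Λ a} := by
    have : Measurable fun p : 𝔾 × ℝ => (a, ((p.1, -u, p.2) : Cylinder 𝔾)) := by fun_prop
    exact this (measurableSet_attached h)
  have e : ν.prod (expMeasure 1) = (ν.prod expDensity).restrict (univ ×ˢ Ioi 0) := by
    rw [expMeasure_one_eq, ← Measure.prod_restrict, Measure.restrict_univ]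
  rw [e, Measure.restrict_restrict hatt, rate]
  refine Measure.restrict_congr_set ?_
  have hnull : (ν.prod expDensity) {p : 𝔾 × ℝ | p.2 = u + TI I a p.1} = 0 := by
    have hTI : Measurable fun p : 𝔾 × ℝ => u + TI I a p.1 := by
      have : Measurable fun p : 𝔾 × ℝ => TI I a p.1 :=
        (measurable_TI h.measurable).comp (measurable_const.prodMk measurable_fst)
      exact this.const_add u
    rw [Measure.measure_prod_null (measurableSet_eq_fun measurable_snd hTI)]
    refine Eventually.of_forall fun θ => ?_
    have : Prod.mk θ ⁻¹' {p : 𝔾 × ℝ | p.2 = u + TI I a p.1} = {u + TI I a θ} := by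
      ext s; simp
    change expDensity (Prod.mk θ ⁻¹' {p : 𝔾 × ℝ | p.2 = u + TI I a p.1}) = 0
    rw [this, measure_singleton]
  filter_upwards [measure_eq_zero_iff_ae_notMem.mp hnull] with p hp
  refine propext ?_
  change (((p.1, -u, p.2) : Cylinder 𝔾) ∈ attached I body Λ a ∧ p ∈ univ ×ˢ Ioi 0) ↔
    p ∈ admissible I body Λ u a
  have h0 := ha.neg_le_TI (I := I) hu p.1
  have hp' : p.2 ≠ u + TI I a p.1 := hp
  constructor
  · rintro ⟨⟨h1, h2⟩, -⟩
    have h2' : TI I a p.1 ≤ -u + p.2 := h2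
    exact ⟨h1, lt_of_le_of_ne (by linarith) hp'.symm⟩
  · rintro ⟨h1, h2⟩
    refine ⟨⟨h1, ?_⟩, mem_univ _, ?_⟩
    · change TI I a p.1 ≤ -u + p.2
      linarith
    · change 0 < p.2
      linarith

/-- The strip is disintegrated by the birth time `-u`. The generator depends on the running time
`u`, while the configuration remains frozen at `a`. -/
lemma setIntegral_jump (h : FiniteInfluence ν I body Λ) {F : Config 𝔾 → ℝ} (hF : Measurable F)
    {K : ℝ} (hK : ∀ a, |F a| ≤ K) {B : Set 𝔾} (hB : MeasurableSet B) (hBfin : ν B < ⊤)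
    (hloc : LocalTo B F) {r r' : ℝ} (hr : 0 ≤ r) (hrr : r ≤ r') {a : Config 𝔾} (ha : Valid r a) :
    ∫ C in stripOver B r r', jump I body Λ F r r' a C ∂(meanMeasure ν) =
      ∫ u in r..r', generator ν I body Λ u F a := by
  have hjm : Measurable fun C => jump I body Λ F r r' a C :=
    (measurable_jump h hF r r').comp measurable_prodMk_left
  have hD := measurableSet_stripOver hB r r'
  have hind : (stripOver B r r').indicator (jump I body Λ F r r' a) = jump I body Λ F r r' a := by
    ext C
    by_cases hC : C ∈ stripOver B r r'
    · simp [hC]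
    · simp [hC, jump_eq_zero hloc hC]
  have hint : Integrable (jump I body Λ F r r' a) (meanMeasure ν) := by
    have : IsFiniteMeasure ((meanMeasure ν).restrict (stripOver B r r')) :=
      ⟨by simpa using meanMeasure_stripOver_lt_top hBfin r r'⟩
    rw [← hind, integrable_indicator_iff hD]
    exact Integrable.of_bound hjm.aestronglyMeasurable (2 * K)
      (Eventually.of_forall fun C => abs_jump_le hK r r' a C)
  have hmp := measurePreserving_cylinder (ν := ν)
  rw [← integral_indicator hD, hind, ← hmp.map_eq,
    integral_map hmp.measurable.aemeasurable hjm.aestronglyMeasurable]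
  have hint' : Integrable (fun q : ℝ × (𝔾 × ℝ) =>
      jump I body Λ F r r' a (q.2.1, -q.1, q.2.2)) (volume.prod (ν.prod (expMeasure 1))) :=
    hmp.integrable_comp_of_integrable hint
  rw [integral_prod _ hint', intervalIntegral.integral_of_le hrr,
    ← integral_indicator measurableSet_Ioc]
  refine integral_congr_ae (Eventually.of_forall fun u => ?_)
  by_cases hu : u ∈ Ioc r r'
  · have hu0 : 0 ≤ u := hr.trans hu.1.le
    simp only [indicator_of_mem hu]
    rw [generator_eq_integral_rate h.measurable h.measurable_window h.window_lt_top h.lt_top hF hK,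
      ← restrict_attached_eq_rate h hu0 (ha.mono hu.1.le)]
    have hatt : MeasurableSet
        {p : 𝔾 × ℝ | ((p.1, -u, p.2) : Cylinder 𝔾) ∈ attached I body Λ a} := by
      have : Measurable fun p : 𝔾 × ℝ => (a, ((p.1, -u, p.2) : Cylinder 𝔾)) := by fun_prop
      exact this (measurableSet_attached h)
    rw [← integral_indicator hatt]
    refine integral_congr_ae (Eventually.of_forall fun p => ?_)
    have hs : ((p.1, -u, p.2) : Cylinder 𝔾) ∈ strip 𝔾 r r' :=
      ⟨neg_le_neg hu.2, neg_lt_neg hu.1⟩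
    by_cases hp : ((p.1, -u, p.2) : Cylinder 𝔾) ∈ attached I body Λ a
    · have e : jump I body Λ F r r' a (p.1, -u, p.2) = F (a.add (p.1, -u, p.2)) - F a :=
        if_pos ⟨hs, hp⟩
      exact e.trans (indicator_of_mem (s := {p : 𝔾 × ℝ |
        ((p.1, -u, p.2) : Cylinder 𝔾) ∈ attached I body Λ a}) hp
        fun p => F (joined u a p) - F a).symm
    · have e : jump I body Λ F r r' a (p.1, -u, p.2) = 0 := if_neg fun h => hp h.2
      exact e.trans (indicator_of_notMem (s := {p : 𝔾 × ℝ |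
        ((p.1, -u, p.2) : Cylinder 𝔾) ∈ attached I body Λ a}) hp
        fun p => F (joined u a p) - F a).symm
  · have hs : ∀ p : 𝔾 × ℝ, ((p.1, -u, p.2) : Cylinder 𝔾) ∉ strip 𝔾 r r' := fun p hs =>
      hu ⟨neg_lt_neg_iff.mp hs.2, neg_le_neg_iff.mp hs.1⟩
    simp [indicator_of_notMem hu, jump, hs]

end MeanJump

end BackwardClan

namespace BackwardClan

/-! ### The clan satisfies the evolution equation -/

section ClanSolves

variable {𝔾 E : Type*} [MeasurableSpace 𝔾] [StandardBorelSpace 𝔾]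
  {ν : Measure 𝔾} [SigmaFinite ν] {I : 𝔾 → 𝔾 → Prop} {body : 𝔾 → Set E} {Λ : Set E}
  {Ω J : Type*} [MeasurableSpace Ω] {P : Measure Ω} [IsProbabilityMeasure P] [Countable J]
  {Γ : J → Ω → 𝔾} {T S : J → Ω → ℝ}

lemma number_stripOver_add {x : J → Ω → Cylinder 𝔾} (B : Set 𝔾) {r r' r'' : ℝ} (h : r ≤ r')
    (h' : r' ≤ r'') (ω : Ω) : number x (stripOver B r r'') ω =
      number x (stripOver B r r') ω + number x (stripOver B r' r'') ω := by
  have hu : stripOver B r r'' = stripOver B r r' ∪ stripOver B r' r'' := by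
    ext C
    simp only [stripOver, strip, mem_inter_iff, mem_ofPred_eq, mem_union, mem_preimage]
    constructor
    · rintro ⟨⟨h1, h2⟩, h3⟩
      rcases le_or_gt (-r') C.birth with h4 | h4
      · exact Or.inl ⟨⟨h4, h2⟩, h3⟩
      · exact Or.inr ⟨⟨h1, h4⟩, h3⟩
    · rintro (⟨⟨h1, h2⟩, h3⟩ | ⟨⟨h1, h2⟩, h3⟩)
      · exact ⟨⟨by linarith, h2⟩, h3⟩
      · exact ⟨⟨h1, by linarith⟩, h3⟩
  have hd : Disjoint (stripOver B r r') (stripOver B r' r'') :=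
    disjoint_left.mpr fun C h1 h2 => absurd h1.1.1 (not_le.mpr h2.1.2)
  simp only [number, hu, indicator_union_of_disjoint hd, ENNReal.tsum_add]

/-- Strips of a grid add up to one strip, so the number of cylinders in the latter dominates the
jump sums of all grids at once. -/
lemma sum_number_stripOver {x : J → Ω → Cylinder 𝔾} (B : Set 𝔾) {g : ℕ → ℝ} (hg : Monotone g)
    (ω : Ω) (n : ℕ) : ∑ k ∈ Finset.range n, number x (stripOver B (g k) (g (k + 1))) ω =
      number x (stripOver B (g 0) (g n)) ω := by
  induction n with
  | zero =>
    have : stripOver B (g 0) (g 0) = ∅ := by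
      ext C
      simp only [stripOver, strip, mem_inter_iff, mem_ofPred_eq, mem_empty_iff_false, iff_false]
      rintro ⟨⟨h1, h2⟩, -⟩
      linarith
    simp [number, this]
  | succ n ih =>
    rw [Finset.sum_range_succ, ih, ← number_stripOver_add B (hg n.zero_le) (hg n.le_succ)]

lemma enorm_tsum_jump_le {F : Config 𝔾 → ℝ} {K : ℝ} (hK : ∀ a, |F a| ≤ K) {B : Set 𝔾}
    (hloc : LocalTo B F) (x : J → Ω → Cylinder 𝔾) (r r' : ℝ) (a : Config 𝔾) (ω : Ω) :
    ‖∑' i, jump I body Λ F r r' a (x i ω)‖ₑ ≤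
      ENNReal.ofReal (2 * K) * number x (stripOver B r r') ω := by
  refine enorm_tsum_le_tsum_enorm.trans ?_
  rw [number, ← ENNReal.tsum_mul_left]
  refine ENNReal.tsum_le_tsum fun i => ?_
  by_cases hi : x i ω ∈ stripOver B r r'
  · rw [indicator_of_mem hi, Pi.one_apply, mul_one, Real.enorm_eq_ofReal_abs]
    exact ENNReal.ofReal_le_ofReal (abs_jump_le hK _ _ _ _)
  · rw [jump_eq_zero hloc hi]
    simp

/-- The mean count is read off from the independence formula with `R` and `B` empty, whose void
event is the whole space. -/
lemma lintegral_number_stripOver (hf : IsFreeCylinders P ν Γ T S) {B : Set 𝔾}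
    (hB : MeasurableSet B) (hBfin : ν B < ⊤) (r r' : ℝ) :
    ∫⁻ ω, number (cylinder Γ T S) (stripOver B r r') ω ∂P < ⊤ := by
  have hD := measurableSet_stripOver hB r r'
  have hDfin := meanMeasure_stripOver_lt_top (B := B) hBfin r r'
  have h1 := hf.independentOutside MeasurableSet.empty ∅ MeasurableSet.empty (empty_subset _) _ hD
    (by simp [bornIn]) hDfin
  rw [← setLIntegral_univ, setLIntegral_number (measurable_cylinder hf) hD MeasurableSet.univ]
  rw [void_empty] at h1
  rw [h1, measure_univ, one_mul]
  exact hDfin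

lemma measurable_sum_jump (h : FiniteInfluence ν I body Λ) (hf : IsFreeCylinders P ν Γ T S)
    {F : Config 𝔾 → ℝ} (hF : Measurable F) (r r' : ℝ) :
    Measurable fun ω => ∑' i, jump I body Λ F r r' (clanProcess I body Λ Γ T S r ω)
      (cylinder Γ T S i ω) :=
  Measurable.tsum fun i => (measurable_jump h hF r r').comp
    ((measurable_clanProcess h hf r).prodMk (measurable_cylinder hf i))

lemma integrable_sum_jump (h : FiniteInfluence ν I body Λ) (hf : IsFreeCylinders P ν Γ T S)
    {F : Config 𝔾 → ℝ} (hF : Measurable F) {K : ℝ} (hK : ∀ a, |F a| ≤ K) {B : Set 𝔾}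
    (hB : MeasurableSet B) (hBfin : ν B < ⊤) (hloc : LocalTo B F) (r r' : ℝ) :
    Integrable (fun ω => ∑' i, jump I body Λ F r r' (clanProcess I body Λ Γ T S r ω)
      (cylinder Γ T S i ω)) P := by
  refine ⟨(measurable_sum_jump h hf hF r r').aestronglyMeasurable, ?_⟩
  refine (lintegral_mono fun ω => enorm_tsum_jump_le hK hloc _ r r' _ ω).trans_lt ?_
  rw [lintegral_const_mul _ (measurable_number (measurable_cylinder hf)
    (measurableSet_stripOver hB r r'))]
  exact ENNReal.mul_lt_top ENNReal.ofReal_lt_top (lintegral_number_stripOver hf hB hBfin r r')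

lemma ae_goodPath_clanProcess (hfin : ∀ᵐ ω ∂P, ∀ t : ℝ,
      (clanSince I body Λ (cylinders Γ T S ω) t).Finite) :
    ∀ᵐ ω ∂P, GoodPath fun t => clanProcess I body Λ Γ T S t ω :=
  hfin.mono fun _ h => goodPath_clanConfig h

/-- The mean contribution of a strip of cylinders to the increment of `F`. -/
lemma setIntegral_sum_jump (h : FiniteInfluence ν I body Λ) (hf : IsFreeCylinders P ν Γ T S)
    (hfin : ∀ᵐ ω ∂P, ∀ t : ℝ, (clanSince I body Λ (cylinders Γ T S ω) t).Finite)
    {F : Config 𝔾 → ℝ} (hF : Measurable F) {K : ℝ} (hK : ∀ a, |F a| ≤ K) {B : Set 𝔾}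
    (hB : MeasurableSet B) (hBfin : ν B < ⊤) (hloc : LocalTo B F) {r r' : ℝ} (hr : 0 ≤ r)
    (hrr : r ≤ r') {V : Set Ω} (hV : MeasurableSet[history (clanProcess I body Λ Γ T S) r] V) :
    ∫ ω in V, (∑' i, jump I body Λ F r r' (clanProcess I body Λ Γ T S r ω)
        (cylinder Γ T S i ω)) ∂P =
      ∫ ω in V, (∫ u in r..r', generator ν I body Λ u F (clanProcess I body Λ Γ T S r ω)) ∂P := by
  have hD := measurableSet_stripOver hB r r'
  have key := setIntegral_tsum_cylinder h hf hr hV hD (fun C hC hC' => absurd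
    (mem_bornIn_recent.mp hC') (not_le.mpr hC.1.2)) (meanMeasure_stripOver_lt_top hBfin r r')
    (measurable_jump h hF r r') (K := 2 * K) (fun p => abs_jump_le hK r r' p.1 p.2)
  have e : ∀ a : Config 𝔾, (stripOver B r r').indicator (fun C => jump I body Λ F r r' a C) =
      jump I body Λ F r r' a := fun a => by
    ext C
    by_cases hC : C ∈ stripOver B r r'
    · simp [hC]
    · simp [hC, jump_eq_zero hloc hC]
  simp only [e] at key
  rw [key]
  refine integral_congr_ae (ae_restrict_of_ae ?_)
  filter_upwards [ae_goodPath_clanProcess hfin] with ω hω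
  exact setIntegral_jump h hF hK hB hBfin hloc hr hrr (hω.valid r hr)

/-- Along almost every path, the increments of `F` are eventually the sums of the contributions of
the strips of cylinders. -/
lemma ae_eventually_increment_eq (hf : IsFreeCylinders P ν Γ T S)
    (hfin : ∀ᵐ ω ∂P, ∀ t : ℝ, (clanSince I body Λ (cylinders Γ T S ω) t).Finite)
    {s t : ℝ} (hs : 0 ≤ s) (hst : s ≤ t) (F : Config 𝔾 → ℝ) :
    ∀ᵐ ω ∂P, ∀ᶠ m in atTop,
      F (clanProcess I body Λ Γ T S t ω) - F (clanProcess I body Λ Γ T S s ω) =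
        ∑ k ∈ Finset.range m, ∑' i, jump I body Λ F (grid s t m k) (grid s t m (k + 1))
          (clanProcess I body Λ Γ T S (grid s t m k) ω) (cylinder Γ T S i ω) := by
  filter_upwards [hfin, ae_birth_injective hf.poisson, ae_birth_ne hf.poisson 0]
    with ω h1 h2 h3
  exact eventually_increment_eq_sum (x := fun i => cylinder Γ T S i ω) h1 h2 h3 hs hst F

/-- Along almost every path the grid sums eventually equal the increment of `F`. They are dominated
by `2 * K` times the number of cylinders over `B` in the whole strip, which is integrable. -/
lemma tendsto_setIntegral_sum_jump (h : FiniteInfluence ν I body Λ)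
    (hf : IsFreeCylinders P ν Γ T S)
    (hfin : ∀ᵐ ω ∂P, ∀ t : ℝ, (clanSince I body Λ (cylinders Γ T S ω) t).Finite)
    {F : Config 𝔾 → ℝ} (hF : Measurable F) {K : ℝ} (hK : ∀ a, |F a| ≤ K) {B : Set 𝔾}
    (hB : MeasurableSet B) (hBfin : ν B < ⊤) (hloc : LocalTo B F) {s t : ℝ} (hs : 0 ≤ s)
    (hst : s ≤ t) (V : Set Ω) :
    Tendsto (fun m => ∑ k ∈ Finset.range m, ∫ ω in V, (∑' i,
        jump I body Λ F (grid s t m k) (grid s t m (k + 1))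
          (clanProcess I body Λ Γ T S (grid s t m k) ω) (cylinder Γ T S i ω)) ∂P) atTop
      (𝓝 (∫ ω in V, (F (clanProcess I body Λ Γ T S t ω) -
        F (clanProcess I body Λ Γ T S s ω)) ∂P)) := by
  have hx := measurable_cylinder hf
  have hnm := measurable_number hx (measurableSet_stripOver hB s t)
  have hnfin := (lintegral_number_stripOver hf hB hBfin s t).ne
  have hsum : ∀ m, ∑ k ∈ Finset.range m, ∫ ω in V, (∑' i,
        jump I body Λ F (grid s t m k) (grid s t m (k + 1))
          (clanProcess I body Λ Γ T S (grid s t m k) ω) (cylinder Γ T S i ω)) ∂P =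
      ∫ ω in V, (∑ k ∈ Finset.range m, ∑' i,
        jump I body Λ F (grid s t m k) (grid s t m (k + 1))
          (clanProcess I body Λ Γ T S (grid s t m k) ω) (cylinder Γ T S i ω)) ∂P := fun m =>
    (integral_finsetSum _ fun k _ =>
      (integrable_sum_jump h hf hF hK hB hBfin hloc _ _).restrict).symm
  simp only [hsum]
  refine tendsto_integral_filter_of_dominated_convergence
    (fun ω => (ENNReal.ofReal (2 * K) * number (cylinder Γ T S) (stripOver B s t) ω).toReal)
    ?_ ?_ ?_ ?_
  · exact Eventually.of_forall fun m => (Finset.measurable_sum _ fun k _ =>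
      measurable_sum_jump h hf hF _ _).aestronglyMeasurable
  · filter_upwards [eventually_gt_atTop 0] with m hm
    refine ae_restrict_of_ae ?_
    filter_upwards [ae_lt_top hnm hnfin] with ω hω
    rw [← toReal_enorm]
    refine ENNReal.toReal_mono (ENNReal.mul_lt_top ENNReal.ofReal_lt_top hω).ne ?_
    have := sum_number_stripOver (x := cylinder Γ T S) B (grid_mono hst m) ω m
    rw [grid_zero, grid_self s t hm] at this
    rw [← this, Finset.mul_sum]
    exact (enorm_sum_le _ _).trans (Finset.sum_le_sum fun k _ =>
      enorm_tsum_jump_le hK hloc _ _ _ _ ω)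
  · refine (integrable_toReal_of_lintegral_ne_top (hnm.const_mul _).aemeasurable ?_).restrict
    rw [lintegral_const_mul _ hnm]
    exact ENNReal.mul_ne_top ENNReal.ofReal_ne_top hnfin
  · refine ae_restrict_of_ae ?_
    filter_upwards [ae_eventually_increment_eq hf hfin hs hst F] with ω hω
    exact tendsto_const_nhds.congr' hω

lemma FiniteInfluence.measurable_generator (h : FiniteInfluence ν I body Λ) {F : Config 𝔾 → ℝ}
    (hF : IsTest ν F) : Measurable fun q : ℝ × Config 𝔾 => generator ν I body Λ q.1 F q.2 :=
  BackwardClan.measurable_generator h.measurable h.measurable_window h.window_lt_top h.lt_top hF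

lemma FiniteInfluence.exists_abs_generator_le (h : FiniteInfluence ν I body Λ)
    {F : Config 𝔾 → ℝ} (hF : IsTest ν F) :
    ∃ C : ℝ, 0 ≤ C ∧ ∀ u a, 0 ≤ u → Valid u a → |generator ν I body Λ u F a| ≤ C := by
  obtain ⟨K, hK⟩ := hF.bounded
  obtain ⟨B, hB, hBfin, hloc⟩ := hF.isLocal
  have hK0 : 0 ≤ K := (abs_nonneg _).trans (hK Config.empty)
  exact ⟨2 * K * (ν B).toReal, by positivity, fun u a hu ha => abs_generator_le h.measurable
    h.measurable_window h.window_lt_top h.lt_top hF.measurable hK hB hBfin hloc hu ha⟩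

lemma measurable_integral_generator (h : FiniteInfluence ν I body Λ) {F : Config 𝔾 → ℝ}
    (hF : IsTest ν F) {Y : Ω → Config 𝔾} (hY : Measurable Y) {r r' : ℝ} (hr : r ≤ r') :
    Measurable fun ω => ∫ u in r..r', generator ν I body Λ u F (Y ω) := by
  simp only [intervalIntegral.integral_of_le hr]
  have hm : Measurable fun p : Ω × ℝ => generator ν I body Λ p.2 F (Y p.1) :=
    (h.measurable_generator hF).comp (measurable_snd.prodMk (hY.comp measurable_fst))
  exact hm.stronglyMeasurable.integral_prod_right'.measurable

/-- Freezing the configuration at left grid points is undone in the limit, because the path is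
locally constant at almost every time. -/
lemma tendsto_setIntegral_sum_generator (h : FiniteInfluence ν I body Λ)
    (hf : IsFreeCylinders P ν Γ T S)
    (hfin : ∀ᵐ ω ∂P, ∀ t : ℝ, (clanSince I body Λ (cylinders Γ T S ω) t).Finite)
    {F : Config 𝔾 → ℝ} (hF : IsTest ν F) {s t : ℝ} (hs : 0 ≤ s) (hst : s ≤ t) (V : Set Ω) :
    Tendsto (fun m => ∑ k ∈ Finset.range m, ∫ ω in V,
        (∫ u in (grid s t m k)..(grid s t m (k + 1)), generator ν I body Λ u F
          (clanProcess I body Λ Γ T S (grid s t m k) ω)) ∂P) atTop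
      (𝓝 (∫ ω in V, (∫ u in s..t, generator ν I body Λ u F
        (clanProcess I body Λ Γ T S u ω)) ∂P)) := by
  obtain ⟨C, hC0, hC⟩ := h.exists_abs_generator_le hF
  have hAm := measurable_clanProcess h hf
  have hm : ∀ m k, Measurable fun ω => ∫ u in (grid s t m k)..(grid s t m (k + 1)),
      generator ν I body Λ u F (clanProcess I body Λ Γ T S (grid s t m k) ω) := fun m k =>
    measurable_integral_generator h hF (hAm _) (grid_mono hst m k.le_succ)
  have hbd : ∀ᵐ ω ∂P, ∀ m k, ‖∫ u in (grid s t m k)..(grid s t m (k + 1)),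
      generator ν I body Λ u F (clanProcess I body Λ Γ T S (grid s t m k) ω)‖ ≤
      C * (grid s t m (k + 1) - grid s t m k) := by
    filter_upwards [ae_goodPath_clanProcess hfin] with ω hω m k
    have hmono := grid_mono hst m (Nat.le_succ k)
    have h0 := hs.trans (le_grid hst m k)
    refine (intervalIntegral.norm_integral_le_of_norm_le_const (C := C) fun u hu => ?_).trans
      (by rw [abs_of_nonneg (sub_nonneg.mpr hmono)])
    rw [uIoc_of_le hmono] at hu
    exact hC u _ (h0.trans hu.1.le) ((hω.valid _ h0).mono hu.1.le)
  have hsum : ∀ m, ∑ k ∈ Finset.range m, ∫ ω in V,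
        (∫ u in (grid s t m k)..(grid s t m (k + 1)), generator ν I body Λ u F
          (clanProcess I body Λ Γ T S (grid s t m k) ω)) ∂P =
      ∫ ω in V, (∑ k ∈ Finset.range m, ∫ u in (grid s t m k)..(grid s t m (k + 1)),
        generator ν I body Λ u F (clanProcess I body Λ Γ T S (grid s t m k) ω)) ∂P := fun m =>
    (integral_finsetSum _ fun k _ => (Integrable.of_bound (hm m k).aestronglyMeasurable _
      (hbd.mono fun ω hω => hω m k)).restrict).symm
  simp only [hsum]
  refine tendsto_integral_filter_of_dominated_convergence (fun _ => C * (t - s)) ?_ ?_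
    (integrable_const _) ?_
  · exact Eventually.of_forall fun m => (Finset.measurable_sum _ fun k _ =>
      hm m k).aestronglyMeasurable
  · filter_upwards [eventually_gt_atTop 0] with m hm0
    refine ae_restrict_of_ae ?_
    filter_upwards [hbd] with ω hω
    refine (norm_sum_le_of_le _ fun k _ => hω m k).trans ?_
    rw [← Finset.mul_sum, Finset.sum_range_sub, grid_zero, grid_self s t hm0]
  · refine ae_restrict_of_ae ?_
    filter_upwards [ae_goodPath_clanProcess hfin] with ω hω
    refine tendsto_sum_grid_integral (φ := fun r u => generator ν I body Λ u F
      (clanProcess I body Λ Γ T S r ω)) (C := C) hst (fun r => ?_) (fun r u hr hru _ => ?_) ?_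
    · exact (h.measurable_generator hF).comp measurable_prodMk_right
    · exact hC u _ (hs.trans (hr.trans hru)) ((hω.valid r (hs.trans hr)).mono hru)
    · filter_upwards [ae_eventually_eq_of_mono hω.mono] with u hu hsu
      refine tendsto_const_nhds.congr' ?_
      filter_upwards [nhdsWithin_le_nhds (hu (hs.trans_lt hsu))] with r hr
      rw [hr]

lemma integrable_integral_generator (h : FiniteInfluence ν I body Λ) {X : ℝ → Ω → Config 𝔾}
    (hX : ∀ t, 0 ≤ t → Measurable (X t)) (hg : ∀ᵐ ω ∂P, GoodPath fun t => X t ω)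
    {F : Config 𝔾 → ℝ} (hF : IsTest ν F) {s t : ℝ} (hs : 0 ≤ s) (hst : s ≤ t) :
    Integrable (fun ω => ∫ u in s..t, generator ν I body Λ u F (X u ω)) P := by
  obtain ⟨Y, hY, hYg, hYX⟩ := exists_modification hX hg
  obtain ⟨C, -, hC⟩ := h.exists_abs_generator_le hF
  refine (integral_interval_process (Q := P) hs hst hY hYg (h.measurable_generator hF) hC).1.congr ?_
  filter_upwards [hYX] with ω hω
  simp only [hω]

theorem setIntegral_increment_clanProcess (h : FiniteInfluence ν I body Λ)
    (hf : IsFreeCylinders P ν Γ T S)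
    (hfin : ∀ᵐ ω ∂P, ∀ t : ℝ, (clanSince I body Λ (cylinders Γ T S ω) t).Finite)
    {F : Config 𝔾 → ℝ} (hF : IsTest ν F) {s t : ℝ} (hs : 0 ≤ s) (hst : s ≤ t) {V : Set Ω}
    (hV : MeasurableSet[history (clanProcess I body Λ Γ T S) s] V) :
    ∫ ω in V, (F (clanProcess I body Λ Γ T S t ω) - F (clanProcess I body Λ Γ T S s ω)) ∂P =
      ∫ ω in V, (∫ u in s..t, generator ν I body Λ u F (clanProcess I body Λ Γ T S u ω)) ∂P := by
  obtain ⟨K, hK⟩ := hF.bounded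
  obtain ⟨B, hB, hBfin, hloc⟩ := hF.isLocal
  refine tendsto_nhds_unique
    (tendsto_setIntegral_sum_jump h hf hfin hF.measurable hK hB hBfin hloc hs hst V)
    ((tendsto_setIntegral_sum_generator h hf hfin hF hs hst V).congr fun m => ?_)
  refine Finset.sum_congr rfl fun k _ => ?_
  refine (setIntegral_sum_jump h hf hfin hF.measurable hK hB hBfin hloc
    (hs.trans (le_grid hst m k)) (grid_mono hst m k.le_succ) ?_).symm
  have hle : history (clanProcess I body Λ Γ T S) s ≤
      history (clanProcess I body Λ Γ T S) (grid s t m k) :=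
    biSup_mono fun u hu => ⟨hu.1, hu.2.trans (le_grid hst m k)⟩
  exact hle _ hV

/-- The clan, explored backwards in time, solves the evolution equation. -/
theorem solvesEvolution_clanProcess (h : FiniteInfluence ν I body Λ)
    (hf : IsFreeCylinders P ν Γ T S)
    (hfin : ∀ᵐ ω ∂P, ∀ t : ℝ, (clanSince I body Λ (cylinders Γ T S ω) t).Finite) :
    SolvesEvolution P ν I body Λ (clanProcess I body Λ Γ T S) where
  measurable t _ := measurable_clanProcess h hf t
  init := Eventually.of_forall fun _ => clanConfig_zero
  mono := (ae_goodPath_clanProcess hfin).mono fun _ hω => hω.mono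
  right_cont := (ae_goodPath_clanProcess hfin).mono fun _ hω => hω.right
  integrable F hF s t hs hst := integrable_integral_generator h
    (fun t _ => measurable_clanProcess h hf t) (ae_goodPath_clanProcess hfin) hF hs hst
  evolution F hF s t hs hst := by
    have hAm : ∀ t, 0 ≤ t → Measurable (clanProcess I body Λ Γ T S t) := fun t _ =>
      measurable_clanProcess h hf t
    have hle := history_le hAm s
    obtain ⟨K, hK⟩ := hF.bounded
    have hint : Integrable (fun ω => F (clanProcess I body Λ Γ T S t ω) -
        F (clanProcess I body Λ Γ T S s ω)) P :=
      Integrable.of_bound ((hF.measurable.comp (hAm t (hs.trans hst))).sub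
        (hF.measurable.comp (hAm s hs))).aestronglyMeasurable (2 * K)
        (Eventually.of_forall fun ω => abs_increment_le hK _ _)
    have hint' := integrable_integral_generator h hAm (ae_goodPath_clanProcess hfin) hF hs hst
    refine ae_eq_condExp_of_forall_setIntegral_eq hle hint'
      (fun V _ _ => integrable_condExp.integrableOn) (fun V hV _ => ?_)
      stronglyMeasurable_condExp.aestronglyMeasurable
    rw [setIntegral_condExp hle hint hV]
    exact setIntegral_increment_clanProcess h hf hfin hF hs hst hV

end ClanSolves

end BackwardClan

namespace BackwardClan

/-! ### The evolution equation in differential form -/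

section Differential

variable {𝔾 E : Type*} [MeasurableSpace 𝔾] [StandardBorelSpace 𝔾]
  {ν : Measure 𝔾} [SigmaFinite ν] {I : 𝔾 → 𝔾 → Prop} {body : 𝔾 → Set E} {Λ : Set E}
  {Ω : Type*} [MeasurableSpace Ω] {P : Measure Ω} [IsProbabilityMeasure P]
  {X : ℝ → Ω → Config 𝔾}

/-- Averages over small intervals to the right of a point of right-continuity. -/
lemma tendsto_average_right {f : ℝ → ℝ} {t : ℝ} (hf : Measurable f)
    (hc : ContinuousWithinAt f (Ici t) t) :
    Tendsto (fun h : ℝ => h⁻¹ * ∫ u in t..(t + h), f u) (𝓝[>] 0) (𝓝 (f t)) := by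
  rw [Metric.tendsto_nhds]
  intro ε hε
  obtain ⟨δ, hδ, hδf⟩ := Metric.continuousWithinAt_iff.mp hc (ε / 2) (half_pos hε)
  filter_upwards [Ioo_mem_nhdsGT hδ] with h hh
  have hle : t ≤ t + h := by linarith [hh.1]
  have hclose : ∀ u ∈ Ι t (t + h), ‖f u - f t‖ ≤ ε / 2 := fun u hu => by
    rw [uIoc_of_le hle] at hu
    refine (hδf (mem_Ici.mpr hu.1.le) ?_).le
    rw [Real.dist_eq, abs_of_pos (by linarith [hu.1])]
    linarith [hu.2, hh.2]
  have hint : IntervalIntegrable (fun u => f u - f t) volume t (t + h) := by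
    rw [intervalIntegrable_iff]
    exact IntegrableOn.of_bound (by simp [uIoc_of_le hle]) (hf.sub_const _).aestronglyMeasurable
      (ε / 2) ((ae_restrict_iff' measurableSet_uIoc).mpr (ae_of_all _ hclose))
  have h1 : ∫ u in t..(t + h), f u = (∫ u in t..(t + h), (f u - f t)) + h * f t := by
    rw [← intervalIntegral.integral_congr (f := fun u => (f u - f t) + f t) fun u _ => by
      simp, intervalIntegral.integral_add hint intervalIntegrable_const,
      intervalIntegral.integral_const, smul_eq_mul, add_sub_cancel_left]
  have h2 := intervalIntegral.norm_integral_le_of_norm_le_const hclose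
  rw [add_sub_cancel_left, abs_of_pos hh.1] at h2
  rw [Real.dist_eq, h1, mul_add, inv_mul_cancel_left₀ hh.1.ne', add_sub_cancel_right, abs_mul,
    abs_of_pos (inv_pos.mpr hh.1)]
  calc h⁻¹ * |∫ u in t..(t + h), (f u - f t)| ≤ h⁻¹ * (ε / 2 * h) := by
        gcongr
        · exact (inv_pos.mpr hh.1).le
        · exact h2
    _ = ε / 2 := by field_simp [hh.1.ne']
    _ < ε := half_lt_self hε

/-- By the evolution equation the conditional error is the conditional expectation of `R h`, the
time average of the generator minus its value at `t`. Conditional expectation contracts `L¹`, and `R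
h` is bounded and tends to `0` along almost every path. -/
theorem SolvesEvolution.tendsto_difference_quotient (hinf : FiniteInfluence ν I body Λ)
    (hX : SolvesEvolution P ν I body Λ X) {F : Config 𝔾 → ℝ} (hF : IsTest ν F) {t : ℝ}
    (ht : 0 ≤ t)
    (hc : ∀ a, ContinuousWithinAt (fun u => generator ν I body Λ u F a) (Ici t) t) :
    Tendsto (fun h : ℝ => eLpNorm (fun ω =>
        (P[fun ω' => h⁻¹ * (F (X (t + h) ω') - F (X t ω')) | history X t]) ω
          - generator ν I body Λ t F (X t ω)) 1 P) (𝓝[>] 0) (𝓝 0) := by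
  obtain ⟨C, hC0, hC⟩ := hinf.exists_abs_generator_le hF
  have hgood := hX.ae_goodPath
  have hle := history_le hX.measurable t
  have hgm := hinf.measurable_generator hF
  have hLm : Measurable[history X t] fun ω => generator ν I body Λ t F (X t ω) := by
    have h1 : Measurable fun a => generator ν I body Λ t F a := hgm.comp measurable_prodMk_left
    intro D hD
    exact measurableSet_history ht le_rfl (h1 hD)
  have hLint : Integrable (fun ω => generator ν I body Λ t F (X t ω)) P :=
    Integrable.of_bound (hLm.mono hle le_rfl).aestronglyMeasurable C
      (hgood.mono fun ω hω => hC t _ ht (hω.valid t ht))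
  set R : ℝ → Ω → ℝ := fun h ω =>
    h⁻¹ * (∫ u in t..(t + h), generator ν I body Λ u F (X u ω)) -
      generator ν I body Λ t F (X t ω) with hR
  have hintI : ∀ h, 0 < h →
      Integrable (fun ω => ∫ u in t..(t + h), generator ν I body Λ u F (X u ω)) P := fun h hh =>
    hX.integrable F hF t (t + h) ht (by linarith)
  have hRint : ∀ h, 0 < h → Integrable (R h) P := fun h hh => ((hintI h hh).const_mul _).sub hLint
  have hcond : ∀ h, 0 < h → (fun ω =>
      (P[fun ω' => h⁻¹ * (F (X (t + h) ω') - F (X t ω')) | history X t]) ω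
          - generator ν I body Λ t F (X t ω)) =ᵐ[P] P[R h | history X t] := by
    intro h hh
    have e1 : P[R h | history X t] =ᵐ[P]
        P[fun ω => h⁻¹ * (∫ u in t..(t + h), generator ν I body Λ u F (X u ω)) | history X t] -
          P[fun ω => generator ν I body Λ t F (X t ω) | history X t] :=
      condExp_sub ((hintI h hh).const_mul _) hLint _
    have e2 := condExp_of_stronglyMeasurable hle hLm.stronglyMeasurable hLint
    have e3 := condExp_smul (μ := P) h⁻¹
      (fun ω => ∫ u in t..(t + h), generator ν I body Λ u F (X u ω)) (history X t)
    have e4 := condExp_smul (μ := P) h⁻¹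
      (fun ω => F (X (t + h) ω) - F (X t ω)) (history X t)
    have e5 := hX.evolution F hF t (t + h) ht (by linarith)
    filter_upwards [e1, e3, e4, e5] with ω h1 h3 h4 h5
    rw [h1, Pi.sub_apply, e2]
    congr 1
    exact h4.trans ((congrArg (h⁻¹ * ·) h5).trans h3.symm)
  have hbound : ∀ h, 0 < h → ∀ᵐ ω ∂P, ‖R h ω‖ₑ ≤ ENNReal.ofReal (2 * C) := by
    intro h hh
    filter_upwards [hgood] with ω hω
    rw [Real.enorm_eq_ofReal_abs]
    refine ENNReal.ofReal_le_ofReal ?_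
    have h1 : ‖∫ u in t..(t + h), generator ν I body Λ u F (X u ω)‖ ≤ C * |t + h - t| :=
      intervalIntegral.norm_integral_le_of_norm_le_const fun u hu => by
        rw [uIoc_of_le (by linarith)] at hu
        exact hC u _ (ht.trans hu.1.le) (hω.valid u (ht.trans hu.1.le))
    rw [add_sub_cancel_left, abs_of_pos hh, Real.norm_eq_abs] at h1
    have h2 := hC t _ ht (hω.valid t ht)
    have h3 : |h⁻¹ * ∫ u in t..(t + h), generator ν I body Λ u F (X u ω)| ≤ C := by
      rw [abs_mul, abs_of_pos (inv_pos.mpr hh), inv_mul_le_iff₀ hh, mul_comm]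
      exact h1
    exact (abs_sub _ _).trans (by linarith)
  have hlim : ∀ᵐ ω ∂P, Tendsto (fun h => ‖R h ω‖ₑ) (𝓝[>] 0) (𝓝 0) := by
    filter_upwards [hgood] with ω hω
    have h1 := tendsto_average_right (f := fun u => generator ν I body Λ u F (X t ω)) (t := t)
      (hgm.comp measurable_prodMk_right) (hc _)
    -- The path keeps the value `X t ω` on `(t, δ)`, so right-continuity is needed only for the
    -- generator at a fixed configuration.
    obtain ⟨δ, hδ, hδX⟩ := mem_nhdsGT_iff_exists_Ioo_subset.mp (hω.right t ht)
    have hδ' : (0 : ℝ) < δ - t := sub_pos.mpr hδ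
    have h2 : Tendsto (fun h => R h ω) (𝓝[>] 0) (𝓝 0) := by
      have h3 := h1.sub_const (generator ν I body Λ t F (X t ω))
      rw [sub_self] at h3
      refine h3.congr' ?_
      filter_upwards [Ioo_mem_nhdsGT hδ'] with h hh
      simp only [hR]
      congr 2
      refine intervalIntegral.integral_congr_ae (ae_of_all _ fun u hu => ?_)
      rw [uIoc_of_le (by linarith [hh.1])] at hu
      have : X u ω = X t ω := hδX ⟨hu.1, by linarith [hu.2, hh.2]⟩
      rw [this]
    have h4 := h2.enorm
    rwa [enorm_zero] at h4
  have hmain : Tendsto (fun h => ∫⁻ ω, ‖R h ω‖ₑ ∂P) (𝓝[>] 0) (𝓝 0) := by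
    have h1 := tendsto_lintegral_filter_of_dominated_convergence' (μ := P) (l := 𝓝[>] (0 : ℝ))
      (F := fun h ω => ‖R h ω‖ₑ) (f := fun _ => 0) (fun _ => ENNReal.ofReal (2 * C))
      (eventually_nhdsWithin_of_forall fun h hh => (hRint h hh).aestronglyMeasurable.enorm)
      (eventually_nhdsWithin_of_forall hbound) (by simp [ENNReal.mul_eq_top]) hlim
    simpa using h1
  refine tendsto_of_tendsto_of_tendsto_of_le_of_le' tendsto_const_nhds hmain
    (Eventually.of_forall fun _ => zero_le) ?_
  refine eventually_nhdsWithin_of_forall fun h hh => ?_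
  rw [eLpNorm_congr_ae (hcond h hh), ← eLpNorm_one_eq_lintegral_enorm]
  exact eLpNorm_condExp_le_eLpNorm _ le_rfl

end Differential

end BackwardClan

/-! ### Assembly of the theorem. -/

theorem theorem2 {𝔾 : Type*} [MeasurableSpace 𝔾] [StandardBorelSpace 𝔾]
    (ν : Measure 𝔾) [SigmaFinite ν]
    -- incompatibility of individuals, the space they live in, and the window
    (I : 𝔾 → 𝔾 → Prop) (hI : MeasurableSet {p : 𝔾 × 𝔾 | I p.1 p.2})
    {E : Type*} (body : 𝔾 → Set E) (Λ : Set E)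
    (hΛ : MeasurableSet (BackwardClan.meeting body Λ))
    (hΛfin : ν (BackwardClan.meeting body Λ) < ⊤)
    (hIfin : ∀ γ, ν {θ | I γ θ} < ⊤)
    -- the cylinders of the free process
    {Ω : Type*} [MeasurableSpace Ω] (P : Measure Ω) [IsProbabilityMeasure P]
    {J : Type*} [Countable J] (Γ : J → Ω → 𝔾) (T S : J → Ω → ℝ)
    (hfree : BackwardClan.IsFreeCylinders P ν Γ T S)
    -- almost surely, finitely many members of the clan are born in bounded time intervals
    (hfin : ∀ᵐ ω ∂P, ∀ t : ℝ, (BackwardClan.clanSince I body Λ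
      (BackwardClan.cylinders Γ T S ω) t).Finite)
    -- the part of the clan born after `-t`
    (A : ℝ → Ω → BackwardClan.Config 𝔾)
    (hA : A = fun t ω => BackwardClan.clanConfig I body Λ (BackwardClan.cylinders Γ T S ω) t) :
    -- it starts from `∅`, grows, and satisfies the evolution equation
    BackwardClan.SolvesEvolution P ν I body Λ A ∧
    -- the evolution equation in differential form
    (∀ F, BackwardClan.IsTest ν F → ∀ t : ℝ, 0 ≤ t →
      (∀ a, ContinuousWithinAt (fun u => BackwardClan.generator ν I body Λ u F a) (Ici t) t) →
      Tendsto (fun h : ℝ => eLpNorm (fun ω =>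
          (P[fun ω' => h⁻¹ * (F (A (t + h) ω') - F (A t ω')) | BackwardClan.history A t]) ω
            - BackwardClan.generator ν I body Λ t F (A t ω)) 1 P)
        (𝓝[>] 0) (𝓝 0)) ∧
    -- it is a Markov process
    (∀ s t : ℝ, 0 ≤ s → s ≤ t → ∀ D : Set (BackwardClan.Config 𝔾), MeasurableSet D →
      P[(A t ⁻¹' D).indicator (fun _ => (1 : ℝ)) | BackwardClan.history A s] =ᵐ[P]
        P[(A t ⁻¹' D).indicator (fun _ => (1 : ℝ)) |
          MeasurableSpace.comap (A s) inferInstance]) ∧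
    -- its limit as `t → ∞` is the clan
    (∀ᵐ ω ∂P, (⋃ t ∈ Ici (0 : ℝ), (A t ω).carrier) =
      BackwardClan.clan I body Λ (BackwardClan.cylinders Γ T S ω)) ∧
    -- initial condition and evolution equation determine the law of the process and of its limit
    (∀ (Ω' : Type*) [MeasurableSpace Ω'] (P' : Measure Ω') [IsProbabilityMeasure P']
      (X : ℝ → Ω' → BackwardClan.Config 𝔾), BackwardClan.SolvesEvolution P' ν I body Λ X →
      (∀ (n : ℕ) (t : Fin n → ℝ), (∀ i, 0 ≤ t i) →
        IdentDistrib (fun ω i => X (t i) ω) (fun ω i => A (t i) ω) P' P) ∧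
      (∀ (n : ℕ) (D : Fin n → Set (BackwardClan.Cylinder 𝔾)), (∀ i, MeasurableSet (D i)) →
        IdentDistrib (fun ω i => ((⋃ t ∈ Ici (0 : ℝ), (X t ω).carrier) ∩ D i).encard)
          (fun ω i => (BackwardClan.clan I body Λ (BackwardClan.cylinders Γ T S ω) ∩ D i).encard)
          P' P)) := by
  subst hA
  have hinf : BackwardClan.FiniteInfluence ν I body Λ := ⟨hI, hΛ, hΛfin, hIfin⟩
  have hsolves : BackwardClan.SolvesEvolution P ν I body Λ
      (BackwardClan.clanProcess I body Λ Γ T S) :=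
    BackwardClan.solvesEvolution_clanProcess hinf hfree hfin
  have hlim : ∀ᵐ ω ∂P, (⋃ t ∈ Ici (0 : ℝ), (BackwardClan.clanProcess I body Λ Γ T S t ω).carrier) =
      BackwardClan.clan I body Λ (BackwardClan.cylinders Γ T S ω) := by
    -- Almost surely no cylinder is born at time `0`, so every member of the clan is born strictly
    -- before `0` and appears in the process at some finite time.
    filter_upwards [hfin, BackwardClan.ae_birth_ne hfree.poisson 0] with ω h1 h2
    exact BackwardClan.iUnion_clanConfig h1 (by rintro _ ⟨i, rfl⟩; exact h2 i)
  refine ⟨hsolves, fun F hF t ht hc => BackwardClan.SolvesEvolution.tendsto_difference_quotient hinf hsolves hF ht hc,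
    fun s t hs hst D hD => BackwardClan.SolvesEvolution.markov hinf hsolves hs hst hD, hlim, ?_⟩
  intro Ω' _ P' _ X hX
  refine ⟨fun n t ht => BackwardClan.SolvesEvolution.identDistrib hinf hX hsolves ht, fun n D hD => ?_⟩
  have h1 := BackwardClan.SolvesEvolution.identDistrib_limit hinf hX hsolves hD
  refine h1.trans (IdentDistrib.of_ae_eq h1.aemeasurable_snd ?_)
  filter_upwards [hlim] with ω hω
  simp only [hω]
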